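/- Let $G$ be a noncompact connected Lie group with Lie algebra $\mathfrak g$ (identified with the left-invariant vector fields on $G$), let $\mu$ be a left Haar measure on $G$, let $\langle\cdot,\cdot\rangle$ be a scalar product on $\mathfrak g$, and let $\mathcal H\subseteq\mathfrak g$ be a linear subspace which generates $\mathfrak g$ as a Lie algebra. Let $d$ be the associated left-invariant Carnot--Carathéodory distance: $d(x,y)=\inf_\gamma\int_0^1|\gamma'(t)|\,dt$, where $\gamma$ runs through the absolutely continuous curves $\gamma\colon[0,1]\to G$ from $x$ to $y$ such that $\gamma'(t)\in\mathcal H_{\gamma(t)}=\{X_{\gamma(t)}: X\in\mathcal H\}$ for almost every $t$, and $|X_x|=\langle X,X\rangle^{1/2}$ for $X\in\mathcal H$, $x\in G$. Balls $B=B(x,r)$, $r>0$, are open balls with respect to $d$, and $\lambda B=B(x,\lambda r)$. For $R>0$ let $\mathcal B_R$ be the set of all balls of radius at most $R$. Let $R>0$ and let $w\in L^1_{\mathrm{loc}}(\mu)$ be a non-negative function which is not almost everywhere $0$. Let $\mu_w$ be the measure with density $w$ with respect to $\mu$. Consider the following conditions. (1) There are $\varepsilon,\delta\in(0,1)$ such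 that, for every $B\in\mathcal B_R$ and every Borel subset $F$ of $B$, $$\mu(F)\le\varepsilon\mu(B)\implies\mu_w(F)\le\delta\mu_w(B).$$ (2) There are $p\in[1,\infty)$ and $C>0$ such that, for every $B\in\mathcal B_R$ with $\mu_w(B)>0$ and every Borel subset $F$ of $B$, $$\frac{\mu_w(F)}{\mu_w(B)}\ge C\Big(\frac{\mu(F)}{\mu(B)}\Big)^p.$$ (3) There are $p\in(1,\infty)$ and $C>0$ such that, for every $B\in\mathcal B_R$, with $p'=p/(p-1)$ and with the conventions $0^{-s}=\infty$ for $s>0$ and $0\cdot\infty=0$, $$\Big(\frac1{\mu(B)}\int_B w\,d\mu\Big)\Big(\frac1{\mu(B)}\int_B w^{-p'/p}\,d\mu\Big)^{p/p'}\le C.$$ (4) There are $\delta,c>0$ such that, for every $B\in\mathcal B_R$, $$\mu\Big(\Big\{x\in B: w(x)\ge\delta\frac1{\mu(B)}\int_B w\,d\mu\Big\}\Big)\ge c\,\mu(B).$$ Then (4) implies (1), (3) implies (2), (2) implies (1), and (3) implies (4). If, moreover, there is a constant $C>0$ such that $\mu_w(5B)\le C\mu_w(B)$ for every $B\in\mathcal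 B_R$, then conditions (1)--(4) are equivalent. -/

import Mathlib

open Set MeasureTheory
open scoped Manifold ContDiff ENNReal

/-- Over the reals, the smoothness required for the Lie algebra structure on the tangent space at
the identity is finite, so that smooth Lie groups have it. -/
instance instLEInftyMinSmoothnessReal : ENat.LEInfty (minSmoothness ℝ 3) :=
  ⟨by
    rw [minSmoothness_of_isRCLikeNormedField]
    exact ENat.LEInfty.out⟩

namespace SubRiemannian

noncomputable section

variable {n : ℕ} {G : Type*} [TopologicalSpace G] [ChartedSpace (EuclideanSpace ℝ (Fin n)) G]

/-- Absolute continuity on `[0, 1]` of a curve in a manifold: the curve is continuous, and its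
reading in each preferred chart is absolutely continuous on each subinterval which the curve maps
into the domain of that chart. -/
def IsAbsContCurve (n : ℕ) {G : Type*} [TopologicalSpace G]
    [ChartedSpace (EuclideanSpace ℝ (Fin n)) G] (γ : ℝ → G) : Prop :=
  ContinuousOn γ (Icc 0 1) ∧
    ∀ (x : G) (a b : ℝ), 0 ≤ a → a ≤ b → b ≤ 1 →
      MapsTo γ (Icc a b) (chartAt (EuclideanSpace ℝ (Fin n)) x).source →
      AbsolutelyContinuousOnInterval (fun t => chartAt (EuclideanSpace ℝ (Fin n)) x (γ t)) a b

/-- The velocity `γ'(t)` (it is `0` if `γ` is not differentiable at `t`). -/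
def velocity (n : ℕ) {G : Type*} [TopologicalSpace G]
    [ChartedSpace (EuclideanSpace ℝ (Fin n)) G] (γ : ℝ → G) (t : ℝ) : TangentSpace (𝓡 n) (γ t) :=
  mfderiv 𝓘(ℝ, ℝ) (𝓡 n) γ t (1 : ℝ)

variable [Group G]

/-- The left-invariant distribution `{X_x : X ∈ 𝓗}` generated by a subspace `𝓗` of the Lie algebra. -/
def distribution (𝓗 : Submodule ℝ (GroupLieAlgebra (𝓡 n) G)) (x : G) :
    Set (TangentSpace (𝓡 n) x) :=
  {v | ∃ X ∈ 𝓗, v = mulInvariantVectorField X x}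

/-- The left-invariant norm on tangent vectors: `v ∈ T_x G` is moved to the identity by the
differential of the left translation by `x⁻¹`, and measured there with the scalar product `Q`. -/
def tangentNorm (Q : LinearMap.BilinForm ℝ (GroupLieAlgebra (𝓡 n) G)) (x : G)
    (v : TangentSpace (𝓡 n) x) : ℝ :=
  let X : GroupLieAlgebra (𝓡 n) G := mfderiv (𝓡 n) (𝓡 n) (fun y : G => x⁻¹ * y) x v
  Real.sqrt (Q X X)

/-- The set of horizontal curves from `x` to `y`. -/
def horizontalCurves (𝓗 : Submodule ℝ (GroupLieAlgebra (𝓡 n) G)) (x y : G) : Set (ℝ → G) :=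
  {γ | IsAbsContCurve n γ ∧ γ 0 = x ∧ γ 1 = y ∧
    ∀ᵐ t ∂(volume.restrict (Icc (0 : ℝ) 1)),
      MDifferentiableAt 𝓘(ℝ, ℝ) (𝓡 n) γ t ∧ velocity n γ t ∈ distribution 𝓗 (γ t)}

/-- The length of a curve parametrized by `[0, 1]`. -/
def curveLength (Q : LinearMap.BilinForm ℝ (GroupLieAlgebra (𝓡 n) G)) (γ : ℝ → G) : ℝ≥0∞ :=
  ∫⁻ t in Icc (0 : ℝ) 1, ENNReal.ofReal (tangentNorm Q (γ t) (velocity n γ t))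

/-- The Carnot–Carathéodory distance. -/
def ccDist (𝓗 : Submodule ℝ (GroupLieAlgebra (𝓡 n) G))
    (Q : LinearMap.BilinForm ℝ (GroupLieAlgebra (𝓡 n) G)) (x y : G) : ℝ≥0∞ :=
  ⨅ γ ∈ horizontalCurves 𝓗 x y, curveLength Q γ

/-- The open ball `B(x, r)` for the Carnot–Carathéodory distance. -/
def ccBall (𝓗 : Submodule ℝ (GroupLieAlgebra (𝓡 n) G))
    (Q : LinearMap.BilinForm ℝ (GroupLieAlgebra (𝓡 n) G)) (x : G) (r : ℝ) : Set G :=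
  {y | ccDist 𝓗 Q x y < ENNReal.ofReal r}

end

end SubRiemannian

namespace LocalMuckenhoupt

noncomputable section

/- In this section `ball x r` is the ball of centre `x` and radius `r`, `μ` is the reference measure
and `w` the weight. -/
variable {G : Type*} [MeasurableSpace G]

/-- The measure `μ_w` with density `w` with respect to `μ`. -/
def weightMeasure (μ : Measure G) (w : G → ℝ) : Measure G :=
  μ.withDensity (fun x => ENNReal.ofReal (w x))

/-- Sets that are small for `μ` are not almost everything for `μ_w`, uniformly on the balls of radius
at most `R`. -/
def Cond1 (ball : G → ℝ → Set G) (μ : Measure G) (w : G → ℝ) (R : ℝ) : Prop :=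
  ∃ ε ∈ Ioo (0 : ℝ) 1, ∃ δ ∈ Ioo (0 : ℝ) 1, ∀ (x : G) (r : ℝ), 0 < r → r ≤ R →
    ∀ F : Set G, MeasurableSet F → F ⊆ ball x r →
      μ F ≤ ENNReal.ofReal ε * μ (ball x r) →
        weightMeasure μ w F ≤ ENNReal.ofReal δ * weightMeasure μ w (ball x r)

/-- Power lower bound of `μ_w` in terms of `μ` on the balls of radius at most `R`. The inequality is required on the balls of positive `μ_w`-measure, where its
left-hand side is meaningful. -/
def Cond2 (ball : G → ℝ → Set G) (μ : Measure G) (w : G → ℝ) (R : ℝ) : Prop :=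
  ∃ p : ℝ, 1 ≤ p ∧ ∃ C : ℝ, 0 < C ∧ ∀ (x : G) (r : ℝ), 0 < r → r ≤ R →
    0 < weightMeasure μ w (ball x r) →
    ∀ F : Set G, MeasurableSet F → F ⊆ ball x r →
      weightMeasure μ w F / weightMeasure μ w (ball x r) ≥
        ENNReal.ofReal C * (μ F / μ (ball x r)) ^ p

/-- The `A_p` condition for some `p > 1` on the balls of radius at most `R`. Negative powers of `0` are `∞`, and `0 * ∞ = 0`. -/
def Cond3 (ball : G → ℝ → Set G) (μ : Measure G) (w : G → ℝ) (R : ℝ) : Prop :=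
  ∃ p p' : ℝ, p.HolderConjugate p' ∧ ∃ C : ℝ, 0 < C ∧ ∀ (x : G) (r : ℝ), 0 < r → r ≤ R →
    (⨍⁻ y in ball x r, ENNReal.ofReal (w y) ∂μ) *
      (⨍⁻ y in ball x r, ENNReal.ofReal (w y) ^ (-(p' / p)) ∂μ) ^ (p / p') ≤ ENNReal.ofReal C

/-- On a fixed proportion of each ball of radius at most `R`, the weight is bounded below by a fixed
multiple of its average. -/
def Cond4 (ball : G → ℝ → Set G) (μ : Measure G) (w : G → ℝ) (R : ℝ) : Prop :=
  ∃ δ : ℝ, 0 < δ ∧ ∃ c : ℝ, 0 < c ∧ ∀ (x : G) (r : ℝ), 0 < r → r ≤ R →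
    μ {y ∈ ball x r | ENNReal.ofReal (w y) ≥
        ENNReal.ofReal δ * ⨍⁻ z in ball x r, ENNReal.ofReal (w z) ∂μ} ≥
      ENNReal.ofReal c * μ (ball x r)

/-- `μ_w(5B) ≤ C μ_w(B)` for some constant `C` and all balls `B` of radius at most `R`. -/
def FiveDoubling (ball : G → ℝ → Set G) (μ : Measure G) (w : G → ℝ) (R : ℝ) : Prop :=
  ∃ C : ℝ, 0 < C ∧ ∀ (x : G) (r : ℝ), 0 < r → r ≤ R →
    weightMeasure μ w (ball x (5 * r)) ≤ ENNReal.ofReal C * weightMeasure μ w (ball x r)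

end

end LocalMuckenhoupt

open SubRiemannian LocalMuckenhoupt

/-! Four of the implications are elementary and hold ball by ball. If the weight is at least a fixed
multiple of its average on a fixed proportion of `B`, a set of small measure cannot absorb that
part, so (4) gives (1). Under (2) the complement of a set of at most half the measure carries a
fixed share of the weight, which is (1). With `s = p'/p`, condition (3) bounds the integral of
`w^(-s)`; Hölder's inequality applied to `1 = w^(1/p) w^(-1/p)` then gives (2), and Chebyshev's
inequality for `w^(-s)` gives (4).

The substance is that (1) and the doubling of the weighted measure `ν` imply (3). This is proved in
`cond3_of_cond1` for a metric in which points can be interpolated (`LengthProperty`) and the measure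
of a ball depends only on its radius. Three facts carry it. Doubling of `μ`: in a length space a
doubling measure puts little mass near the boundary of a ball, so `B(x, (1-η)r)` has more than the
fraction `δ` of the weight, and (1) forces it to have at least the fraction `ε` of the measure.
Iteration makes `μ` doubling, so Lebesgue's differentiation theorem is available. Level sets
(`measure_lt_le_weightMeasure_lt`): when `t` is small compared with the average of `w` on `B`,
almost every point of `{w < t}` lies in a ball inside `B`, chosen nearly as large as possible among
those of average at most `t`. Its average is then comparable to `t`, and by (1) a fixed share of its
weight sits in `{w < t/ε}`. Vitali's lemma gives `μ{w < t} ≤ (C/t) ν{w < t/ε}`. Decay: splitting the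
right-hand side at the level `t/(2C)` shows that the measure of `{w < a}` shrinks by a factor `θ <
1` whenever `a` is divided by a fixed `M`. Summing over layers bounds the average of a small
negative power of `w`, which is (3).

It remains to see that Carnot–Carathéodory balls are of this kind. Cutting nearly minimal curves
gives the length property, left translations preserve lengths, and an estimate in a chart confines
small balls. Chow's theorem (`setOf_ccDist_lt_mem_nhds`) makes balls neighbourhoods of their
centres: conjugates of horizontal vectors by points near the identity span the Lie algebra, because
the derivative of the adjoint representation is the bracket, and a product of the corresponding
curves is open at the identity. Thus the distance is finite, induces the topology of the group, and
has relatively compact balls. -/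

namespace LocalMuckenhoupt

/-! ### The implications which need no geometry of the balls. -/

section Elementary

variable {G : Type*} [MeasurableSpace G] {ball : G → ℝ → Set G} {μ : Measure G} {w : G → ℝ} {R : ℝ}

theorem measure_le_of_le_measure_diff {ν : Measure G} {F B : Set G} {κ : ℝ}
    (hF : MeasurableSet F) (hFB : F ⊆ B) (hB : ν B ≠ ⊤) (hκ0 : 0 ≤ κ) (hκ1 : κ ≤ 1)
    (h : ENNReal.ofReal κ * ν B ≤ ν (B \ F)) : ν F ≤ ENNReal.ofReal (1 - κ) * ν B := by
  have h1 : ν F + ν (B \ F) = ν B := by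
    rw [← measure_inter_add_sdiff B hF, inter_eq_self_of_subset_right hFB]
  have h2 : ν F + ENNReal.ofReal κ * ν B ≤
      ENNReal.ofReal (1 - κ) * ν B + ENNReal.ofReal κ * ν B := by
    rw [← add_mul, ← ENNReal.ofReal_add (by linarith) hκ0, sub_add_cancel, ENNReal.ofReal_one,
      one_mul]
    exact (add_le_add le_rfl h).trans h1.le
  exact (ENNReal.add_le_add_iff_right (ENNReal.mul_ne_top ENNReal.ofReal_ne_top hB)).1 h2

theorem cond1_of_cond4 (hmeas : ∀ x r, MeasurableSet (ball x r))
    (hpos : ∀ x r, 0 < r → μ (ball x r) ≠ 0) (hfin : ∀ x r, μ (ball x r) ≠ ⊤)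
    (hwfin : ∀ x r, weightMeasure μ w (ball x r) ≠ ⊤) (hw : AEMeasurable w μ)
    (h : Cond4 ball μ w R) : Cond1 ball μ w R := by
  obtain ⟨δ, hδ, c, hc, h⟩ := h
  -- The truncations at `1/2` keep the two constants of condition (1) inside the open unit interval.
  set c' := min c 2⁻¹ with hc'
  set d := min δ 2⁻¹ with hd
  have hc'0 : 0 < c' := by positivity
  have hd0 : 0 < d := by positivity
  have hc'1 : c' ≤ 2⁻¹ := min_le_right _ _
  have hd1 : d ≤ 2⁻¹ := min_le_right _ _
  have hprod : d * (c' / 2) ≤ 2⁻¹ := by nlinarith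
  refine ⟨c' / 2, ⟨by positivity, by linarith⟩, 1 - d * (c' / 2),
    ⟨by linarith, by linarith [mul_pos hd0 (half_pos hc'0)]⟩, fun x r hr hrR F hF hFB hFμ => ?_⟩
  refine measure_le_of_le_measure_diff hF hFB (hwfin x r) (by positivity) (by linarith) ?_
  set B := ball x r
  have hf : AEMeasurable (fun y => ENNReal.ofReal (w y)) μ := hw.ennreal_ofReal
  set A := ⨍⁻ z in B, ENNReal.ofReal (w z) ∂μ with hA
  have hAm : A * μ B = weightMeasure μ w B := by
    rw [hA, setLAverage_eq, weightMeasure, withDensity_apply _ (hmeas x r),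
      ENNReal.div_mul_cancel (hpos x r hr) (hfin x r)]
  have hE := h x r hr hrR
  have hDm : MeasurableSet (B \ F) := (hmeas x r).diff hF
  calc ENNReal.ofReal (d * (c' / 2)) * weightMeasure μ w B
      = (ENNReal.ofReal d * A) * (ENNReal.ofReal (c' / 2) * μ B) := by
        rw [← hAm, ENNReal.ofReal_mul hd0.le]; ring
    _ ≤ (ENNReal.ofReal δ * A) * μ ({y ∈ B | ENNReal.ofReal (w y) ≥ ENNReal.ofReal δ * A} \ F) := by
        gcongr
        · exact min_le_left _ _
        -- The set where the weight is large has measure at least `c' μ(B)` and `F` removes at most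
        -- half of this. As `w` is only almost everywhere measurable, that set need not be
        -- measurable, so the difference is estimated by subadditivity.
        · refine le_trans ?_ (le_measure_sdiff)
          refine ENNReal.le_sub_of_add_le_left ?_ ?_
          · exact ne_top_of_le_ne_top (ENNReal.mul_ne_top ENNReal.ofReal_ne_top (hfin x r)) hFμ
          · calc μ F + ENNReal.ofReal (c' / 2) * μ B
                ≤ ENNReal.ofReal (c' / 2) * μ B + ENNReal.ofReal (c' / 2) * μ B := by gcongr
              _ = ENNReal.ofReal c' * μ B := by
                rw [← add_mul, ← ENNReal.ofReal_add (by positivity) (by positivity), add_halves]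
              _ ≤ ENNReal.ofReal c * μ B := by gcongr; exact min_le_left _ _
              _ ≤ _ := hE
    _ ≤ (ENNReal.ofReal δ * A) *
          μ.restrict (B \ F) {y | ENNReal.ofReal δ * A ≤ ENNReal.ofReal (w y)} := by
        refine mul_le_mul_right ?_ _
        rw [Measure.restrict_apply' hDm]
        refine measure_mono fun y hy => ⟨hy.1.2, hy.1.1, hy.2⟩
    _ ≤ ∫⁻ y in B \ F, ENNReal.ofReal (w y) ∂μ := mul_meas_ge_le_lintegral₀ hf.restrict _
    _ = weightMeasure μ w (B \ F) := by rw [weightMeasure, withDensity_apply _ hDm]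

theorem cond1_of_cond2 (hmeas : ∀ x r, MeasurableSet (ball x r))
    (hpos : ∀ x r, 0 < r → μ (ball x r) ≠ 0) (hfin : ∀ x r, μ (ball x r) ≠ ⊤)
    (hwfin : ∀ x r, weightMeasure μ w (ball x r) ≠ ⊤)
    (h : Cond2 ball μ w R) : Cond1 ball μ w R := by
  obtain ⟨p, hp, C, hC, h⟩ := h
  -- A set with half of the measure of `B` has at least the fraction `C 2⁻ᵖ` of its weight; the
  -- minimum with `1/2` ensures `κ < 1`.
  set κ := min C 2⁻¹ * 2⁻¹ ^ p with hκ
  have h2p : (2⁻¹ : ℝ) ^ p ≤ 1 := Real.rpow_le_one (by norm_num) (by norm_num) (by linarith)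
  have hκ0 : 0 < κ := by positivity
  have hκ1 : κ ≤ 2⁻¹ := by
    have : min C 2⁻¹ ≤ (2⁻¹ : ℝ) := min_le_right _ _
    calc κ ≤ 2⁻¹ * 1 := mul_le_mul this h2p (by positivity) (by norm_num)
      _ = 2⁻¹ := mul_one _
  refine ⟨2⁻¹, by norm_num, 1 - κ, ⟨by linarith, by linarith⟩, fun x r hr hrR F hF hFB hFμ => ?_⟩
  set B := ball x r
  rcases eq_or_ne (weightMeasure μ w B) 0 with h0 | h0
  · rw [h0, mul_zero, ← h0]; exact measure_mono hFB
  refine measure_le_of_le_measure_diff hF hFB (hwfin x r) hκ0.le (by linarith) ?_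
  have key := h x r hr hrR (pos_iff_ne_zero.2 h0) (B \ F) ((hmeas x r).diff hF) sdiff_subset
  rw [ge_iff_le, ENNReal.le_div_iff_mul_le (Or.inl h0) (Or.inl (hwfin x r))] at key
  refine le_trans ?_ key
  gcongr
  have hhalf : (2⁻¹ : ℝ≥0∞) ≤ μ (B \ F) / μ B := by
    rw [ENNReal.le_div_iff_mul_le (Or.inl (hpos x r hr)) (Or.inl (hfin x r))]
    have h1 : μ F + μ (B \ F) = μ B := by
      rw [← measure_inter_add_sdiff B hF, inter_eq_self_of_subset_right hFB]
    have h2 : ENNReal.ofReal 2⁻¹ = 2⁻¹ := by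
      rw [ENNReal.ofReal_inv_of_pos (by norm_num)]; norm_num
    rw [h2] at hFμ
    have h3 : (2⁻¹ : ℝ≥0∞) * μ B + 2⁻¹ * μ B ≤ 2⁻¹ * μ B + μ (B \ F) := by
      rw [← add_mul, ENNReal.inv_two_add_inv_two, one_mul]
      nth_rw 1 [← h1]
      gcongr
    exact (ENNReal.add_le_add_iff_left (ENNReal.mul_ne_top (by norm_num) (hfin x r))).1 h3
  calc ENNReal.ofReal κ = ENNReal.ofReal (min C 2⁻¹) * (2⁻¹ : ℝ≥0∞) ^ p := by
        rw [hκ, ENNReal.ofReal_mul (by positivity),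
          ← ENNReal.ofReal_rpow_of_pos (by norm_num), ENNReal.ofReal_inv_of_pos (by norm_num)]
        norm_num
    _ ≤ _ := by
        gcongr
        exact min_le_left _ _

/-- In the `A_p` condition on a ball of positive weight, the dual integral is finite and bounded by
the reciprocal of the average of the weight. -/
theorem lintegral_rpow_le_of_mul_le {B : Set G} {f : G → ℝ≥0∞} {s C : ℝ} (hs : 0 < s)
    (hB0 : μ B ≠ 0) (hBt : μ B ≠ ⊤) (hN0 : ∫⁻ y in B, f y ∂μ ≠ 0) (hNt : ∫⁻ y in B, f y ∂μ ≠ ⊤)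
    (h : (⨍⁻ y in B, f y ∂μ) * (⨍⁻ y in B, f y ^ (-s) ∂μ) ^ s⁻¹ ≤ ENNReal.ofReal C) :
    ∫⁻ y in B, f y ^ (-s) ∂μ ≤ (ENNReal.ofReal C / ⨍⁻ y in B, f y ∂μ) ^ s * μ B := by
  have hA0 : ⨍⁻ y in B, f y ∂μ ≠ 0 := by
    rw [setLAverage_eq]; exact ENNReal.div_ne_zero.2 ⟨hN0, hBt⟩
  have hAt : ⨍⁻ y in B, f y ∂μ ≠ ⊤ := by
    rw [setLAverage_eq]; exact ENNReal.div_ne_top hNt hB0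
  have h1 : (⨍⁻ y in B, f y ^ (-s) ∂μ) ^ s⁻¹ ≤ ENNReal.ofReal C / ⨍⁻ y in B, f y ∂μ := by
    rwa [ENNReal.le_div_iff_mul_le (Or.inl hA0) (Or.inl hAt), mul_comm]
  have h2 : (⨍⁻ y in B, f y ^ (-s) ∂μ) ≤ (ENNReal.ofReal C / ⨍⁻ y in B, f y ∂μ) ^ s := by
    rwa [← ENNReal.rpow_inv_le_iff hs]
  rwa [setLAverage_eq, ENNReal.div_le_iff_le_mul (Or.inl hB0) (Or.inl hBt)] at h2

theorem cond4_of_cond3 (hpos : ∀ x r, 0 < r → μ (ball x r) ≠ 0)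
    (hmeas : ∀ x r, MeasurableSet (ball x r))
    (hfin : ∀ x r, μ (ball x r) ≠ ⊤) (hwfin : ∀ x r, weightMeasure μ w (ball x r) ≠ ⊤)
    (hw : AEMeasurable w μ) (h : Cond3 ball μ w R) : Cond4 ball μ w R := by
  obtain ⟨p, p', hp, C, hC, h⟩ := h
  have hs : 0 < p' / p := div_pos hp.symm.pos hp.pos
  have hinv : p / p' = (p' / p)⁻¹ := (inv_div _ _).symm
  rw [hinv] at h
  set s := p' / p
  -- This is the value for which the Chebyshev bound `(δ A)^s (C / A)^s μ(B)` equals `μ(B)/2`, where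
  -- `A` is the average of the weight.
  set δ : ℝ := C⁻¹ * 2⁻¹ ^ s⁻¹ with hδ
  have hδ0 : 0 < δ := by positivity
  refine ⟨δ, hδ0, 2⁻¹, by norm_num, fun x r hr hrR => ?_⟩
  have hf : AEMeasurable (fun y => ENNReal.ofReal (w y)) μ := hw.ennreal_ofReal
  have hwB := hwfin x r
  rw [weightMeasure, withDensity_apply _ (hmeas x r)] at hwB
  have hB0 := hpos x r hr
  have hBt := hfin x r
  have hsr := h x r hr hrR
  set B := ball x r
  have h2 : ENNReal.ofReal 2⁻¹ = 2⁻¹ := by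
    rw [ENNReal.ofReal_inv_of_pos (by norm_num)]; norm_num
  rw [h2, ge_iff_le]
  rcases eq_or_ne (∫⁻ y in B, ENNReal.ofReal (w y) ∂μ) 0 with h0 | h0
  · have : ⨍⁻ y in B, ENNReal.ofReal (w y) ∂μ = 0 := by
      rw [setLAverage_eq, h0, ENNReal.zero_div]
    rw [this]
    simp only [mul_zero, ge_iff_le, zero_le, and_true]
    calc 2⁻¹ * μ B ≤ 1 * μ B := by gcongr; norm_num
      _ = μ B := one_mul _
  have hI := lintegral_rpow_le_of_mul_le hs hB0 hBt h0 hwB hsr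
  set A := ⨍⁻ y in B, ENNReal.ofReal (w y) ∂μ with hA
  have hA0 : A ≠ 0 := by
    rw [hA, setLAverage_eq]; exact ENNReal.div_ne_zero.2 ⟨h0, hBt⟩
  have hAt : A ≠ ⊤ := by
    rw [hA, setLAverage_eq]; exact ENNReal.div_ne_top hwB hB0
  have hd0 : ENNReal.ofReal δ ≠ 0 := by simpa using hδ0
  have hδA0 : ENNReal.ofReal δ * A ≠ 0 := mul_ne_zero hd0 hA0
  have hδAt : ENNReal.ofReal δ * A ≠ ⊤ := ENNReal.mul_ne_top ENNReal.ofReal_ne_top hAt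
  -- Small values of `w` are large values of `w^(-s)`, so this is Chebyshev's inequality for the
  -- dual weight.
  have hL : μ {y ∈ B | ENNReal.ofReal (w y) < ENNReal.ofReal δ * A} ≤ 2⁻¹ * μ B := by
    calc μ {y ∈ B | ENNReal.ofReal (w y) < ENNReal.ofReal δ * A}
        ≤ μ.restrict B
            {y | (ENNReal.ofReal δ * A) ^ (-s) ≤ ENNReal.ofReal (w y) ^ (-s)} := by
          rw [Measure.restrict_apply' (hmeas x r)]
          refine measure_mono fun y hy => ⟨?_, hy.1⟩
          rw [mem_ofPred_eq, ENNReal.rpow_neg, ENNReal.rpow_neg, ENNReal.inv_le_inv]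
          exact ENNReal.rpow_le_rpow hy.2.le hs.le
      _ = (ENNReal.ofReal δ * A) ^ s * ((ENNReal.ofReal δ * A) ^ (-s) * μ.restrict B
            {y | (ENNReal.ofReal δ * A) ^ (-s) ≤ ENNReal.ofReal (w y) ^ (-s)}) := by
          rw [← mul_assoc, ← ENNReal.rpow_add _ _ hδA0 hδAt]; simp
      _ ≤ (ENNReal.ofReal δ * A) ^ s * ((ENNReal.ofReal C / A) ^ s * μ B) := by
          refine mul_le_mul_right ?_ _
          exact (mul_meas_ge_le_lintegral₀ (hf.restrict.pow_const _) _).trans hI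
      _ = 2⁻¹ * μ B := by
          rw [← mul_assoc, ← ENNReal.mul_rpow_of_nonneg _ _ hs.le]
          congr 1
          have : ENNReal.ofReal δ * A * (ENNReal.ofReal C / A) = ENNReal.ofReal (2⁻¹ ^ s⁻¹) := by
            rw [mul_assoc, ENNReal.mul_div_cancel hA0 hAt, ← ENNReal.ofReal_mul hδ0.le]
            congr 1
            rw [hδ]; field_simp
          rw [this, ENNReal.ofReal_rpow_of_pos (by positivity),
            ← Real.rpow_mul (by norm_num), inv_mul_cancel₀ hs.ne', Real.rpow_one, h2]
  have hcover : μ B ≤ μ {y ∈ B | ENNReal.ofReal (w y) ≥ ENNReal.ofReal δ * A} + 2⁻¹ * μ B := by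
    calc μ B ≤ μ ({y ∈ B | ENNReal.ofReal (w y) ≥ ENNReal.ofReal δ * A} ∪
            {y ∈ B | ENNReal.ofReal (w y) < ENNReal.ofReal δ * A}) := by
          refine measure_mono fun y hy => ?_
          rcases le_or_gt (ENNReal.ofReal δ * A) (ENNReal.ofReal (w y)) with h | h
          · exact Or.inl ⟨hy, h⟩
          · exact Or.inr ⟨hy, h⟩
      _ ≤ _ := (measure_union_le _ _).trans (by gcongr)
  have h3 : (2⁻¹ : ℝ≥0∞) * μ B + 2⁻¹ * μ B ≤
      μ {y ∈ B | ENNReal.ofReal (w y) ≥ ENNReal.ofReal δ * A} + 2⁻¹ * μ B := by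
    rwa [← add_mul, ENNReal.inv_two_add_inv_two, one_mul]
  exact (ENNReal.add_le_add_iff_right (ENNReal.mul_ne_top (by norm_num) hBt)).1 h3

theorem cond2_of_cond3 (hpos : ∀ x r, 0 < r → μ (ball x r) ≠ 0)
    (hmeas : ∀ x r, MeasurableSet (ball x r))
    (hfin : ∀ x r, μ (ball x r) ≠ ⊤) (hwfin : ∀ x r, weightMeasure μ w (ball x r) ≠ ⊤)
    (hw : AEMeasurable w μ) (h : Cond3 ball μ w R) : Cond2 ball μ w R := by
  obtain ⟨p, p', hp, C, hC, h⟩ := h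
  have hs : 0 < p' / p := div_pos hp.symm.pos hp.pos
  have hinv : p / p' = (p' / p)⁻¹ := (inv_div _ _).symm
  rw [hinv] at h
  refine ⟨p, hp.lt.le, C⁻¹, by positivity, fun x r hr hrR hN F hF hFB => ?_⟩
  have hf : AEMeasurable (fun y => ENNReal.ofReal (w y)) μ := hw.ennreal_ofReal
  have hwB := hwfin x r
  rw [weightMeasure, withDensity_apply _ (hmeas x r)] at hwB hN
  rw [weightMeasure, withDensity_apply _ (hmeas x r), withDensity_apply _ hF]
  have hB0 := hpos x r hr
  have hBt := hfin x r
  have hI := lintegral_rpow_le_of_mul_le hs hB0 hBt hN.ne' hwB (h x r hr hrR)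
  have hpp : p' / p * p / p' = 1 := by field_simp [hp.ne_zero, hp.symm.ne_zero]
  have hps : (1 + p' / p) * (p / p') = p := by
    have := hp.inv_add_inv_eq_one
    have h1 := hp.ne_zero
    have h2 := hp.symm.ne_zero
    field_simp at this ⊢
    linarith
  set s := p' / p with hsdef
  set B := ball x r
  set f := fun y => ENNReal.ofReal (w y)
  set N := ∫⁻ y in B, f y ∂μ with hNdef
  have hAv : ⨍⁻ y in B, f y ∂μ = N / μ B := setLAverage_eq _ _ _
  rw [hAv] at hI
  have hIt : ∫⁻ y in B, f y ^ (-s) ∂μ ≠ ⊤ := by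
    refine ne_top_of_le_ne_top (ENNReal.mul_ne_top ?_ hBt) hI
    refine ENNReal.rpow_ne_top_of_nonneg hs.le (ENNReal.div_ne_top ENNReal.ofReal_ne_top ?_)
    exact ENNReal.div_ne_zero.2 ⟨hN.ne', hBt⟩
  -- The integrand `w^(-s)` is infinite at the zeros of `w`. Its integral being finite, the zeros
  -- are negligible and `1 = w^(1/p) w^(-1/p)` holds almost everywhere.
  have hpos_ae : ∀ᵐ y ∂(μ.restrict F), f y ≠ 0 := by
    have h1 : ∀ᵐ y ∂(μ.restrict B), f y ^ (-s) < ⊤ := ae_lt_top' (hf.restrict.pow_const _) hIt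
    filter_upwards [ae_restrict_of_ae_restrict_of_subset hFB h1] with y hy h0
    rw [h0, ENNReal.zero_rpow_of_neg (neg_lt_zero.2 hs)] at hy
    exact hy.ne rfl
  have hHolder : μ F ≤ (∫⁻ y in F, f y ∂μ) ^ (1 / p) *
      (∫⁻ y in F, f y ^ (-s) ∂μ) ^ (1 / p') := by
    have := ENNReal.lintegral_mul_le_Lp_mul_Lq (μ.restrict F) hp
      (f := fun y => f y ^ (1 / p)) (g := fun y => f y ^ (-(1 / p)))
      (hf.restrict.pow_const _) (hf.restrict.pow_const _)
    have e1 : ∀ y, (f y ^ (1 / p)) ^ p = f y := fun y => by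
      rw [← ENNReal.rpow_mul, one_div, inv_mul_cancel₀ hp.ne_zero, ENNReal.rpow_one]
    have e2 : ∀ y, (f y ^ (-(1 / p))) ^ p' = f y ^ (-s) := fun y => by
      rw [← ENNReal.rpow_mul, hsdef]; congr 1; ring
    have e3 : ∫⁻ y in F, ((fun y => f y ^ (1 / p)) * fun y => f y ^ (-(1 / p))) y ∂μ = μ F := by
      rw [← setLIntegral_one]
      refine lintegral_congr_ae ?_
      filter_upwards [hpos_ae] with y hy
      rw [Pi.mul_apply, ← ENNReal.rpow_add _ _ hy ENNReal.ofReal_ne_top]; simp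
    simp only [e1, e2, e3] at this
    exact this
  have hpow : μ F ^ p ≤ (∫⁻ y in F, f y ∂μ) * (∫⁻ y in B, f y ^ (-s) ∂μ) ^ (p / p') := by
    calc μ F ^ p ≤ ((∫⁻ y in F, f y ∂μ) ^ (1 / p) *
          (∫⁻ y in F, f y ^ (-s) ∂μ) ^ (1 / p')) ^ p :=
          ENNReal.rpow_le_rpow hHolder hp.nonneg
      _ = (∫⁻ y in F, f y ∂μ) * (∫⁻ y in F, f y ^ (-s) ∂μ) ^ (p / p') := by
          rw [ENNReal.mul_rpow_of_nonneg _ _ hp.nonneg, ← ENNReal.rpow_mul, ← ENNReal.rpow_mul,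
            one_div, inv_mul_cancel₀ hp.ne_zero, ENNReal.rpow_one]
          congr 2; ring
      _ ≤ _ := by
          gcongr
          exact (div_pos hp.pos hp.symm.pos).le
  have hpp0 : 0 ≤ p / p' := (div_pos hp.pos hp.symm.pos).le
  have hIpow : (∫⁻ y in B, f y ^ (-s) ∂μ) ^ (p / p') ≤ ENNReal.ofReal C / N * μ B ^ p := by
    calc (∫⁻ y in B, f y ^ (-s) ∂μ) ^ (p / p')
        ≤ ((ENNReal.ofReal C / (N / μ B)) ^ s * μ B) ^ (p / p') := ENNReal.rpow_le_rpow hI hpp0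
      _ = ((ENNReal.ofReal C / N) ^ s * μ B ^ (1 + s)) ^ (p / p') := by
          congr 1
          have : ENNReal.ofReal C / (N / μ B) = ENNReal.ofReal C / N * μ B := by
            rw [div_eq_mul_inv, ENNReal.inv_div (Or.inl hBt) (Or.inl hB0), div_eq_mul_inv,
              div_eq_mul_inv]
            ring
          rw [this, ENNReal.mul_rpow_of_nonneg _ _ hs.le, mul_assoc,
            ENNReal.rpow_add _ _ hB0 hBt, ENNReal.rpow_one, mul_comm (μ B)]
      _ = _ := by
          rw [ENNReal.mul_rpow_of_nonneg _ _ hpp0, ← ENNReal.rpow_mul, ← ENNReal.rpow_mul, hps,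
            ← mul_div_assoc, hpp, ENNReal.rpow_one]
  rw [ge_iff_le, ENNReal.le_div_iff_mul_le (Or.inl hN.ne') (Or.inl hwB),
    ENNReal.div_rpow_of_nonneg _ _ hp.nonneg]
  have hBp0 : μ B ^ p ≠ 0 := by simp [ENNReal.rpow_eq_zero_iff, hB0, hBt]
  have hBpt : μ B ^ p ≠ ⊤ := ENNReal.rpow_ne_top_of_nonneg hp.nonneg hBt
  have hC0 : ENNReal.ofReal C ≠ 0 := by simpa using hC
  calc ENNReal.ofReal C⁻¹ * (μ F ^ p / μ B ^ p) * N
      ≤ ENNReal.ofReal C⁻¹ * (((∫⁻ y in F, f y ∂μ) * (ENNReal.ofReal C / N * μ B ^ p))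
          / μ B ^ p) * N := by gcongr; exact hpow.trans (by gcongr)
    _ = ∫⁻ y in F, f y ∂μ := by
        rw [← mul_assoc (∫⁻ y in F, f y ∂μ), ENNReal.mul_div_cancel_right hBp0 hBpt,
          ENNReal.ofReal_inv_of_pos hC, div_eq_mul_inv]
        calc _ = (∫⁻ y in F, f y ∂μ) * ((ENNReal.ofReal C)⁻¹ * ENNReal.ofReal C) * (N⁻¹ * N) := by
              ring
          _ = _ := by
              rw [ENNReal.inv_mul_cancel hC0 ENNReal.ofReal_ne_top,
                ENNReal.inv_mul_cancel hN.ne' hwB, mul_one, mul_one]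

end Elementary

end LocalMuckenhoupt

namespace LocalMuckenhoupt

/-! ### Covering, annuli and doubling in length spaces. -/

section Metric

open Metric Filter Topology

/-- The final radius may reach `5 * R`, since the last doubling starts from a radius five times
smaller. -/
theorem measure_ball_pow_five_le {X : Type*} [PseudoMetricSpace X] [MeasurableSpace X]
    {ν : Measure X} {R : ℝ} {D : ℝ≥0∞}
    (hD : ∀ x r, 0 < r → r ≤ R → ν (ball x (5 * r)) ≤ D * ν (ball x r)) (k : ℕ) :
    ∀ (x : X) (r : ℝ), 0 < r → 5 ^ k * r ≤ 5 * R →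
    ν (ball x (5 ^ k * r)) ≤ D ^ k * ν (ball x r) := by
  induction k with
  | zero => intro x r _ _; simp
  | succ k ih =>
    intro x r hr hrR
    have h5 : (0 : ℝ) < 5 ^ k := by positivity
    have h1 : 5 ^ k * r ≤ R := by rw [pow_succ] at hrR; linarith
    have h2 : 0 < 5 ^ k * r := by positivity
    calc ν (ball x (5 ^ (k + 1) * r)) = ν (ball x (5 * (5 ^ k * r))) := by ring_nf
      _ ≤ D * ν (ball x (5 ^ k * r)) := hD x _ h2 h1
      _ ≤ D * (D ^ k * ν (ball x r)) := by gcongr; exact ih x r hr (by linarith)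
      _ = _ := by ring

variable {X : Type*} [PseudoMetricSpace X] [SecondCountableTopology X] [MeasurableSpace X]
  [BorelSpace X]

/-- A consequence of the Vitali covering lemma: a measure comparison on a family of balls covering
`E` passes to `E`. -/
theorem measure_le_of_forall_ball {μ ν : Measure X} {E A : Set X} {C : ℝ≥0∞} {S : ℝ}
    (h : ∀ y ∈ E, ∃ z s, 0 < s ∧ s ≤ S ∧ y ∈ ball z s ∧
      μ (ball z (5 * s)) ≤ C * ν (ball z s ∩ A)) : μ E ≤ C * ν A := by
  choose! z s hs hsS hy hμ using h
  -- Vitali's lemma allows any enlargement factor above `3`; the factor `4` leaves room to pass from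
  -- closed balls to the open balls of radius `5 * s`.
  obtain ⟨u, huE, hdisj, hcov⟩ :=
    Vitali.exists_disjoint_subfamily_covering_enlargement_closedBall E z s S hsS 4 (by norm_num)
  have hdisj' : u.PairwiseDisjoint fun a => ball (z a) (s a) :=
    hdisj.mono fun a => ball_subset_closedBall
  have hu : u.Countable := hdisj'.countable_of_isOpen (fun a _ => isOpen_ball)
    fun a ha => ⟨z a, mem_ball_self (hs a (huE ha))⟩
  have hsub : E ⊆ ⋃ a ∈ u, ball (z a) (5 * s a) := by
    intro y hyE
    obtain ⟨b, hb, hyb⟩ := hcov y hyE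
    refine mem_iUnion₂.2 ⟨b, hb, ?_⟩
    have := hyb (ball_subset_closedBall (hy y hyE))
    rw [mem_closedBall] at this
    rw [mem_ball]
    linarith [hs b (huE hb)]
  calc μ E ≤ ∑' a : u, μ (ball (z a) (5 * s a)) :=
        (measure_mono hsub).trans (measure_biUnion_le μ hu _)
    _ ≤ ∑' a : u, C * (ν.restrict A) (ball (z a) (s a)) := by
        refine ENNReal.tsum_le_tsum fun a => ?_
        rw [Measure.restrict_apply measurableSet_ball]
        exact hμ a (huE a.2)
    _ = C * (ν.restrict A) (⋃ a ∈ u, ball (z a) (s a)) := by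
        rw [ENNReal.tsum_mul_left, measure_biUnion hu hdisj' fun _ _ => measurableSet_ball]
    _ ≤ C * ν A := by
        refine mul_le_mul_right ?_ _
        exact (measure_mono (subset_univ _)).trans_eq (Measure.restrict_apply_univ A)

/-- The length property: a ball of radius `a + b` is covered by the balls of radius `b` centred in
the concentric ball of radius `a`. -/
def LengthProperty (X : Type*) [PseudoMetricSpace X] : Prop :=
  ∀ (x y : X) (a b : ℝ), 0 < a → 0 < b → dist x y < a + b → ∃ z, dist x z < a ∧ dist z y < b

variable {μ ν : Measure X} {w : X → ℝ} {R : ℝ}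

/-- The length property moves a point `y` of the outer annulus to a point `z` with `d(x,z) < r - 2ρ`
and `d(z,y) < 2ρ`, so that `B(z,ρ)` lies in the next annulus. Two doublings take `B(z,ρ)` to a ball
containing `B(z,15ρ)`, and Vitali's lemma with balls of radius `3ρ` sums the local comparisons. -/
theorem measureReal_annulus_le (hlen : LengthProperty X) {D : ℝ} (hD0 : 0 ≤ D)
    (hfin : ∀ x r, ν (ball x r) ≠ ⊤)
    (hD : ∀ x r, 0 < r → r ≤ R → ν (ball x (5 * r)) ≤ ENNReal.ofReal D * ν (ball x r))
    {x : X} {r ρ : ℝ} (hρ : 0 < ρ) (hρr : 8 * ρ ≤ r) (hr : r ≤ R) :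
    ν.real (ball x r) - ν.real (ball x (r - ρ)) ≤
      D ^ 2 * (ν.real (ball x (r - ρ)) - ν.real (ball x (r - 4 * ρ))) := by
  have key : ν (ball x r \ ball x (r - ρ)) ≤
      ENNReal.ofReal D ^ 2 * ν (ball x (r - ρ) \ ball x (r - 4 * ρ)) := by
    refine measure_le_of_forall_ball (S := 3 * ρ) fun y hy => ?_
    have hy1 : dist x y < (r - 2 * ρ) + 2 * ρ := by
      have := mem_ball'.1 hy.1; linarith
    have hy2 : r - ρ ≤ dist x y := by
      have := hy.2; rw [mem_ball', not_lt] at this; exact this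
    obtain ⟨z, hz1, hz2⟩ := hlen x y (r - 2 * ρ) (2 * ρ) (by linarith) (by linarith) hy1
    refine ⟨z, 3 * ρ, by linarith, le_rfl, ?_, ?_⟩
    · rw [mem_ball']; linarith
    · calc ν (ball z (5 * (3 * ρ))) ≤ ν (ball z (5 ^ 2 * ρ)) :=
            measure_mono (ball_subset_ball (by linarith))
        _ ≤ ENNReal.ofReal D ^ 2 * ν (ball z ρ) :=
            measure_ball_pow_five_le hD 2 z ρ hρ (by linarith)
        _ ≤ _ := by
            gcongr
            intro q hq
            rw [mem_ball'] at hq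
            refine ⟨ball_subset_ball (by linarith) (mem_ball'.2 hq), ?_, ?_⟩
            · rw [mem_ball']; linarith [dist_triangle x z q]
            · rw [mem_ball', not_lt]
              linarith [dist_triangle x q y, dist_triangle q z y, dist_comm q z]
  have e1 : ν.real (ball x r \ ball x (r - ρ)) = ν.real (ball x r) - ν.real (ball x (r - ρ)) :=
    measureReal_sdiff (ball_subset_ball (by linarith)) measurableSet_ball (hfin _ _)
  have e2 : ν.real (ball x (r - ρ) \ ball x (r - 4 * ρ)) =
      ν.real (ball x (r - ρ)) - ν.real (ball x (r - 4 * ρ)) :=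
    measureReal_sdiff (ball_subset_ball (by linarith)) measurableSet_ball (hfin _ _)
  rw [← e1, ← e2]
  have := ENNReal.toReal_mono (ENNReal.mul_ne_top (by simp)
    (measure_ne_top_of_subset sdiff_subset (hfin _ _))) key
  rwa [ENNReal.toReal_mul, ENNReal.toReal_pow, ENNReal.toReal_ofReal hD0] at this

/-- In a length space, a doubling measure puts little mass near the boundary of a ball. -/
theorem exists_measureReal_annulus_lt (hlen : LengthProperty X) {D : ℝ} (hD0 : 0 ≤ D)
    (hfin : ∀ x r, ν (ball x r) ≠ ⊤)
    (hD : ∀ x r, 0 < r → r ≤ R → ν (ball x (5 * r)) ≤ ENNReal.ofReal D * ν (ball x r))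
    {δ : ℝ} (hδ : δ < 1) :
    ∃ η ∈ Ioo (0 : ℝ) 1, ∀ (x : X) (r : ℝ), 0 < r → r ≤ R → 0 < ν.real (ball x r) →
      δ * ν.real (ball x r) < ν.real (ball x ((1 - η) * r)) := by
  -- If `a j` is the mass of the outer annulus of width `r / (8 * 4 ^ j)`, the annulus estimate
  -- reads `a (j+1) ≤ D ^ 2 * (a j - a (j+1))`, that is, `a (j+1) ≤ θ * a j`.
  set θ := D ^ 2 / (1 + D ^ 2) with hθ
  have hθ0 : 0 ≤ θ := by positivity
  have hθ1 : θ < 1 := by rw [hθ, div_lt_one (by positivity)]; linarith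
  obtain ⟨k, hk⟩ := exists_pow_lt_of_lt_one (sub_pos.2 hδ) hθ1
  have hη : (0 : ℝ) < 1 / (8 * 4 ^ k) := by positivity
  refine ⟨1 / (8 * 4 ^ k), ⟨hη, ?_⟩, fun x r hr hrR hpos => ?_⟩
  · rw [div_lt_one (by positivity)]
    have : (1 : ℝ) ≤ 4 ^ k := one_le_pow₀ (by norm_num)
    linarith
  have hiter : ∀ j : ℕ, ν.real (ball x r) - ν.real (ball x (r - r / (8 * 4 ^ j))) ≤
      θ ^ j * ν.real (ball x r) := by
    intro j
    induction j with
    | zero => simp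
    | succ j ih =>
      have h4 : (1 : ℝ) ≤ 4 ^ (j + 1) := one_le_pow₀ (by norm_num)
      have h := measureReal_annulus_le hlen hD0 hfin hD (x := x) (r := r)
        (ρ := r / (8 * 4 ^ (j + 1))) (by positivity)
        (by rw [mul_div_assoc', div_le_iff₀ (by positivity)]; nlinarith) hrR
      have e : 4 * (r / (8 * 4 ^ (j + 1))) = r / (8 * 4 ^ j) := by
        rw [pow_succ]; field_simp
      rw [e] at h
      have h' : ν.real (ball x r) - ν.real (ball x (r - r / (8 * 4 ^ (j + 1)))) ≤
          θ * (ν.real (ball x r) - ν.real (ball x (r - r / (8 * 4 ^ j)))) := by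
        rw [hθ, div_mul_eq_mul_div, le_div_iff₀ (by positivity)]
        linarith
      calc _ ≤ _ := h'
        _ ≤ θ * (θ ^ j * ν.real (ball x r)) := by gcongr
        _ = _ := by ring
  have := hiter k
  have e : (1 - 1 / (8 * 4 ^ k)) * r = r - r / (8 * 4 ^ k) := by ring
  rw [e]
  nlinarith

/-- The first condition transfers the doubling property from the weighted measure to the reference
measure. -/
theorem exists_doubling_of_cond1 (hlen : LengthProperty X)
    (hinv : ∀ x y r, μ (ball x r) = μ (ball y r))
    (hfin : ∀ x r, μ (ball x r) ≠ ⊤) (hwfin : ∀ x r, weightMeasure μ w (ball x r) ≠ ⊤)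
    {D : ℝ} (hD0 : 0 ≤ D)
    (hD : ∀ x r, 0 < r → r ≤ R →
      weightMeasure μ w (ball x (5 * r)) ≤ ENNReal.ofReal D * weightMeasure μ w (ball x r))
    (h1 : Cond1 ball μ w R) {x₀ : X} (hx₀ : ∀ r, 0 < r → weightMeasure μ w (ball x₀ r) ≠ 0) :
    ∃ D' : ℝ, 1 ≤ D' ∧ ∀ x r, 0 < r → r ≤ R / 5 →
      μ (ball x (5 * r)) ≤ ENNReal.ofReal D' * μ (ball x r) := by
  obtain ⟨ε, hε, δ, hδ, h1⟩ := h1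
  obtain ⟨η, hη, hann⟩ := exists_measureReal_annulus_lt hlen hD0 hwfin hD hδ.2
  have hη0 : 0 < 1 - η := by linarith [hη.2]
  obtain ⟨j, hj⟩ := exists_pow_lt_of_lt_one (show (0 : ℝ) < 1 / 5 by norm_num)
    (show 1 - η < 1 by linarith [hη.1])
  -- Otherwise (1) would bound the weight of the inner ball by the fraction `δ`, against the choice
  -- of `η`.
  have hstep : ∀ r, 0 < r → r ≤ R →
      ε * μ.real (ball x₀ r) ≤ μ.real (ball x₀ ((1 - η) * r)) := by
    intro r hr hrR
    have hν : 0 < (weightMeasure μ w).real (ball x₀ r) :=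
      ENNReal.toReal_pos (hx₀ r hr) (hwfin _ _)
    have hlt := hann x₀ r hr hrR hν
    by_contra hcon
    rw [not_le] at hcon
    have := h1 x₀ r hr hrR (ball x₀ ((1 - η) * r)) measurableSet_ball
      (ball_subset_ball (by nlinarith [hη.1])) ?_
    · have h' := ENNReal.toReal_mono (ENNReal.mul_ne_top ENNReal.ofReal_ne_top (hwfin _ _)) this
      rw [ENNReal.toReal_mul, ENNReal.toReal_ofReal hδ.1.le] at h'
      exact absurd hlt (not_lt.2 h')
    · rw [← ENNReal.toReal_le_toReal (hfin _ _)
        (ENNReal.mul_ne_top ENNReal.ofReal_ne_top (hfin _ _)), ENNReal.toReal_mul,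
        ENNReal.toReal_ofReal hε.1.le]
      exact hcon.le
  have hiter : ∀ i : ℕ, ∀ r, 0 < r → r ≤ R →
      ε ^ i * μ.real (ball x₀ r) ≤ μ.real (ball x₀ ((1 - η) ^ i * r)) := by
    intro i
    induction i with
    | zero => intro r _ _; simp
    | succ i ih =>
      intro r hr hrR
      have hle : (1 - η) ^ i ≤ 1 := pow_le_one₀ hη0.le (by linarith [hη.1])
      have hs := hstep ((1 - η) ^ i * r) (by positivity) (by nlinarith)
      calc ε ^ (i + 1) * μ.real (ball x₀ r) = ε * (ε ^ i * μ.real (ball x₀ r)) := by ring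
        _ ≤ ε * μ.real (ball x₀ ((1 - η) ^ i * r)) :=
            mul_le_mul_of_nonneg_left (ih r hr hrR) hε.1.le
        _ ≤ _ := hs
        _ = _ := by ring_nf
  have hεj : 0 < ε ^ j := pow_pos hε.1 j
  refine ⟨(ε ^ j)⁻¹, (one_le_inv₀ hεj).2 (pow_le_one₀ hε.1.le hε.2.le), fun x r hr hrR => ?_⟩
  -- The argument needs positive weight, which is known only at `x₀`; invariance carries the result
  -- to every centre.
  rw [hinv x x₀, hinv x x₀]
  have h := hiter j (5 * r) (by linarith) (by linarith)
  have hmono : μ.real (ball x₀ ((1 - η) ^ j * (5 * r))) ≤ μ.real (ball x₀ r) :=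
    ENNReal.toReal_mono (hfin _ _) (measure_mono (ball_subset_ball (by nlinarith)))
  rw [← ENNReal.toReal_le_toReal (hfin _ _)
    (ENNReal.mul_ne_top ENNReal.ofReal_ne_top (hfin _ _)), ENNReal.toReal_mul,
    ENNReal.toReal_ofReal (by positivity), inv_mul_eq_div, le_div_iff₀ hεj, mul_comm]
  exact h.trans hmono

end Metric

end LocalMuckenhoupt

namespace LocalMuckenhoupt

/-! ### The level set estimate by a stopping argument. -/

section LevelSets

open Metric Filter Topology

theorem isUnifLocDoublingMeasure_of_ball {X : Type*} [PseudoMetricSpace X] [MeasurableSpace X]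
    {μ : Measure X} {R D : ℝ} (hR : 0 < R)
    (hD : ∀ x r, 0 < r → r ≤ R → μ (ball x (5 * r)) ≤ ENNReal.ofReal D * μ (ball x r)) :
    IsUnifLocDoublingMeasure μ := by
  refine ⟨⟨D.toNNReal, ?_⟩⟩
  filter_upwards [Ioc_mem_nhdsGT hR] with ε hε x
  calc μ (closedBall x (2 * ε)) ≤ μ (ball x (5 * ε)) :=
        measure_mono (closedBall_subset_ball (by linarith [hε.1]))
    _ ≤ ENNReal.ofReal D * μ (ball x ε) := hD x ε hε.1 hε.2
    _ ≤ _ := by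
        refine mul_le_mul_right (measure_mono ball_subset_closedBall) _

variable {X : Type*} [PseudoMetricSpace X] [SecondCountableTopology X] [MeasurableSpace X]
  [BorelSpace X] {μ : Measure X} {w : X → ℝ} {R : ℝ}

/-- Almost every point where the weight is less than `t` has arbitrarily small balls on which the
average of the weight is at most `t`. -/
theorem ae_exists_ball_weightMeasure_le [IsUnifLocDoublingMeasure μ] [IsLocallyFiniteMeasure μ]
    (hw : LocallyIntegrable w μ) (hw0 : ∀ x, 0 ≤ w x)
    (hpos : ∀ x r, 0 < r → μ (ball x r) ≠ 0) (hfin : ∀ x r, μ (ball x r) ≠ ⊤)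
    (hwfin : ∀ x r, weightMeasure μ w (ball x r) ≠ ⊤) (t : ℝ) :
    ∀ᵐ y ∂μ, w y < t → ∀ ρ > 0, ∃ s, 0 < s ∧ s ≤ ρ ∧
      weightMeasure μ w (ball y s) ≤ ENNReal.ofReal t * μ (ball y s) := by
  filter_upwards [IsUnifLocDoublingMeasure.ae_tendsto_average μ hw 1] with y hy hyt ρ hρ
  have hlim := hy (fun _ : ℝ => y) (fun s : ℝ => s) (l := 𝓝[>] 0) tendsto_id
    (by
      filter_upwards [self_mem_nhdsWithin] with s hs
      exact mem_closedBall_self (by simpa using (le_of_lt hs)))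
  have hev := hlim.eventually (gt_mem_nhds hyt)
  obtain ⟨s, hs0, hs⟩ := (mem_nhdsGT_iff_exists_Ioc_subset).1 hev
  have hs0' : 0 < s := hs0
  have hclosed : ∀ q, 0 < q → q ≤ s →
      weightMeasure μ w (closedBall y q) ≤ ENNReal.ofReal t * μ (closedBall y q) := by
    intro q hq hqs
    have h1 : ⨍ z in closedBall y q, w z ∂μ < t := hs ⟨hq, hqs⟩
    have hsub : closedBall y q ⊆ ball y (q + 1) := closedBall_subset_ball (by linarith)
    have hintegral : IntegrableOn w (closedBall y q) μ := by
      refine ⟨hw.aestronglyMeasurable.restrict, ?_⟩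
      rw [hasFiniteIntegral_iff_ofReal (ae_of_all _ hw0)]
      have : weightMeasure μ w (closedBall y q) < ⊤ :=
        (measure_mono hsub).trans_lt (hwfin y (q + 1)).lt_top
      rwa [weightMeasure, withDensity_apply _ measurableSet_closedBall] at this
    have h2 := ofReal_setAverage hintegral (ae_of_all _ hw0)
    have h3 : (∫⁻ x in closedBall y q, ENNReal.ofReal (w x) ∂μ) / μ (closedBall y q) ≤
        ENNReal.ofReal t := by
      rw [← h2]; exact ENNReal.ofReal_le_ofReal h1.le
    rw [ENNReal.div_le_iff_le_mul] at h3
    · rwa [weightMeasure, withDensity_apply _ measurableSet_closedBall]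
    · left
      exact fun h => hpos y q hq (measure_mono_null ball_subset_closedBall h)
    · left
      exact measure_ne_top_of_subset hsub (hfin _ _)
  have hq0 : 0 < min s ρ := lt_min hs0' hρ
  refine ⟨min s ρ, hq0, min_le_right _ _, ?_⟩
  set q := min s ρ
  -- The differentiation theorem concerns closed balls, and the open ball is their increasing union.
  -- The shift by `2` makes all their radii positive.
  have hU : ball y q = ⋃ n : ℕ, closedBall y (q * (1 - 1 / (n + 2))) := by
    ext z
    simp only [mem_ball, mem_iUnion, mem_closedBall]
    constructor
    · intro hz
      have hlim2 : Tendsto (fun n : ℕ => q * (1 - 1 / ((n : ℝ) + 2))) atTop (𝓝 (q * (1 - 0))) := by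
        refine tendsto_const_nhds.mul (tendsto_const_nhds.sub ?_)
        have := (tendsto_one_div_add_atTop_nhds_zero_nat (𝕜 := ℝ)).comp (tendsto_add_atTop_nat 1)
        refine this.congr fun n => ?_
        simp only [Function.comp_apply]; push_cast; ring
      rw [sub_zero, mul_one] at hlim2
      obtain ⟨n, hn⟩ := (hlim2.eventually (lt_mem_nhds hz)).exists
      exact ⟨n, hn.le⟩
    · rintro ⟨n, hn⟩
      refine hn.trans_lt ?_
      have : (0 : ℝ) < 1 / ((n : ℝ) + 2) := by positivity
      nlinarith
  have hmono : Monotone fun n : ℕ => closedBall y (q * (1 - 1 / ((n : ℝ) + 2))) := by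
    intro a b hab
    refine closedBall_subset_closedBall ?_
    have : (a : ℝ) ≤ b := by exact_mod_cast hab
    gcongr
  rw [hU, hmono.measure_iUnion, iSup_le_iff, ← hU]
  intro n
  have h0 : (0 : ℝ) < 1 / ((n : ℝ) + 2) := by positivity
  have h1 : (1 : ℝ) / ((n : ℝ) + 2) < 1 := by
    rw [div_lt_one (by positivity)]; linarith [(Nat.cast_nonneg n : (0 : ℝ) ≤ n)]
  refine (hclosed _ (mul_pos hq0 (by linarith)) ?_).trans ?_
  · exact le_trans (by nlinarith) (min_le_left s ρ)
  · rw [hU]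
    refine mul_le_mul_right (measure_mono ?_) _
    exact subset_iUnion (fun n : ℕ => closedBall y (q * (1 - 1 / ((n : ℝ) + 2)))) n

/-- Through almost every point of the sublevel set passes a ball of nearly maximal radius, inside
the given ball, with average at most `t`. Maximality bounds the average below by `t / D`, and (1)
leaves at least `1 - δ` of the weight of this ball where `w < t / ε`. Vitali's lemma sums over the
selected balls. -/
theorem measure_lt_le_weightMeasure_lt (hlen : LengthProperty X)
    (hinv : ∀ x y r, μ (ball x r) = μ (ball y r))
    (hpos : ∀ x r, 0 < r → μ (ball x r) ≠ 0) (hfin : ∀ x r, μ (ball x r) ≠ ⊤)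
    (hwfin : ∀ x r, weightMeasure μ w (ball x r) ≠ ⊤)
    (hw : LocallyIntegrable w μ) (hwm : Measurable w) (hw0 : ∀ x, 0 ≤ w x)
    {D : ℝ} (hD0 : 0 < D)
    (hDw : ∀ x r, 0 < r → r ≤ R →
      weightMeasure μ w (ball x (5 * r)) ≤ ENNReal.ofReal D * weightMeasure μ w (ball x r))
    (hDμ : ∀ x r, 0 < r → r ≤ R / 5 → μ (ball x (5 * r)) ≤ ENNReal.ofReal D * μ (ball x r))
    {ε δ : ℝ} (hε : ε ∈ Ioo (0 : ℝ) 1) (hδ : δ ∈ Ioo (0 : ℝ) 1)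
    (h1 : ∀ (x : X) (r : ℝ), 0 < r → r ≤ R → ∀ F : Set X, MeasurableSet F → F ⊆ ball x r →
      μ F ≤ ENNReal.ofReal ε * μ (ball x r) →
        weightMeasure μ w F ≤ ENNReal.ofReal δ * weightMeasure μ w (ball x r))
    {x : X} {r : ℝ} (hr : 0 < r) (hrR : r ≤ R) {t : ℝ} (ht : 0 < t)
    (htB : ENNReal.ofReal D ^ 3 * (ENNReal.ofReal t * μ (ball x r)) <
      weightMeasure μ w (ball x r)) :
    μ {y ∈ ball x r | w y < t} ≤ ENNReal.ofReal (D ^ 2 / (t * (1 - δ))) *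
      weightMeasure μ w {y ∈ ball x r | w y < t / ε} := by
  have hR : 0 < R := hr.trans_le hrR
  have : IsUnifLocDoublingMeasure μ := isUnifLocDoublingMeasure_of_ball (by positivity) hDμ
  have : IsLocallyFiniteMeasure μ :=
    ⟨fun y => ⟨ball y 1, ball_mem_nhds y one_pos, (hfin y 1).lt_top⟩⟩
  set ν := weightMeasure μ w with hν
  have hae := ae_exists_ball_weightMeasure_le hw hw0 hpos hfin hwfin t
  set P : Set X := {y | w y < t → ∀ ρ > 0, ∃ s, 0 < s ∧ s ≤ ρ ∧
      ν (ball y s) ≤ ENNReal.ofReal t * μ (ball y s)} with hP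
  have hnull : μ {y ∈ ball x r | w y < t} = μ ({y ∈ ball x r | w y < t} ∩ P) :=
    (measure_inter_conull hae).symm
  rw [hnull]
  refine measure_le_of_forall_ball (S := r) ?_
  rintro y ⟨⟨hyB, hyt⟩, hyP⟩
  -- radii of balls containing `y`, contained in the given ball, and of average at most `t`
  set S : Set ℝ := {s | 0 < s ∧ ∃ z, y ∈ ball z s ∧ ball z s ⊆ ball x r ∧
    ν (ball z s) ≤ ENNReal.ofReal t * μ (ball z s)} with hS
  -- Since `5 ^ 3 / 40 > 2`, three doublings of `B(z, r/40)` cover `B(x, r)`. A ball of radius at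
  -- least `r / 40` and average at most `t` would contradict the assumed smallness of `t`.
  have hSlt : ∀ s ∈ S, s < r / 40 := by
    rintro s ⟨hs0, z, hyz, hzB, hz⟩
    by_contra hcon
    rw [not_lt] at hcon
    have hzx : dist z x < r := mem_ball.1 (hzB (mem_ball_self hs0))
    refine absurd htB (not_lt.2 ?_)
    calc ν (ball x r) ≤ ν (ball z (5 ^ 3 * (r / 40))) := by
          refine measure_mono (ball_subset_ball' ?_)
          rw [dist_comm]; linarith
      _ ≤ ENNReal.ofReal D ^ 3 * ν (ball z (r / 40)) :=
          measure_ball_pow_five_le hDw 3 z (r / 40) (by positivity) (by linarith)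
      _ ≤ ENNReal.ofReal D ^ 3 * ν (ball z s) :=
          mul_le_mul_right (measure_mono (ball_subset_ball hcon)) _
      _ ≤ ENNReal.ofReal D ^ 3 * (ENNReal.ofReal t * μ (ball z s)) := mul_le_mul_right hz _
      _ ≤ _ := mul_le_mul_right (mul_le_mul_right (measure_mono hzB) _) _
  have hSne : S.Nonempty := by
    have hgap : 0 < r - dist y x := sub_pos.2 (mem_ball.1 hyB)
    obtain ⟨s, hs0, hsρ, hs⟩ := hyP hyt _ hgap
    exact ⟨s, hs0, y, mem_ball_self hs0, ball_subset_ball' (by linarith), hs⟩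
  have hSbdd : BddAbove S := ⟨r / 40, fun s hs => (hSlt s hs).le⟩
  have hsup : 0 < sSup S := by
    obtain ⟨s, hs⟩ := hSne
    exact hs.1.trans_le (le_csSup hSbdd hs)
  -- The supremum need not be attained; a radius above half of it is enough, since twice that radius
  -- is no longer admissible.
  obtain ⟨s, hsS, hs2⟩ := exists_lt_of_lt_csSup hSne (half_lt_self hsup)
  have hs2S : 2 * s ∉ S := fun h => by linarith [le_csSup hSbdd h]
  have hslt := hSlt s hsS
  obtain ⟨hs0, z, hyz, hzB, hz⟩ := hsS
  -- The ball of radius `2 * s` about `z` may leave the given ball. The length property supplies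
  -- another centre whose ball of that radius contains `y` and stays inside, so its average exceeds
  -- `t`.
  obtain ⟨z', hz'1, hz'2⟩ := hlen x y (r - 2 * s) (2 * s) (by linarith) (by linarith)
    (by rw [sub_add_cancel]; exact mem_ball'.1 hyB)
  have hz'B : ball z' (2 * s) ⊆ ball x r :=
    ball_subset_ball' (by rw [dist_comm]; linarith)
  have hz' : ENNReal.ofReal t * μ (ball z' (2 * s)) < ν (ball z' (2 * s)) := by
    by_contra hcon
    exact hs2S ⟨by linarith, z', mem_ball'.2 hz'2, hz'B, not_lt.1 hcon⟩
  -- The two centres differ, but balls of equal radius have equal measure, and `B(z', 2s)` is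
  -- contained in `B(z, 5s)` because both balls contain `y`.
  have hlow : ENNReal.ofReal t * μ (ball z s) ≤ ENNReal.ofReal D * ν (ball z s) := by
    calc ENNReal.ofReal t * μ (ball z s) = ENNReal.ofReal t * μ (ball z' s) := by rw [hinv z z']
      _ ≤ ENNReal.ofReal t * μ (ball z' (2 * s)) :=
          mul_le_mul_right (measure_mono (ball_subset_ball (by linarith))) _
      _ ≤ ν (ball z' (2 * s)) := hz'.le
      _ ≤ ν (ball z (5 * s)) := by
          refine measure_mono (ball_subset_ball' ?_)
          have := mem_ball.1 hyz
          linarith [dist_triangle z' y z]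
      _ ≤ _ := hDw z s hs0 (by linarith)
  have hportion : ENNReal.ofReal (1 - δ) * ν (ball z s) ≤
      ν (ball z s ∩ {q ∈ ball x r | w q < t / ε}) := by
    set F : Set X := {q ∈ ball z s | t / ε ≤ w q} with hF
    have hFm : MeasurableSet F := measurableSet_ball.inter (measurableSet_le measurable_const hwm)
    have hFsub : F ⊆ ball z s := sep_subset _ _
    -- Chebyshev's inequality: the average over the ball is at most `t`, and `w` is at least `t / ε`
    -- on `F`.
    have hFμ : μ F ≤ ENNReal.ofReal ε * μ (ball z s) := by
      have h2 : ENNReal.ofReal (t / ε) * μ F ≤ ENNReal.ofReal t * μ (ball z s) := by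
        calc ENNReal.ofReal (t / ε) * μ F = ∫⁻ _ in F, ENNReal.ofReal (t / ε) ∂μ := by
              rw [setLIntegral_const]
          _ ≤ ∫⁻ q in F, ENNReal.ofReal (w q) ∂μ :=
              setLIntegral_mono' hFm fun q hq => ENNReal.ofReal_le_ofReal hq.2
          _ = ν F := by rw [hν, weightMeasure, withDensity_apply _ hFm]
          _ ≤ ν (ball z s) := measure_mono hFsub
          _ ≤ _ := hz
      have ht0 : ENNReal.ofReal (ε / t) * ENNReal.ofReal (t / ε) = 1 := by
        rw [← ENNReal.ofReal_mul (div_nonneg hε.1.le ht.le), ← ENNReal.ofReal_one]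
        congr 1
        have := hε.1.ne'
        field_simp
      calc μ F = ENNReal.ofReal (ε / t) * (ENNReal.ofReal (t / ε) * μ F) := by
            rw [← mul_assoc, ht0, one_mul]
        _ ≤ ENNReal.ofReal (ε / t) * (ENNReal.ofReal t * μ (ball z s)) := mul_le_mul_right h2 _
        _ = _ := by
            rw [← mul_assoc, ← ENNReal.ofReal_mul (div_nonneg hε.1.le ht.le),
              div_mul_cancel₀ _ ht.ne']
    have hνF := h1 z s hs0 (by linarith) F hFm hFsub hFμ
    have hsum : ν F + ν (ball z s \ F) = ν (ball z s) := by
      rw [← measure_inter_add_sdiff (ball z s) hFm, inter_eq_self_of_subset_right hFsub]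
    have hle : ENNReal.ofReal δ * ν (ball z s) + ENNReal.ofReal (1 - δ) * ν (ball z s) ≤
        ENNReal.ofReal δ * ν (ball z s) + ν (ball z s \ F) := by
      rw [← add_mul, ← ENNReal.ofReal_add hδ.1.le (by linarith [hδ.2]), add_sub_cancel,
        ENNReal.ofReal_one, one_mul]
      nth_rw 1 [← hsum]
      gcongr
    refine ((ENNReal.add_le_add_iff_left
      (ENNReal.mul_ne_top ENNReal.ofReal_ne_top (hwfin _ _))).1 hle).trans (measure_mono ?_)
    intro q hq
    refine ⟨hq.1, hzB hq.1, ?_⟩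
    by_contra hcon
    exact hq.2 ⟨hq.1, not_lt.1 hcon⟩
  refine ⟨z, s, hs0, by linarith, hyz, ?_⟩
  have h1δ : 0 < 1 - δ := by linarith [hδ.2]
  calc μ (ball z (5 * s)) ≤ ENNReal.ofReal D * μ (ball z s) := hDμ z s hs0 (by linarith)
    _ = ENNReal.ofReal (D / t) * (ENNReal.ofReal t * μ (ball z s)) := by
        rw [← mul_assoc, ← ENNReal.ofReal_mul (by positivity), div_mul_cancel₀ _ ht.ne']
    _ ≤ ENNReal.ofReal (D / t) * (ENNReal.ofReal D * ν (ball z s)) := mul_le_mul_right hlow _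
    _ = ENNReal.ofReal (D ^ 2 / (t * (1 - δ))) * (ENNReal.ofReal (1 - δ) * ν (ball z s)) := by
        rw [← mul_assoc, ← mul_assoc, ← ENNReal.ofReal_mul (by positivity),
          ← ENNReal.ofReal_mul (by positivity)]
        congr 2
        field_simp
    _ ≤ _ := mul_le_mul_right hportion _

end LevelSets

end LocalMuckenhoupt

namespace LocalMuckenhoupt

/-! ### From level sets to negative powers. -/

section NegativePowers

/-- An estimate of the measure of the sublevel sets of a weight by their weighted measure yields
geometric decay. -/
theorem measureReal_lt_decay {X : Type*} [MeasurableSpace X] {μ : Measure X} {w : X → ℝ}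
    (hwm : Measurable w) {B : Set X} (hB : MeasurableSet B) (hBt : μ B ≠ ⊤)
    {C K t : ℝ} (hC : 1 ≤ C) (hK : 1 ≤ K) (ht : 0 < t)
    (h : μ {y ∈ B | w y < t} ≤
      ENNReal.ofReal (C / t) * weightMeasure μ w {y ∈ B | w y < t * K}) :
    μ.real {y ∈ B | w y < t / (2 * C)} ≤
      C * K / (2⁻¹ + C * K) * μ.real {y ∈ B | w y < t * K} := by
  have hm : ∀ a : ℝ, MeasurableSet {y ∈ B | w y < a} := fun a =>
    hB.inter (measurableSet_lt hwm measurable_const)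
  have hft : ∀ a : ℝ, μ {y ∈ B | w y < a} ≠ ⊤ := fun a =>
    measure_ne_top_of_subset (sep_subset _ _) hBt
  have hL : t / (2 * C) ≤ t := div_le_self ht.le (by linarith)
  have hsub : {y ∈ B | w y < t / (2 * C)} ⊆ {y ∈ B | w y < t * K} := fun y hy =>
    ⟨hy.1, hy.2.trans_le (hL.trans (le_mul_of_one_le_right ht.le hK))⟩
  have hmono : μ.real {y ∈ B | w y < t / (2 * C)} ≤ μ.real {y ∈ B | w y < t} :=
    measureReal_mono (fun y hy => ⟨hy.1, hy.2.trans_le hL⟩) (hft _)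
  have hbound : ∀ (F : Set X) (a : ℝ), MeasurableSet F → (∀ y ∈ F, w y < a) →
      weightMeasure μ w F ≤ ENNReal.ofReal a * μ F := by
    intro F a hF ha
    rw [weightMeasure, withDensity_apply _ hF, ← setLIntegral_const]
    exact setLIntegral_mono' hF fun y hy => ENNReal.ofReal_le_ofReal (ha y hy).le
  -- After multiplication by `C / t`, the part below `t / (2 * C)` contributes only half of its own
  -- measure and can be absorbed into the left-hand side.
  have hsplit : weightMeasure μ w {y ∈ B | w y < t * K} ≤
      ENNReal.ofReal (t / (2 * C)) * μ {y ∈ B | w y < t / (2 * C)} +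
      ENNReal.ofReal (t * K) * μ ({y ∈ B | w y < t * K} \ {y ∈ B | w y < t / (2 * C)}) := by
    rw [← measure_inter_add_sdiff _ (hm (t / (2 * C))), inter_eq_self_of_subset_right hsub]
    exact add_le_add (hbound _ _ (hm _) fun y hy => hy.2)
      (hbound _ _ ((hm _).diff (hm _)) fun y hy => hy.1.2)
  have hreal := ENNReal.toReal_mono (ENNReal.mul_ne_top ENNReal.ofReal_ne_top
    (ENNReal.add_ne_top.2 ⟨ENNReal.mul_ne_top ENNReal.ofReal_ne_top (hft _),
      ENNReal.mul_ne_top ENNReal.ofReal_ne_top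
        (measure_ne_top_of_subset sdiff_subset (hft _))⟩)) (h.trans (mul_le_mul_right hsplit _))
  rw [ENNReal.toReal_mul, ENNReal.toReal_add (ENNReal.mul_ne_top ENNReal.ofReal_ne_top (hft _))
    (ENNReal.mul_ne_top ENNReal.ofReal_ne_top (measure_ne_top_of_subset sdiff_subset (hft _))),
    ENNReal.toReal_mul, ENNReal.toReal_mul, ENNReal.toReal_ofReal (by positivity),
    ENNReal.toReal_ofReal (by positivity), ENNReal.toReal_ofReal (by positivity)] at hreal
  change μ.real _ ≤ C / t * (t / (2 * C) * μ.real _ + t * K * μ.real _) at hreal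
  rw [measureReal_sdiff hsub (hm _) (hft _)] at hreal
  have e : ∀ a b : ℝ, C / t * (t / (2 * C) * a + t * K * (b - a)) =
      2⁻¹ * a + C * K * (b - a) := by
    intro a b; field_simp
  rw [e] at hreal
  rw [div_mul_eq_mul_div, le_div_iff₀ (by positivity)]
  linarith

/-- Geometric decay of the measure of sublevel sets gives integrability of a negative power. -/
theorem lintegral_rpow_neg_le_of_decay {X : Type*} [MeasurableSpace X] {μ : Measure X} {w : X → ℝ}
    (hwm : Measurable w) {B : Set X}
    {t M θ s : ℝ} (ht : 0 < t) (hM : 1 < M) (hθ : 0 ≤ θ) (hs : 0 < s) (hMθ : M ^ s * θ < 1)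
    (h : ∀ j : ℕ, μ {y ∈ B | w y < t / M ^ j} ≤ ENNReal.ofReal (θ ^ j) * μ B) :
    ∫⁻ y in B, ENNReal.ofReal (w y) ^ (-s) ∂μ ≤
      ENNReal.ofReal (t ^ (-s) * (1 + M ^ s / (1 - M ^ s * θ))) * μ B := by
  have hM0 : 0 < M := by linarith
  have hm : ∀ a : ℝ, MeasurableSet {y | w y < a} := fun a => measurableSet_lt hwm measurable_const
  -- On the layer `t / M ^ (j+1) ≤ w < t / M ^ j` the negative power is at most `t ^ (-s) * (M ^ s)
  -- ^ (j+1)`, which is a single term of the series.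
  have hpt : ∀ y, ENNReal.ofReal (w y) ^ (-s) ≤ ENNReal.ofReal (t ^ (-s)) *
      (1 + ∑' j : ℕ, {y | w y < t / M ^ j}.indicator
        (fun _ => ENNReal.ofReal ((M ^ s) ^ (j + 1))) y) := by
    intro y
    have hpos : ∀ a : ℝ, 0 < a → ENNReal.ofReal a ^ (-s) = ENNReal.ofReal (a ^ (-s)) :=
      fun a ha => ENNReal.ofReal_rpow_of_pos ha
    have hmon : ∀ a, 0 < a → a ≤ w y →
        ENNReal.ofReal (w y) ^ (-s) ≤ ENNReal.ofReal (a ^ (-s)) := by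
      intro a ha haw
      rw [hpos _ (ha.trans_le haw)]
      exact ENNReal.ofReal_le_ofReal
        (Real.rpow_le_rpow_of_nonpos ha haw (neg_nonpos.2 hs.le))
    have htpos : 0 < t ^ (-s) := Real.rpow_pos_of_pos ht _
    rcases le_or_gt t (w y) with hty | hty
    · refine (hmon t ht hty).trans ?_
      calc ENNReal.ofReal (t ^ (-s)) = ENNReal.ofReal (t ^ (-s)) * 1 := (mul_one _).symm
        _ ≤ _ := mul_le_mul_right (self_le_add_right _ _) _
    rcases le_or_gt (w y) 0 with h0 | h0
    -- Where `w` is not positive, the left-hand side is infinite; all the indicators equal `1`, so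
    -- the series diverges as well.
    · have htop : ∑' j : ℕ, {y | w y < t / M ^ j}.indicator
          (fun _ => ENNReal.ofReal ((M ^ s) ^ (j + 1))) y = ⊤ := by
        refine top_le_iff.1 ?_
        calc (⊤ : ℝ≥0∞) = ∑' _ : ℕ, (1 : ℝ≥0∞) :=
              (ENNReal.tsum_const_eq_top_of_ne_zero one_ne_zero).symm
          _ ≤ _ := by
            refine ENNReal.tsum_le_tsum fun j => ?_
            rw [indicator_of_mem (show y ∈ {y | w y < t / M ^ j} from h0.trans_lt (by positivity)),
              ← ENNReal.ofReal_one]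
            exact ENNReal.ofReal_le_ofReal (one_le_pow₀ (Real.one_le_rpow hM.le hs.le))
      rw [htop, add_top, ENNReal.mul_top (by simpa using htpos)]
      exact le_top
    · obtain ⟨j, hj1, hj2⟩ : ∃ j : ℕ, w y < t / M ^ j ∧ t / M ^ (j + 1) ≤ w y := by
        have hex : ∃ n : ℕ, t / M ^ n ≤ w y := by
          obtain ⟨n, hn⟩ := pow_unbounded_of_one_lt (t / w y) hM
          refine ⟨n, ?_⟩
          rw [div_lt_iff₀ h0] at hn
          rw [div_le_iff₀ (by positivity)]
          linarith
        classical
        have hne : Nat.find hex ≠ 0 := fun h => by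
          have := Nat.find_spec hex
          rw [h, pow_zero, div_one] at this
          linarith
        obtain ⟨i, hi⟩ := Nat.exists_eq_succ_of_ne_zero hne
        refine ⟨i, not_le.1 (Nat.find_min hex (by omega)), ?_⟩
        have := Nat.find_spec hex
        rwa [hi] at this
      have hmem : y ∈ {y | w y < t / M ^ j} := hj1
      refine (hmon _ (by positivity) hj2).trans ?_
      calc ENNReal.ofReal ((t / M ^ (j + 1)) ^ (-s))
          = ENNReal.ofReal (t ^ (-s)) * ENNReal.ofReal ((M ^ s) ^ (j + 1)) := by
            rw [← ENNReal.ofReal_mul htpos.le]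
            congr 1
            rw [Real.div_rpow ht.le (by positivity),
              Real.rpow_neg (by positivity : 0 ≤ M ^ (j + 1)),
              div_inv_eq_mul, ← Real.rpow_natCast M, ← Real.rpow_mul hM0.le,
              ← Real.rpow_natCast (M ^ s), ← Real.rpow_mul hM0.le, mul_comm s]
        _ ≤ _ := by
            refine mul_le_mul_right (le_add_left ?_) _
            refine le_trans ?_ (ENNReal.le_tsum j)
            rw [indicator_of_mem hmem]
  have hMs : 0 < M ^ s := by positivity
  calc ∫⁻ y in B, ENNReal.ofReal (w y) ^ (-s) ∂μ
      ≤ ∫⁻ y in B, ENNReal.ofReal (t ^ (-s)) *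
      (1 + ∑' j : ℕ, {y | w y < t / M ^ j}.indicator
        (fun _ => ENNReal.ofReal ((M ^ s) ^ (j + 1))) y) ∂μ := lintegral_mono fun y => hpt y
    _ = ENNReal.ofReal (t ^ (-s)) * (μ B + ∑' j : ℕ, ENNReal.ofReal ((M ^ s) ^ (j + 1)) *
          μ {y ∈ B | w y < t / M ^ j}) := by
        have hmeas : ∀ j : ℕ, Measurable fun y => {y | w y < t / M ^ j}.indicator
            (fun _ => ENNReal.ofReal ((M ^ s) ^ (j + 1))) y := fun j =>
          measurable_const.indicator (hm _)
        have hmeas' : Measurable fun y => 1 + ∑' j : ℕ, {y | w y < t / M ^ j}.indicator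
            (fun _ => ENNReal.ofReal ((M ^ s) ^ (j + 1))) y :=
          measurable_const.add (Measurable.tsum hmeas)
        rw [lintegral_const_mul _ hmeas', lintegral_add_left measurable_const, setLIntegral_one,
          lintegral_tsum fun j => (hmeas j).aemeasurable]
        congr 3
        ext j
        rw [lintegral_indicator_const (hm _), Measure.restrict_apply (hm _), inter_comm]
        rfl
    _ ≤ ENNReal.ofReal (t ^ (-s)) * (μ B + ∑' j : ℕ, ENNReal.ofReal ((M ^ s) ^ (j + 1)) *
          (ENNReal.ofReal (θ ^ j) * μ B)) := by
        gcongr with j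
        exact h j
    _ = ENNReal.ofReal (t ^ (-s)) * (μ B + ENNReal.ofReal (M ^ s / (1 - M ^ s * θ)) * μ B) := by
        congr 2
        have e : ∀ j : ℕ, ENNReal.ofReal ((M ^ s) ^ (j + 1)) * (ENNReal.ofReal (θ ^ j) * μ B) =
            ENNReal.ofReal (M ^ s * (M ^ s * θ) ^ j) * μ B := by
          intro j
          rw [← mul_assoc, ← ENNReal.ofReal_mul (by positivity)]
          congr 2
          rw [mul_pow, pow_succ]; ring
        simp_rw [e]
        rw [ENNReal.tsum_mul_right, ← ENNReal.ofReal_tsum_of_nonneg (fun j => by positivity)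
          ((summable_geometric_of_lt_one (by positivity) hMθ).mul_left _), tsum_mul_left,
          tsum_geometric_of_lt_one (by positivity) hMθ, div_eq_mul_inv]
    _ = _ := by
        have hpos : 0 ≤ M ^ s / (1 - M ^ s * θ) := div_nonneg hMs.le (by linarith)
        rw [ENNReal.ofReal_mul (by positivity), ENNReal.ofReal_add zero_le_one hpos,
          ENNReal.ofReal_one]
        ring

end NegativePowers

/-! ### Condition (1) and doubling imply condition (3). -/

section Main

open Metric

variable {X : Type*} [PseudoMetricSpace X] [SecondCountableTopology X] [MeasurableSpace X]
  [BorelSpace X] {μ : Measure X} {w : X → ℝ} {R : ℝ}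

theorem cond3_of_cond1_of_measurable (hlen : LengthProperty X)
    (hinv : ∀ x y r, μ (ball x r) = μ (ball y r))
    (hpos : ∀ x r, 0 < r → μ (ball x r) ≠ 0) (hfin : ∀ x r, μ (ball x r) ≠ ⊤)
    (hwfin : ∀ x r, weightMeasure μ w (ball x r) ≠ ⊤)
    (hw : LocallyIntegrable w μ) (hwm : Measurable w) (hw0 : ∀ x, 0 ≤ w x)
    (hdouble : FiveDoubling ball μ w R) (h1 : Cond1 ball μ w R) : Cond3 ball μ w R := by
  obtain ⟨D₁, hD₁, hDw⟩ := hdouble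
  -- If every such ball has zero weight, the convention `0 * ∞ = 0` makes (3) hold for any exponent.
  -- Otherwise there is a centre of positive weight from which to derive the doubling of `μ`.
  by_cases htriv : ∀ (x : X) (r : ℝ), 0 < r → r ≤ R → weightMeasure μ w (ball x r) = 0
  · refine ⟨2, 2, Real.HolderConjugate.two_two, 1, one_pos, fun x r hr hrR => ?_⟩
    have h0 := htriv x r hr hrR
    rw [weightMeasure, withDensity_apply _ measurableSet_ball] at h0
    rw [setLAverage_eq, h0, ENNReal.zero_div, zero_mul]
    exact zero_le
  push Not at htriv
  obtain ⟨x₀, r₀, hr₀, hr₀R, hx₀⟩ := htriv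
  have hR : 0 < R := hr₀.trans_le hr₀R
  -- Doubling read backwards: a null ball about `x₀` would make the ball of radius `r₀` null.
  have hx₀' : ∀ r, 0 < r → weightMeasure μ w (ball x₀ r) ≠ 0 := by
    intro r hr h0
    obtain ⟨k, hk⟩ := pow_unbounded_of_one_lt (r₀ / r) (show (1 : ℝ) < 5 by norm_num)
    rw [div_lt_iff₀ hr] at hk
    have h5 : (0 : ℝ) < 5 ^ k := by positivity
    have hq : r₀ / 5 ^ k ≤ r := by rw [div_le_iff₀ h5]; linarith
    have e : 5 ^ k * (r₀ / 5 ^ k) = r₀ := by field_simp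
    have := measure_ball_pow_five_le hDw k x₀ (r₀ / 5 ^ k) (by positivity)
      (by rw [e]; linarith)
    rw [e, measure_mono_null (ball_subset_ball hq) h0, mul_zero] at this
    exact hx₀ (le_zero_iff.1 this)
  obtain ⟨D₂, hD₂, hDμ⟩ := exists_doubling_of_cond1 hlen hinv hfin hwfin hD₁.le hDw h1 hx₀'
  obtain ⟨ε, hε, δ, hδ, h1⟩ := h1
  set D := max D₁ D₂
  have hD1 : 1 ≤ D := hD₂.trans (le_max_right _ _)
  have hD0 : 0 < D := by linarith
  have hDw' : ∀ x r, 0 < r → r ≤ R →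
      weightMeasure μ w (ball x (5 * r)) ≤ ENNReal.ofReal D * weightMeasure μ w (ball x r) :=
    fun x r hr hrR => (hDw x r hr hrR).trans (by gcongr; exact le_max_left _ _)
  have hDμ' : ∀ x r, 0 < r → r ≤ R / 5 → μ (ball x (5 * r)) ≤ ENNReal.ofReal D * μ (ball x r) :=
    fun x r hr hrR => (hDμ x r hr hrR).trans (by gcongr; exact le_max_right _ _)
  have h1δ : 0 < 1 - δ := by linarith [hδ.2]
  set C := D ^ 2 / (1 - δ) with hC
  have hC1 : 1 ≤ C := by
    rw [hC, one_le_div h1δ]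
    nlinarith [hδ.1]
  set K := ε⁻¹ with hK
  have hK1 : 1 ≤ K := (one_le_inv₀ hε.1).2 hε.2.le
  set θ := C * K / (2⁻¹ + C * K) with hθ
  have hθ0 : 0 < θ := by positivity
  have hθ1 : θ < 1 := by rw [hθ, div_lt_one (by positivity)]; linarith
  -- The decay estimate at `a / K` compares the levels `a` and `a / (2 * C * K)`, so each
  -- application divides the level by `M`.
  set M := 2 * C * K with hM
  have hM1 : 1 < M := by nlinarith
  -- With this exponent `M ^ s * θ` is the square root of `θ`, and the layers sum to a convergent
  -- geometric series.
  set s := -Real.log θ / (2 * Real.log M) with hs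
  have hlogM : 0 < Real.log M := Real.log_pos hM1
  have hs0 : 0 < s := div_pos (neg_pos.2 (Real.log_neg hθ0 hθ1)) (by positivity)
  have hMθ : M ^ s * θ < 1 := by
    rw [Real.rpow_def_of_pos (by linarith)]
    have : Real.log M * s = -Real.log θ / 2 := by rw [hs]; field_simp
    rw [this]
    calc _ = Real.exp (-Real.log θ / 2) * Real.exp (Real.log θ) := by rw [Real.exp_log hθ0]
      _ < 1 := ?_
    rw [← Real.exp_add, Real.exp_lt_one_iff]
    linarith [Real.log_neg hθ0 hθ1]
  set S := 1 + M ^ s / (1 - M ^ s * θ) with hS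
  have hS0 : 0 < S := by
    have : 0 ≤ M ^ s / (1 - M ^ s * θ) := div_nonneg (by positivity) (by linarith)
    linarith
  -- This conjugate pair is the one for which `p' / p = s`.
  have hconj : (1 + s⁻¹).HolderConjugate (1 + s) := by
    rw [Real.holderConjugate_iff]
    refine ⟨by linarith [inv_pos.2 hs0], ?_⟩
    field_simp
    ring
  have hq1 : (1 + s) / (1 + s⁻¹) = s := by field_simp; ring
  have hq2 : (1 + s⁻¹) / (1 + s) = s⁻¹ := by field_simp; ring
  refine ⟨1 + s⁻¹, 1 + s, hconj, 2 * D ^ 3 * S ^ s⁻¹, by positivity, fun x r hr hrR => ?_⟩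
  rw [hq1, hq2]
  have hBm : MeasurableSet (ball x r) := measurableSet_ball
  have hB0 := hpos x r hr
  have hBt := hfin x r
  set N := (weightMeasure μ w).real (ball x r) with hN
  set m := μ.real (ball x r) with hm
  have hm0 : 0 < m := ENNReal.toReal_pos hB0 hBt
  have hμm : μ (ball x r) = ENNReal.ofReal m := (ENNReal.ofReal_toReal hBt).symm
  have hνN : weightMeasure μ w (ball x r) = ENNReal.ofReal N :=
    (ENNReal.ofReal_toReal (hwfin x r)).symm
  have havg : ⨍⁻ y in ball x r, ENNReal.ofReal (w y) ∂μ = ENNReal.ofReal (N / m) := by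
    rw [setLAverage_eq, ENNReal.ofReal_div_of_pos hm0, ← hνN, ← hμm, weightMeasure,
      withDensity_apply _ hBm]
  have hN0 : 0 ≤ N := ENNReal.toReal_nonneg
  rcases hN0.eq_or_lt with hNz | hNpos
  · rw [havg, ← hNz]; simp
  -- Half of the threshold in the level set estimate, where the inequality is strict. It explains
  -- the factor `2 * D ^ 3` in the final constant.
  set t := N / (2 * D ^ 3 * m) with ht
  have ht0 : 0 < t := by positivity
  have hlevel : ∀ a : ℝ, 0 < a → a ≤ t → μ {y ∈ ball x r | w y < a} ≤
      ENNReal.ofReal (C / a) * weightMeasure μ w {y ∈ ball x r | w y < a * K} := by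
    intro a ha hat
    have := measure_lt_le_weightMeasure_lt hlen hinv hpos hfin hwfin hw hwm hw0 hD0 hDw' hDμ' hε hδ
      h1 (x := x) hr hrR ha ?_
    · rw [div_eq_mul_inv a ε] at this
      convert this using 3
      rw [hC]; field_simp
    · rw [hμm, hνN, ← ENNReal.ofReal_pow hD0.le, ← ENNReal.ofReal_mul ha.le,
        ← ENNReal.ofReal_mul (by positivity), ENNReal.ofReal_lt_ofReal_iff hNpos]
      calc D ^ 3 * (a * m) ≤ D ^ 3 * (t * m) := by gcongr
        _ = N / 2 := by rw [ht]; field_simp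
        _ < N := by linarith
  have hdec : ∀ j : ℕ, μ.real {y ∈ ball x r | w y < t / M ^ j} ≤ θ ^ j * m := by
    intro j
    induction j with
    | zero =>
      rw [pow_zero θ, one_mul]
      exact measureReal_mono (sep_subset _ _) hBt
    | succ j ih =>
      have hMj : 1 ≤ M ^ j := one_le_pow₀ hM1.le
      have ha : 0 < t / M ^ j / K := by positivity
      have hat : t / M ^ j / K ≤ t :=
        (div_le_self (by positivity) hK1).trans (div_le_self ht0.le hMj)
      have := measureReal_lt_decay hwm hBm hBt hC1 hK1 ha (hlevel _ ha hat)
      have e1 : t / M ^ j / K / (2 * C) = t / M ^ (j + 1) := by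
        rw [pow_succ, hM]; field_simp
      have e2 : t / M ^ j / K * K = t / M ^ j := by field_simp
      rw [e1, e2] at this
      calc _ ≤ _ := this
        _ ≤ θ * (θ ^ j * m) := by gcongr
        _ = _ := by ring
  have hintegral := lintegral_rpow_neg_le_of_decay hwm ht0 hM1 hθ0.le hs0 hMθ (μ := μ) (fun j => by
    rw [hμm, ← ENNReal.ofReal_mul (by positivity)]
    refine (ENNReal.le_ofReal_iff_toReal_le
      (measure_ne_top_of_subset (sep_subset _ _) hBt) (by positivity)).2 (hdec j))
  have havg2 : ⨍⁻ y in ball x r, ENNReal.ofReal (w y) ^ (-s) ∂μ ≤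
      ENNReal.ofReal (t ^ (-s) * S) := by
    rw [setLAverage_eq, ENNReal.div_le_iff_le_mul (Or.inl hB0) (Or.inl hBt)]
    exact hintegral
  rw [havg]
  calc ENNReal.ofReal (N / m) * (⨍⁻ y in ball x r, ENNReal.ofReal (w y) ^ (-s) ∂μ) ^ s⁻¹
      ≤ ENNReal.ofReal (N / m) * ENNReal.ofReal (t ^ (-s) * S) ^ s⁻¹ := by gcongr
    _ = ENNReal.ofReal (N / m * (t⁻¹ * S ^ s⁻¹)) := by
        rw [ENNReal.ofReal_rpow_of_pos (by positivity), ← ENNReal.ofReal_mul (by positivity),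
          Real.mul_rpow (by positivity) hS0.le, ← Real.rpow_mul ht0.le, neg_mul,
          mul_inv_cancel₀ hs0.ne', Real.rpow_neg_one]
    _ ≤ _ := by
        refine ENNReal.ofReal_le_ofReal (le_of_eq ?_)
        rw [ht]; field_simp

/-- The conditions see `w` only up to null sets, so it may be replaced by a measurable version that
is nonnegative everywhere. -/
theorem cond3_of_cond1 (hlen : LengthProperty X)
    (hinv : ∀ x y r, μ (ball x r) = μ (ball y r))
    (hpos : ∀ x r, 0 < r → μ (ball x r) ≠ 0) (hfin : ∀ x r, μ (ball x r) ≠ ⊤)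
    (hwfin : ∀ x r, weightMeasure μ w (ball x r) ≠ ⊤)
    (hw : LocallyIntegrable w μ) (hw0 : ∀ᵐ x ∂μ, 0 ≤ w x)
    (hdouble : FiveDoubling ball μ w R) (h1 : Cond1 ball μ w R) : Cond3 ball μ w R := by
  set v : X → ℝ := fun x => max (hw.aestronglyMeasurable.mk w x) 0 with hv
  have hvm : Measurable v := hw.aestronglyMeasurable.stronglyMeasurable_mk.measurable.max
    measurable_const
  have hwv : w =ᵐ[μ] v := by
    filter_upwards [hw.aestronglyMeasurable.ae_eq_mk, hw0] with x hx hx0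
    rw [hv]
    simp only
    rw [← hx, max_eq_left hx0]
  have hof : (fun x => ENNReal.ofReal (w x)) =ᵐ[μ] fun x => ENNReal.ofReal (v x) := by
    filter_upwards [hwv] with x hx; rw [hx]
  have hmeas : weightMeasure μ w = weightMeasure μ v := withDensity_congr_ae hof
  have key : Cond3 ball μ v R := by
    refine cond3_of_cond1_of_measurable hlen hinv hpos hfin (fun x r => hmeas ▸ hwfin x r)
      ?_ hvm (fun x => le_max_right _ _) ?_ ?_
    · intro x
      obtain ⟨U, hU, hi⟩ := hw x
      exact ⟨U, hU, hi.congr_fun_ae (ae_restrict_of_ae hwv)⟩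
    · unfold FiveDoubling at hdouble ⊢; rwa [← hmeas]
    · unfold Cond1 at h1 ⊢; rwa [← hmeas]
  obtain ⟨p, p', hp, C, hC, h⟩ := key
  refine ⟨p, p', hp, C, hC, fun x r hr hrR => ?_⟩
  have e1 : ⨍⁻ y in ball x r, ENNReal.ofReal (w y) ∂μ = ⨍⁻ y in ball x r, ENNReal.ofReal (v y) ∂μ :=
    laverage_congr (ae_restrict_of_ae hof)
  have e2 : ⨍⁻ y in ball x r, ENNReal.ofReal (w y) ^ (-(p' / p)) ∂μ =
      ⨍⁻ y in ball x r, ENNReal.ofReal (v y) ^ (-(p' / p)) ∂μ := by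
    refine laverage_congr (ae_restrict_of_ae ?_)
    filter_upwards [hwv] with y hy; rw [hy]
  rw [e1, e2]
  exact h x r hr hrR

end Main

end LocalMuckenhoupt

/-! ### Absolutely continuous functions: composition, gluing, reparametrization. -/

namespace AbsolutelyContinuousOnInterval

open Filter Topology
open scoped NNReal

variable {X Y : Type*} [PseudoMetricSpace X] [PseudoMetricSpace Y] {f : ℝ → X} {a b c : ℝ}

theorem congr {g : ℝ → X} (hf : AbsolutelyContinuousOnInterval f a b) (h : EqOn f g (uIcc a b)) :
    AbsolutelyContinuousOnInterval g a b := by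
  rw [absolutelyContinuousOnInterval_iff] at hf ⊢
  intro ε hε
  obtain ⟨δ, hδ, H⟩ := hf ε hε
  refine ⟨δ, hδ, fun E hE hEδ => ?_⟩
  convert H E hE hEδ using 1
  refine Finset.sum_congr rfl fun i hi => ?_
  rw [h (hE.1 i hi).1, h (hE.1 i hi).2]

theorem lipschitzOnWith_comp {g : X → Y} {K : ℝ≥0} {s : Set X}
    (hg : LipschitzOnWith K g s) (hf : AbsolutelyContinuousOnInterval f a b)
    (hs : MapsTo f (uIcc a b) s) : AbsolutelyContinuousOnInterval (fun t => g (f t)) a b := by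
  rw [absolutelyContinuousOnInterval_iff] at hf ⊢
  intro ε hε
  obtain ⟨δ, hδ, H⟩ := hf (ε / (K + 1)) (by positivity)
  refine ⟨δ, hδ, fun E hE hEδ => ?_⟩
  calc ∑ i ∈ Finset.range E.1, dist (g (f (E.2 i).1)) (g (f (E.2 i).2))
      ≤ ∑ i ∈ Finset.range E.1, (K : ℝ) * dist (f (E.2 i).1) (f (E.2 i).2) :=
        Finset.sum_le_sum fun i hi =>
          hg.dist_le_mul _ (hs (hE.1 i hi).1) _ (hs (hE.1 i hi).2)
    _ = K * ∑ i ∈ Finset.range E.1, dist (f (E.2 i).1) (f (E.2 i).2) := by rw [Finset.mul_sum]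
    _ ≤ (K + 1) * ∑ i ∈ Finset.range E.1, dist (f (E.2 i).1) (f (E.2 i).2) := by
        gcongr; linarith
    _ < (K + 1) * (ε / (K + 1)) := by gcongr; exact H E hE hEδ
    _ = ε := by field_simp

/-- Each interval of a disjoint family is cut at `b` by truncating its endpoints with `min · b` and
`max · b`. Truncation preserves disjointness and does not increase lengths. -/
theorem trans_of_le (hab : a ≤ b) (hbc : b ≤ c) (h₁ : AbsolutelyContinuousOnInterval f a b)
    (h₂ : AbsolutelyContinuousOnInterval f b c) : AbsolutelyContinuousOnInterval f a c := by
  rw [absolutelyContinuousOnInterval_iff] at h₁ h₂ ⊢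
  intro ε hε
  obtain ⟨δ₁, hδ₁, H₁⟩ := h₁ (ε / 2) (by positivity)
  obtain ⟨δ₂, hδ₂, H₂⟩ := h₂ (ε / 2) (by positivity)
  refine ⟨min δ₁ δ₂, lt_min hδ₁ hδ₂, fun E hE hEδ => ?_⟩
  set E₁ : ℕ × (ℕ → ℝ × ℝ) := (E.1, fun i => (min (E.2 i).1 b, min (E.2 i).2 b)) with hE₁
  set E₂ : ℕ × (ℕ → ℝ × ℝ) := (E.1, fun i => (max (E.2 i).1 b, max (E.2 i).2 b)) with hE₂
  have hmem : ∀ i ∈ Finset.range E.1, ((E.2 i).1 ∈ Icc a c ∧ (E.2 i).2 ∈ Icc a c) := by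
    intro i hi; rw [← uIcc_of_le (hab.trans hbc)]; exact hE.1 i hi
  have hE₁m : E₁ ∈ disjWithin a b := by
    refine ⟨fun i hi => ?_, fun i hi j hj hij => (hE.2 hi hj hij).mono ?_ ?_⟩
    · have := hmem i hi
      rw [uIcc_of_le hab]
      simp only [hE₁, mem_Icc] at this ⊢
      grind
    all_goals
      simp only [hE₁]
      intro t ht
      simp only [mem_uIoc] at ht ⊢
      grind
  have hE₂m : E₂ ∈ disjWithin b c := by
    refine ⟨fun i hi => ?_, fun i hi j hj hij => (hE.2 hi hj hij).mono ?_ ?_⟩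
    · have := hmem i hi
      rw [uIcc_of_le hbc]
      simp only [hE₂, mem_Icc] at this ⊢
      grind
    all_goals
      simp only [hE₂]
      intro t ht
      simp only [mem_uIoc] at ht ⊢
      grind
  have hs₁ : ∑ i ∈ Finset.range E.1, dist (min (E.2 i).1 b) (min (E.2 i).2 b) < δ₁ := by
    refine lt_of_le_of_lt (Finset.sum_le_sum fun i _ => ?_) (hEδ.trans_le (min_le_left _ _))
    rw [Real.dist_eq, Real.dist_eq]
    simpa using abs_min_sub_min_le_max (E.2 i).1 b (E.2 i).2 b
  have hs₂ : ∑ i ∈ Finset.range E.1, dist (max (E.2 i).1 b) (max (E.2 i).2 b) < δ₂ := by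
    refine lt_of_le_of_lt (Finset.sum_le_sum fun i _ => ?_) (hEδ.trans_le (min_le_right _ _))
    rw [Real.dist_eq, Real.dist_eq]
    simpa using abs_max_sub_max_le_max (E.2 i).1 b (E.2 i).2 b
  have h1 := H₁ E₁ hE₁m hs₁
  have h2 := H₂ E₂ hE₂m hs₂
  calc ∑ i ∈ Finset.range E.1, dist (f (E.2 i).1) (f (E.2 i).2)
      ≤ ∑ i ∈ Finset.range E.1, (dist (f (min (E.2 i).1 b)) (f (min (E.2 i).2 b)) +
          dist (f (max (E.2 i).1 b)) (f (max (E.2 i).2 b))) := by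
        refine Finset.sum_le_sum fun i _ => ?_
        rcases le_total (E.2 i).1 b with h | h <;> rcases le_total (E.2 i).2 b with h' | h' <;>
          simp only [min_eq_left, min_eq_right, max_eq_left, max_eq_right, h, h', dist_self,
            add_zero, zero_add, le_refl]
        · exact dist_triangle _ _ _
        · rw [add_comm]; exact dist_triangle _ _ _
    _ < ε / 2 + ε / 2 := by rw [Finset.sum_add_distrib]; exact add_lt_add h1 h2
    _ = ε := add_halves ε

/-- Absolute continuity is a local property. -/
theorem of_local (hab : a ≤ b)
    (h : ∀ t ∈ Icc a b, ∃ U ∈ 𝓝 t, ∀ p q, a ≤ p → p ≤ q → q ≤ b → Icc p q ⊆ U →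
      AbsolutelyContinuousOnInterval f p q) : AbsolutelyContinuousOnInterval f a b := by
  choose! U hU hAC using h
  obtain ⟨t, ht0, htm, ⟨N, hN⟩, htU⟩ := exists_monotone_Icc_subset_open_cover_Icc hab
    (c := fun x : Icc a b => Subtype.val ⁻¹' interior (U x))
    (fun x => isOpen_interior.preimage continuous_subtype_val)
    (fun x _ => mem_iUnion.2 ⟨x, mem_interior_iff_mem_nhds.2 (hU x x.2)⟩)
  have hind : ∀ k : ℕ, AbsolutelyContinuousOnInterval f a (t k) := by
    intro k
    induction k with
    | zero =>
      rw [ht0]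
      obtain ⟨V, hV, H⟩ : ∃ V ∈ 𝓝 a, ∀ p q, a ≤ p → p ≤ q → q ≤ b → Icc p q ⊆ V →
          AbsolutelyContinuousOnInterval f p q :=
        ⟨U a, hU a (left_mem_Icc.2 hab), hAC a (left_mem_Icc.2 hab)⟩
      exact H a a le_rfl le_rfl hab (by simpa using mem_of_mem_nhds hV)
    | succ k ih =>
      obtain ⟨x, hx⟩ := htU k
      have hle : (t k : ℝ) ≤ t (k + 1) := htm (Nat.le_succ k)
      exact trans_of_le (t k).2.1 hle ih
        (hAC x x.2 _ _ (t k).2.1 hle (t (k + 1)).2.2 fun s hs =>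
          interior_subset (@hx ⟨s, (t k).2.1.trans hs.1, hs.2.trans (t (k + 1)).2.2⟩ hs))
  have := hind N
  rwa [hN N le_rfl] at this

theorem comp_mul_add {α β : ℝ} (hα : 0 < α)
    (hf : AbsolutelyContinuousOnInterval f (α * a + β) (α * b + β)) :
    AbsolutelyContinuousOnInterval (fun t => f (α * t + β)) a b := by
  rw [absolutelyContinuousOnInterval_iff] at hf ⊢
  intro ε hε
  obtain ⟨δ, hδ, H⟩ := hf ε hε
  refine ⟨δ / α, by positivity, fun E hE hEδ => ?_⟩
  refine H (E.1, fun i => (α * (E.2 i).1 + β, α * (E.2 i).2 + β)) ⟨fun i hi => ?_,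
    fun i hi j hj hij => ?_⟩ ?_
  · have := hE.1 i hi
    simp only [mem_uIcc] at this ⊢
    refine ⟨?_, ?_⟩
    · rcases this.1 with h | h
      · left; constructor <;> nlinarith
      · right; constructor <;> nlinarith
    · rcases this.2 with h | h
      · left; constructor <;> nlinarith
      · right; constructor <;> nlinarith
  · have hd := hE.2 hi hj hij
    rw [Function.onFun, Set.disjoint_left] at hd ⊢
    intro t ht ht'
    have key : ∀ p q : ℝ, t ∈ uIoc (α * p + β) (α * q + β) → (t - β) / α ∈ uIoc p q := by
      intro p q h
      rw [mem_uIoc] at h ⊢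
      rw [lt_div_iff₀ hα, div_le_iff₀ hα, lt_div_iff₀ hα, div_le_iff₀ hα]
      rcases h with h | h
      · left; constructor <;> linarith
      · right; constructor <;> linarith
    exact hd (key _ _ ht) (key _ _ ht')
  · calc ∑ i ∈ Finset.range E.1, dist (α * (E.2 i).1 + β) (α * (E.2 i).2 + β)
        = α * ∑ i ∈ Finset.range E.1, dist (E.2 i).1 (E.2 i).2 := by
          rw [Finset.mul_sum]
          refine Finset.sum_congr rfl fun i _ => ?_
          rw [Real.dist_eq, Real.dist_eq, add_sub_add_right_eq_sub, ← mul_sub, abs_mul,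
            abs_of_pos hα]
      _ < α * (δ / α) := by gcongr
      _ = δ := by field_simp

theorem comp_const_sub {σ : ℝ} (hf : AbsolutelyContinuousOnInterval f (σ - a) (σ - b)) :
    AbsolutelyContinuousOnInterval (fun t => f (σ - t)) a b := by
  rw [absolutelyContinuousOnInterval_iff] at hf ⊢
  intro ε hε
  obtain ⟨δ, hδ, H⟩ := hf ε hε
  refine ⟨δ, hδ, fun E hE hEδ => ?_⟩
  refine H (E.1, fun i => (σ - (E.2 i).1, σ - (E.2 i).2)) ⟨fun i hi => ?_,
    fun i hi j hj hij => ?_⟩ ?_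
  · have := hE.1 i hi
    simp only [mem_uIcc] at this ⊢
    refine ⟨?_, ?_⟩
    · rcases this.1 with h | h
      · right; constructor <;> linarith
      · left; constructor <;> linarith
    · rcases this.2 with h | h
      · right; constructor <;> linarith
      · left; constructor <;> linarith
  · have hd := hE.2 hi hj hij
    simp only [Function.onFun, uIoc, Ioc_disjoint_Ioc] at hd ⊢
    rw [min_sub_sub_left, min_sub_sub_left, max_sub_sub_left, max_sub_sub_left, min_sub_sub_left,
      max_sub_sub_left]
    rw [min_comm, max_comm] at hd
    grind
  · simpa only [dist_sub_left] using hEδ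

end AbsolutelyContinuousOnInterval

namespace SubRiemannian

/-! ### Absolutely continuous curves in a manifold. -/

section AbsCont

open Filter Topology

variable {n : ℕ} {G : Type*} [TopologicalSpace G] [ChartedSpace (EuclideanSpace ℝ (Fin n)) G]

/-- Absolute continuity of a curve in a manifold on the interval `[a, b]`. -/
def IsAbsContOn (n : ℕ) {G : Type*} [TopologicalSpace G]
    [ChartedSpace (EuclideanSpace ℝ (Fin n)) G] (γ : ℝ → G) (a b : ℝ) : Prop :=
  ContinuousOn γ (Icc a b) ∧
    ∀ (x : G) (c d : ℝ), a ≤ c → c ≤ d → d ≤ b →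
      MapsTo γ (Icc c d) (chartAt (EuclideanSpace ℝ (Fin n)) x).source →
      AbsolutelyContinuousOnInterval (fun t => chartAt (EuclideanSpace ℝ (Fin n)) x (γ t)) c d

theorem IsAbsContOn.mono {γ : ℝ → G} {a b c d : ℝ} (h : IsAbsContOn n γ a b) (hac : a ≤ c)
    (hdb : d ≤ b) : IsAbsContOn n γ c d :=
  ⟨h.1.mono (Icc_subset_Icc hac hdb), fun x p q hp hpq hq hm =>
    h.2 x p q (hac.trans hp) hpq (hq.trans hdb) hm⟩

theorem IsAbsContOn.congr {γ γ' : ℝ → G} {a b : ℝ} (h : IsAbsContOn n γ a b)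
    (heq : EqOn γ γ' (Icc a b)) : IsAbsContOn n γ' a b := by
  refine ⟨h.1.congr heq.symm, fun x p q hp hpq hq hm => ?_⟩
  have heq' : EqOn γ γ' (Icc p q) := heq.mono (Icc_subset_Icc hp hq)
  refine (h.2 x p q hp hpq hq fun t ht => by rw [heq' ht]; exact hm ht).congr ?_
  rw [uIcc_of_le hpq]
  intro t ht
  simp only [heq' ht]

theorem IsAbsContOn.union {γ : ℝ → G} {a b c : ℝ} (hab : a ≤ b) (hbc : b ≤ c)
    (h₁ : IsAbsContOn n γ a b) (h₂ : IsAbsContOn n γ b c) : IsAbsContOn n γ a c := by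
  refine ⟨?_, fun x p q hp hpq hq hm => ?_⟩
  · rw [← Icc_union_Icc_eq_Icc hab hbc]
    exact h₁.1.union_of_isClosed h₂.1 isClosed_Icc isClosed_Icc
  · rcases le_total q b with hqb | hqb
    · exact h₁.2 x p q hp hpq hqb hm
    rcases le_total b p with hbp | hbp
    · exact h₂.2 x p q hbp hpq hq hm
    · exact AbsolutelyContinuousOnInterval.trans_of_le hbp hqb
        (h₁.2 x p b hp hbp le_rfl (hm.mono_left (Icc_subset_Icc le_rfl hqb)))
        (h₂.2 x b q le_rfl hqb hq (hm.mono_left (Icc_subset_Icc hbp le_rfl)))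

/-- A curve which is locally the image of an absolutely continuous curve of a Euclidean space by a
`C^1` map is absolutely continuous. -/
theorem IsAbsContOn.of_local [IsManifold (𝓡 n) ∞ G] {γ : ℝ → G} {a b : ℝ}
    (h : ∀ t ∈ Icc a b, ∃ U ∈ 𝓝 t, ∃ (F : EuclideanSpace ℝ (Fin n) → G)
      (u : ℝ → EuclideanSpace ℝ (Fin n)),
      ContMDiffAt 𝓘(ℝ, EuclideanSpace ℝ (Fin n)) (𝓡 n) 1 F (u t) ∧
      ContinuousWithinAt u (Icc a b) t ∧ (∀ s ∈ U ∩ Icc a b, γ s = F (u s)) ∧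
      ∀ p q, a ≤ p → p ≤ q → q ≤ b → Icc p q ⊆ U → AbsolutelyContinuousOnInterval u p q) :
    IsAbsContOn n γ a b := by
  refine ⟨fun t ht => ?_, fun x c d hac hcd hdb hm => ?_⟩
  · obtain ⟨U, hU, F, u, hF, hu, hγ, -⟩ := h t ht
    have h1 : ContinuousWithinAt (fun s => F (u s)) (Icc a b) t :=
      hF.continuousAt.comp_continuousWithinAt hu
    refine h1.congr_of_eventuallyEq ?_ (hγ t ⟨mem_of_mem_nhds hU, ht⟩)
    filter_upwards [mem_nhdsWithin_of_mem_nhds hU, self_mem_nhdsWithin] with s hs hs'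
      using hγ s ⟨hs, hs'⟩
  · refine AbsolutelyContinuousOnInterval.of_local hcd fun t ht => ?_
    have htab : t ∈ Icc a b := Icc_subset_Icc hac hdb ht
    obtain ⟨U, hU, F, u, hF, hu, hγ, hAC⟩ := h t htab
    have hFx : F (u t) ∈ (chartAt (EuclideanSpace ℝ (Fin n)) x).source := by
      rw [← hγ t ⟨mem_of_mem_nhds hU, htab⟩]; exact hm ht
    have hcd : ContDiffAt ℝ 1 (fun v => chartAt (EuclideanSpace ℝ (Fin n)) x (F v)) (u t) := by
      have h1 : ContMDiffAt (𝓡 n) 𝓘(ℝ, EuclideanSpace ℝ (Fin n)) 1 (extChartAt (𝓡 n) x) (F (u t)) :=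
        contMDiffAt_extChartAt' hFx
      exact (h1.comp (u t) hF).contDiffAt
    -- In coordinates the `C^1` map is Lipschitz near `u t`, and Lipschitz maps preserve absolute
    -- continuity.
    obtain ⟨K, s, hs, hLip⟩ := hcd.exists_lipschitzOnWith
    have hpre : ∃ V ∈ 𝓝 t, ∀ y ∈ V ∩ Icc a b, u y ∈ s := by
      have := hu hs
      rw [mem_map, mem_nhdsWithin_iff_exists_mem_nhds_inter] at this
      obtain ⟨V, hV, hVs⟩ := this
      exact ⟨V, hV, fun y hy => hVs hy⟩
    obtain ⟨V, hV, hVs⟩ := hpre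
    refine ⟨U ∩ V, inter_mem hU hV, fun p q hcp hpq hqd hsub => ?_⟩
    have hsubab : Icc p q ⊆ Icc a b := Icc_subset_Icc (hac.trans hcp) (hqd.trans hdb)
    refine (AbsolutelyContinuousOnInterval.lipschitzOnWith_comp hLip
      (hAC p q (hac.trans hcp) hpq (hqd.trans hdb) (hsub.trans inter_subset_left)) ?_).congr ?_
    · rw [uIcc_of_le hpq]
      exact fun y hy => hVs y ⟨(hsub hy).2, hsubab hy⟩
    · rw [uIcc_of_le hpq]
      intro y hy
      simp only [hγ y ⟨(hsub hy).1, hsubab hy⟩]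

/-- A `C^1` map sends absolutely continuous curves to absolutely continuous curves. -/
theorem IsAbsContOn.comp [IsManifold (𝓡 n) ∞ G] {γ : ℝ → G} {a b : ℝ} (h : IsAbsContOn n γ a b)
    {f : G → G} (hf : ContMDiff (𝓡 n) (𝓡 n) 1 f) : IsAbsContOn n (fun t => f (γ t)) a b := by
  refine IsAbsContOn.of_local fun t ht => ?_
  set e := chartAt (EuclideanSpace ℝ (Fin n)) (γ t) with he
  have hmem : e.source ∈ 𝓝 (γ t) := chart_source_mem_nhds _ _
  have hpre : ∃ V ∈ 𝓝 t, ∀ y ∈ V ∩ Icc a b, γ y ∈ e.source := by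
    have := h.1 t ht hmem
    rw [mem_map, mem_nhdsWithin_iff_exists_mem_nhds_inter] at this
    obtain ⟨V, hV, hVs⟩ := this
    exact ⟨V, hV, fun y hy => hVs hy⟩
  obtain ⟨V, hV, hVs⟩ := hpre
  have htV : γ t ∈ e.source := mem_chart_source _ _
  refine ⟨V, hV, fun v => f (e.symm v), fun s => e (γ s), ?_, ?_, ?_, ?_⟩
  · refine (hf (e.symm (e (γ t)))).comp _ ?_
    have h1 : ContMDiffOn 𝓘(ℝ, EuclideanSpace ℝ (Fin n)) (𝓡 n) 1 (extChartAt (𝓡 n) (γ t)).symm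
      (extChartAt (𝓡 n) (γ t)).target := contMDiffOn_extChartAt_symm _
    exact h1.contMDiffAt ((isOpen_extChartAt_target _).mem_nhds (mem_extChartAt_target _))
  · exact (e.continuousAt htV).comp_continuousWithinAt (h.1 t ht)
  · intro s hs
    simp only [e.left_inv (hVs s hs)]
  · intro p q hap hpq hqb hsub
    exact h.2 (γ t) p q hap hpq hqb fun y hy =>
      hVs y ⟨hsub hy, Icc_subset_Icc hap hqb hy⟩

theorem IsAbsContOn.comp_mul_add {γ : ℝ → G} {a b α β : ℝ} (hα : 0 < α)
    (h : IsAbsContOn n γ (α * a + β) (α * b + β)) :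
    IsAbsContOn n (fun t => γ (α * t + β)) a b := by
  have hmaps : ∀ p q, MapsTo (fun t => α * t + β) (Icc p q) (Icc (α * p + β) (α * q + β)) :=
    fun p q t ht => ⟨by nlinarith [ht.1], by nlinarith [ht.2]⟩
  refine ⟨h.1.comp (by fun_prop) (hmaps a b), fun x p q hp hpq hq hm => ?_⟩
  refine AbsolutelyContinuousOnInterval.comp_mul_add (f := fun t => chartAt _ x (γ t)) hα
    (h.2 x _ _ (by nlinarith) (by nlinarith) (by nlinarith) fun t ht => ?_)
  have := @hm ((t - β) / α) ⟨by rw [le_div_iff₀ hα]; linarith [ht.1],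
    by rw [div_le_iff₀ hα]; linarith [ht.2]⟩
  have e : α * ((t - β) / α) + β = t := by field_simp; ring
  simpa only [e] using this

theorem IsAbsContOn.comp_const_sub {γ : ℝ → G} {a b σ : ℝ}
    (h : IsAbsContOn n γ (σ - b) (σ - a)) : IsAbsContOn n (fun t => γ (σ - t)) a b := by
  refine ⟨h.1.comp (by fun_prop) fun t ht => ⟨by linarith [ht.2], by linarith [ht.1]⟩,
    fun x p q hp hpq hq hm => ?_⟩
  refine AbsolutelyContinuousOnInterval.comp_const_sub (f := fun t => chartAt _ x (γ t))
    (h.2 x _ _ (by linarith) (by linarith) (by linarith) fun t ht => ?_).symm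
  have := @hm (σ - t) ⟨by linarith [ht.2], by linarith [ht.1]⟩
  simpa only [sub_sub_cancel] using this

end AbsCont

end SubRiemannian

namespace SubRiemannian

/-! ### Horizontal curves, their length, and the distance. -/

section Horizontal

open Filter Topology

variable {n : ℕ} {G : Type*} [TopologicalSpace G] [ChartedSpace (EuclideanSpace ℝ (Fin n)) G]
  [Group G]

/-- Horizontality of a curve at a given time. -/
def IsHorizontalAt (𝓗 : Submodule ℝ (GroupLieAlgebra (𝓡 n) G)) (γ : ℝ → G) (t : ℝ) : Prop :=
  MDifferentiableAt 𝓘(ℝ, ℝ) (𝓡 n) γ t ∧ velocity n γ t ∈ distribution 𝓗 (γ t)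

/-- The speed of a curve at a given time. -/
noncomputable def speed (Q : LinearMap.BilinForm ℝ (GroupLieAlgebra (𝓡 n) G)) (γ : ℝ → G) (t : ℝ) :
    ℝ≥0∞ :=
  ENNReal.ofReal (tangentNorm Q (γ t) (velocity n γ t))

/-- Horizontality of an absolutely continuous curve on an interval. -/
def IsHorizontalOn (𝓗 : Submodule ℝ (GroupLieAlgebra (𝓡 n) G)) (γ : ℝ → G) (a b : ℝ) : Prop :=
  IsAbsContOn n γ a b ∧ ∀ᵐ t ∂(volume.restrict (Icc a b)), IsHorizontalAt 𝓗 γ t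

/-- The length of a curve on an interval. -/
noncomputable def lengthOn (Q : LinearMap.BilinForm ℝ (GroupLieAlgebra (𝓡 n) G)) (γ : ℝ → G)
    (a b : ℝ) : ℝ≥0∞ :=
  ∫⁻ t in Icc a b, speed Q γ t

variable {𝓗 : Submodule ℝ (GroupLieAlgebra (𝓡 n) G)}
  {Q : LinearMap.BilinForm ℝ (GroupLieAlgebra (𝓡 n) G)} {γ γ' : ℝ → G} {a b c d t : ℝ} {x y z : G}

theorem mem_horizontalCurves_iff :
    γ ∈ horizontalCurves 𝓗 x y ↔ IsHorizontalOn 𝓗 γ 0 1 ∧ γ 0 = x ∧ γ 1 = y :=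
  ⟨fun h => ⟨⟨h.1, h.2.2.2⟩, h.2.1, h.2.2.1⟩, fun h => ⟨h.1.1, h.2.1, h.2.2, h.1.2⟩⟩

theorem tangentNorm_smul (α : ℝ) (v : TangentSpace (𝓡 n) x) :
    tangentNorm Q x (α • v) = |α| * tangentNorm Q x v := by
  have key : ∀ Z : GroupLieAlgebra (𝓡 n) G, √(Q (α • Z) (α • Z)) = |α| * √(Q Z Z) := by
    intro Z
    rw [map_smul, map_smul, LinearMap.smul_apply, smul_eq_mul, smul_eq_mul, ← mul_assoc,
      Real.sqrt_mul (mul_self_nonneg α), Real.sqrt_mul_self_eq_abs]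
  have h : mfderiv (𝓡 n) (𝓡 n) (fun y : G => x⁻¹ * y) x (α • v) =
      α • mfderiv (𝓡 n) (𝓡 n) (fun y : G => x⁻¹ * y) x v := map_smul _ α v
  exact (congrArg (fun Z : GroupLieAlgebra (𝓡 n) G => √(Q Z Z)) h).trans (key _)

theorem smul_mem_distribution (α : ℝ) {v : TangentSpace (𝓡 n) x} (hv : v ∈ distribution 𝓗 x) :
    α • v ∈ distribution 𝓗 x := by
  obtain ⟨X, hX, rfl⟩ := hv
  exact ⟨α • X, 𝓗.smul_mem α hX, by rw [mulInvariantVectorField_smul]; rfl⟩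

theorem IsHorizontalAt.congr (h : IsHorizontalAt 𝓗 γ t) (heq : γ =ᶠ[𝓝 t] γ') :
    IsHorizontalAt 𝓗 γ' t := by
  refine ⟨h.1.congr_of_eventuallyEq heq.symm, ?_⟩
  have hv : (velocity n γ t : EuclideanSpace ℝ (Fin n)) = velocity n γ' t := by
    have := heq.mfderiv_eq (I := 𝓘(ℝ, ℝ)) (I' := 𝓡 n)
    exact congrArg (fun L : ℝ →L[ℝ] EuclideanSpace ℝ (Fin n) => L 1) this
  -- The two velocities belong to tangent spaces indexed by different expressions for the same
  -- point. Generalizing the base points allows the equality to be substituted.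
  have key : ∀ (p q : G) (v w : EuclideanSpace ℝ (Fin n)), p = q → v = w →
      (v : TangentSpace (𝓡 n) p) ∈ distribution 𝓗 p →
      (w : TangentSpace (𝓡 n) q) ∈ distribution 𝓗 q := by
    rintro p _ v _ rfl rfl h; exact h
  exact key _ _ _ _ heq.eq_of_nhds hv h.2

theorem speed_congr (heq : γ =ᶠ[𝓝 t] γ') : speed Q γ t = speed Q γ' t := by
  have hv : (velocity n γ t : EuclideanSpace ℝ (Fin n)) = velocity n γ' t := by
    have := heq.mfderiv_eq (I := 𝓘(ℝ, ℝ)) (I' := 𝓡 n)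
    exact congrArg (fun L : ℝ →L[ℝ] EuclideanSpace ℝ (Fin n) => L 1) this
  have key : ∀ (p q : G) (v w : EuclideanSpace ℝ (Fin n)), p = q → v = w →
      tangentNorm Q p (v : TangentSpace (𝓡 n) p) = tangentNorm Q q (w : TangentSpace (𝓡 n) q) := by
    rintro p _ v _ rfl rfl; rfl
  exact congrArg ENNReal.ofReal (key _ _ _ _ heq.eq_of_nhds hv)

/-- At interior times, two curves that agree on the closed interval agree in a neighbourhood and
have the same velocity; this may fail at the endpoints. -/
theorem lengthOn_eq_Ioo : lengthOn Q γ a b = ∫⁻ t in Ioo a b, speed Q γ t :=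
  setLIntegral_congr Ioo_ae_eq_Icc.symm

theorem IsHorizontalOn.mono (h : IsHorizontalOn 𝓗 γ a b) (hac : a ≤ c) (hdb : d ≤ b) :
    IsHorizontalOn 𝓗 γ c d :=
  ⟨h.1.mono hac hdb, ae_mono (Measure.restrict_mono (Icc_subset_Icc hac hdb) le_rfl) h.2⟩

theorem IsHorizontalOn.congr (h : IsHorizontalOn 𝓗 γ a b) (heq : EqOn γ γ' (Icc a b)) :
    IsHorizontalOn 𝓗 γ' a b := by
  refine ⟨h.1.congr heq, ?_⟩
  have h2 := h.2
  rw [← restrict_Ioo_eq_restrict_Icc] at h2 ⊢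
  filter_upwards [h2, ae_restrict_mem measurableSet_Ioo] with t ht htI
  exact ht.congr (eventually_of_mem (Icc_mem_nhds htI.1 htI.2) heq)

theorem lengthOn_congr (heq : EqOn γ γ' (Icc a b)) : lengthOn Q γ a b = lengthOn Q γ' a b := by
  rw [lengthOn_eq_Ioo, lengthOn_eq_Ioo]
  exact setLIntegral_congr_fun measurableSet_Ioo fun t ht =>
    speed_congr (eventually_of_mem (Icc_mem_nhds ht.1 ht.2) heq)

theorem IsHorizontalOn.union (hab : a ≤ b) (hbc : b ≤ c) (h₁ : IsHorizontalOn 𝓗 γ a b)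
    (h₂ : IsHorizontalOn 𝓗 γ b c) : IsHorizontalOn 𝓗 γ a c := by
  refine ⟨h₁.1.union hab hbc h₂.1, ?_⟩
  rw [← Icc_union_Icc_eq_Icc hab hbc, ae_restrict_union_iff]
  exact ⟨h₁.2, h₂.2⟩

theorem lengthOn_add (hab : a ≤ b) (hbc : b ≤ c) :
    lengthOn Q γ a b + lengthOn Q γ b c = lengthOn Q γ a c := by
  have h1 : lengthOn Q γ b c = ∫⁻ t in Ioc b c, speed Q γ t := setLIntegral_congr Ioc_ae_eq_Icc.symm
  rw [h1, lengthOn, lengthOn, ← Icc_union_Ioc_eq_Icc hab hbc,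
    lintegral_union measurableSet_Ioc]
  rw [Set.disjoint_left]
  exact fun t ht ht' => absurd ht'.1 (not_lt.2 ht.2)

theorem hasMFDerivAt_comp_real {M : Type*} [TopologicalSpace M]
    [ChartedSpace (EuclideanSpace ℝ (Fin n)) M] {γ : ℝ → M} {φ : ℝ → ℝ} {α : ℝ}
    (hφ : HasDerivAt φ α t)
    (hγ : MDifferentiableAt 𝓘(ℝ, ℝ) (𝓡 n) γ (φ t)) :
    MDifferentiableAt 𝓘(ℝ, ℝ) (𝓡 n) (fun s => γ (φ s)) t ∧
      velocity n (fun s => γ (φ s)) t = α • velocity n γ (φ t) := by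
  have h1 : HasMFDerivAt 𝓘(ℝ, ℝ) 𝓘(ℝ, ℝ) φ t (ContinuousLinearMap.toSpanSingleton ℝ α) :=
    hφ.hasFDerivAt.hasMFDerivAt
  have h2 := hγ.hasMFDerivAt.comp t h1
  refine ⟨h2.mdifferentiableAt, ?_⟩
  have h3 := h2.mfderiv
  have h4 : velocity n (fun s => γ (φ s)) t =
      (mfderiv 𝓘(ℝ, ℝ) (𝓡 n) γ (φ t)) (ContinuousLinearMap.toSpanSingleton ℝ α (1 : ℝ)) :=
    congrArg (fun L : ℝ →L[ℝ] EuclideanSpace ℝ (Fin n) => L 1) h3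
  rw [h4, ContinuousLinearMap.toSpanSingleton_apply]
  have h5 : (1 : ℝ) • α = α • (1 : ℝ) := by simp
  exact (congrArg (mfderiv 𝓘(ℝ, ℝ) (𝓡 n) γ (φ t)) h5).trans
    (ContinuousLinearMap.map_smul _ α (1 : ℝ))

theorem IsHorizontalAt.comp_real {φ : ℝ → ℝ} {α : ℝ} (hφ : HasDerivAt φ α t)
    (h : IsHorizontalAt 𝓗 γ (φ t)) : IsHorizontalAt 𝓗 (fun s => γ (φ s)) t := by
  obtain ⟨h1, h2⟩ := hasMFDerivAt_comp_real hφ h.1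
  refine ⟨h1, ?_⟩
  rw [h2]
  exact smul_mem_distribution α h.2

theorem speed_comp_real {φ : ℝ → ℝ} {α : ℝ} (hφ : HasDerivAt φ α t)
    (hγ : MDifferentiableAt 𝓘(ℝ, ℝ) (𝓡 n) γ (φ t)) :
    speed Q (fun s => γ (φ s)) t = ENNReal.ofReal |α| * speed Q γ (φ t) := by
  obtain ⟨-, h2⟩ := hasMFDerivAt_comp_real hφ hγ
  rw [speed, speed, ← ENNReal.ofReal_mul (abs_nonneg α), h2]
  congr 1
  exact tangentNorm_smul α _

/-- Affine reparametrizations preserve null sets. -/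
theorem ae_comp_mul_add {P : ℝ → Prop} {α β : ℝ} (hα : α ≠ 0) {s : Set ℝ}
    (h : ∀ᵐ t ∂(volume.restrict s), P t) (hs : MeasurableSet s) :
    ∀ᵐ t ∂(volume.restrict ((fun t => α * t + β) ⁻¹' s)), P (α * t + β) := by
  have hm : Measurable fun t : ℝ => α * t + β := by fun_prop
  rw [ae_restrict_iff' hs] at h
  rw [ae_restrict_iff' (hm hs)]
  have h1 : volume {t | ¬ (t ∈ s → P t)} = 0 := h
  change volume ((fun t => α * t + β) ⁻¹' {t | ¬ (t ∈ s → P t)}) = 0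
  have e : (fun t => α * t + β) ⁻¹' {t | ¬ (t ∈ s → P t)} =
      (fun t => α * t) ⁻¹' ((fun t => t + β) ⁻¹' {t | ¬ (t ∈ s → P t)}) := rfl
  rw [e, Real.volume_preimage_mul_left hα, measure_preimage_add_right, h1, mul_zero]

theorem lengthOn_comp_affine {α β : ℝ} (hα : α ≠ 0) {p q : ℝ}
    (hpre : (fun t => α * t + β) '' Icc a b = Icc p q) (h : IsHorizontalOn 𝓗 γ p q) :
    (∀ᵐ t ∂(volume.restrict (Icc a b)), IsHorizontalAt 𝓗 (fun t => γ (α * t + β)) t) ∧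
    lengthOn Q (fun t => γ (α * t + β)) a b = lengthOn Q γ p q := by
  have hinj : Function.Injective fun t : ℝ => α * t + β := fun s t hst => by
    simpa [hα] using hst
  have hpre' : (fun t => α * t + β) ⁻¹' Icc p q = Icc a b := by
    rw [← hpre, preimage_image_eq _ hinj]
  have hder : ∀ t, HasDerivAt (fun t : ℝ => α * t + β) α t := fun t => by
    simpa using ((hasDerivAt_id t).const_mul α).add_const β
  have hae := ae_comp_mul_add hα (β := β) h.2 measurableSet_Icc
  rw [hpre'] at hae
  refine ⟨?_, ?_⟩
  · filter_upwards [hae] with t ht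
    exact ht.comp_real (hder t)
  · rw [lengthOn, lengthOn, ← hpre, lintegral_image_eq_lintegral_abs_deriv_mul measurableSet_Icc
      (fun t _ => (hder t).hasDerivWithinAt) hinj.injOn]
    refine lintegral_congr_ae ?_
    filter_upwards [hae] with t ht
    exact speed_comp_real (hder t) ht.1

theorem IsHorizontalOn.comp_mul_add {α β : ℝ} (hα : 0 < α)
    (h : IsHorizontalOn 𝓗 γ (α * a + β) (α * b + β)) :
    IsHorizontalOn 𝓗 (fun t => γ (α * t + β)) a b ∧
      lengthOn Q (fun t => γ (α * t + β)) a b = lengthOn Q γ (α * a + β) (α * b + β) := by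
  have := lengthOn_comp_affine (Q := Q) (a := a) (b := b) hα.ne' (image_affine_Icc' hα β a b) h
  exact ⟨⟨h.1.comp_mul_add hα, this.1⟩, this.2⟩

theorem IsHorizontalOn.comp_const_sub {σ : ℝ} (h : IsHorizontalOn 𝓗 γ (σ - b) (σ - a)) :
    IsHorizontalOn 𝓗 (fun t => γ (σ - t)) a b ∧
      lengthOn Q (fun t => γ (σ - t)) a b = lengthOn Q γ (σ - b) (σ - a) := by
  have e : (fun t : ℝ => -1 * t + σ) = fun t => σ - t := by ext t; ring
  have himg : (fun t => -1 * t + σ) '' Icc a b = Icc (σ - b) (σ - a) := by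
    rw [e, image_const_sub_Icc]
  have := lengthOn_comp_affine (Q := Q) (a := a) (b := b) (by norm_num) himg h
  have e' : (fun t : ℝ => γ (-1 * t + σ)) = fun t => γ (σ - t) := by ext t; congr 1; ring
  rw [e'] at this
  exact ⟨⟨h.1.comp_const_sub, this.1⟩, this.2⟩

/-- The distance between the endpoints of a horizontal curve is at most its length. -/
theorem ccDist_le_lengthOn (hab : a < b) (h : IsHorizontalOn 𝓗 γ a b) :
    ccDist 𝓗 Q (γ a) (γ b) ≤ lengthOn Q γ a b := by
  have hpos : 0 < b - a := sub_pos.2 hab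
  have h' : IsHorizontalOn 𝓗 γ ((b - a) * 0 + a) ((b - a) * 1 + a) := by
    simpa using h
  obtain ⟨h1, h2⟩ := h'.comp_mul_add (Q := Q) hpos
  have e : lengthOn Q γ ((b - a) * 0 + a) ((b - a) * 1 + a) = lengthOn Q γ a b := by simp
  rw [← e, ← h2]
  exact iInf₂_le (fun t => γ ((b - a) * t + a))
    (mem_horizontalCurves_iff.2 ⟨h1, by simp, by simp⟩)

theorem exists_horizontal_of_ccDist_lt {r : ℝ≥0∞} (h : ccDist 𝓗 Q x y < r) :
    ∃ γ : ℝ → G, IsHorizontalOn 𝓗 γ 0 1 ∧ γ 0 = x ∧ γ 1 = y ∧ lengthOn Q γ 0 1 < r := by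
  rw [ccDist] at h
  obtain ⟨γ, hγ⟩ := iInf_lt_iff.1 h
  obtain ⟨hm, hlt⟩ := iInf_lt_iff.1 hγ
  obtain ⟨h1, h2, h3⟩ := mem_horizontalCurves_iff.1 hm
  exact ⟨γ, h1, h2, h3, hlt⟩

theorem ccDist_triangle : ccDist 𝓗 Q x z ≤ ccDist 𝓗 Q x y + ccDist 𝓗 Q y z := by
  refine ENNReal.le_of_forall_pos_le_add fun ε hε hfin => ?_
  have hε' : (0 : ℝ≥0∞) < ε / 2 := ENNReal.half_pos (ENNReal.coe_ne_zero.2 hε.ne')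
  obtain ⟨hx, hy⟩ := ENNReal.add_lt_top.1 hfin
  obtain ⟨γ₁, h₁, h₁0, h₁1, hl₁⟩ := exists_horizontal_of_ccDist_lt
    (ENNReal.lt_add_right hx.ne hε'.ne')
  obtain ⟨γ₂, h₂, h₂0, h₂1, hl₂⟩ := exists_horizontal_of_ccDist_lt
    (ENNReal.lt_add_right hy.ne hε'.ne')
  have h₂' : IsHorizontalOn 𝓗 γ₂ (1 * 1 + -1) (1 * 2 + -1) := by norm_num; exact h₂
  obtain ⟨h₃, hl₃⟩ := h₂'.comp_mul_add (Q := Q) one_pos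
  -- The concatenation lives on `[0, 2]`; the affine rescaling is left to `ccDist_le_lengthOn`.
  set γ : ℝ → G := fun t => if t ≤ 1 then γ₁ t else γ₂ (1 * t + -1) with hγ
  have e₁ : EqOn γ₁ γ (Icc 0 1) := fun t ht => by simp only [hγ, if_pos ht.2]
  have e₂ : EqOn (fun t => γ₂ (1 * t + -1)) γ (Icc 1 2) := fun t ht => by
    rcases ht.1.eq_or_lt with rfl | h
    · simp [hγ, h₁1, h₂0]
    · simp only [hγ, if_neg (not_le.2 h)]
  have hu : IsHorizontalOn 𝓗 γ 0 2 :=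
    (h₁.congr e₁).union (by norm_num) (by norm_num) (h₃.congr e₂)
  have hle := ccDist_le_lengthOn (Q := Q) (by norm_num) hu
  have g0 : γ 0 = x := by simp [hγ, h₁0]
  have g2 : γ 2 = z := by simp only [hγ]; norm_num; exact h₂1
  rw [g0, g2, ← lengthOn_add (b := 1) (by norm_num) (by norm_num), ← lengthOn_congr e₁,
    ← lengthOn_congr e₂, hl₃] at hle
  refine hle.trans ?_
  have e : lengthOn Q γ₂ (1 * 1 + -1) (1 * 2 + -1) = lengthOn Q γ₂ 0 1 := by norm_num
  rw [e]
  calc lengthOn Q γ₁ 0 1 + lengthOn Q γ₂ 0 1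
      ≤ (ccDist 𝓗 Q x y + ε / 2) + (ccDist 𝓗 Q y z + ε / 2) := add_le_add hl₁.le hl₂.le
    _ = ccDist 𝓗 Q x y + ccDist 𝓗 Q y z + (ε / 2 + ε / 2) := by ring
    _ = _ := by rw [ENNReal.add_halves]

theorem ccDist_le_symm : ccDist 𝓗 Q y x ≤ ccDist 𝓗 Q x y := by
  refine le_of_forall_gt fun r hr => ?_
  obtain ⟨γ, h, h0, h1, hl⟩ := exists_horizontal_of_ccDist_lt hr
  have h' : IsHorizontalOn 𝓗 γ (1 - 1) (1 - 0) := by simpa using h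
  obtain ⟨h2, hl2⟩ := h'.comp_const_sub (Q := Q)
  have := ccDist_le_lengthOn (Q := Q) one_pos h2
  rw [hl2] at this
  simp only [sub_self, sub_zero, h0, h1] at this
  exact this.trans_lt hl

theorem ccDist_comm : ccDist 𝓗 Q x y = ccDist 𝓗 Q y x := le_antisymm ccDist_le_symm ccDist_le_symm

theorem lengthOn_self : lengthOn Q γ a a = 0 := by
  rw [lengthOn, Icc_self]
  exact setLIntegral_measure_zero _ _ (by simp)

theorem lengthOn_mono (hac : a ≤ c) (hdb : d ≤ b) : lengthOn Q γ c d ≤ lengthOn Q γ a b :=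
  lintegral_mono_set (Icc_subset_Icc hac hdb)

/-- The length of a curve of finite length on `[0, t]` depends continuously on `t`. -/
theorem continuousOn_lengthOn (h : lengthOn Q γ 0 1 ≠ ⊤) :
    ContinuousOn (fun t => (lengthOn Q γ 0 t).toReal) (Icc 0 1) := by
  have hfin : ∀ s t, 0 ≤ s → t ≤ 1 → lengthOn Q γ s t ≠ ⊤ := fun s t hs ht =>
    ne_top_of_le_ne_top h (lengthOn_mono hs ht)
  rw [Metric.continuousOn_iff]
  intro t ht ε hε
  obtain ⟨δ, hδ, H⟩ := exists_pos_setLIntegral_lt_of_measure_lt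
    (μ := volume.restrict (Icc (0 : ℝ) 1)) (f := speed Q γ) h (ENNReal.ofReal_pos.2 hε).ne'
  have key : ∀ p q, 0 ≤ p → p ≤ q → q ≤ 1 → ENNReal.ofReal (q - p) < δ →
      |(lengthOn Q γ 0 q).toReal - (lengthOn Q γ 0 p).toReal| < ε := by
    intro p q hp hpq hq hlt
    rw [← lengthOn_add hp hpq, ENNReal.toReal_add (hfin _ _ le_rfl (hpq.trans hq))
      (hfin _ _ hp hq), add_sub_cancel_left, abs_of_nonneg ENNReal.toReal_nonneg]
    refine (ENNReal.lt_ofReal_iff_toReal_lt (hfin _ _ hp hq)).1 ?_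
    have := H (Icc p q) ?_
    · rwa [Measure.restrict_restrict measurableSet_Icc,
        inter_eq_self_of_subset_left (Icc_subset_Icc hp hq)] at this
    · refine (Measure.restrict_apply_le _ _).trans_lt ?_
      rwa [Real.volume_Icc]
  obtain ⟨η, hη, hηδ⟩ : ∃ η : ℝ, 0 < η ∧ ENNReal.ofReal η ≤ δ := by
    rcases eq_or_ne δ ⊤ with rfl | hδt
    · exact ⟨1, one_pos, le_top⟩
    · exact ⟨δ.toReal, ENNReal.toReal_pos hδ.ne' hδt, ENNReal.ofReal_toReal_le⟩
  refine ⟨η, hη, fun s hs hst => ?_⟩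
  rw [Real.dist_eq] at hst ⊢
  have hlt : ENNReal.ofReal |s - t| < δ :=
    ((ENNReal.ofReal_lt_ofReal_iff hη).2 hst).trans_le hηδ
  rcases le_total t s with hle | hle
  · exact key t s ht.1 hle hs.2 (by rwa [abs_of_nonneg (sub_nonneg.2 hle)] at hlt)
  · rw [abs_sub_comm]
    exact key s t hs.1 hle ht.2 (by rwa [abs_sub_comm, abs_of_nonneg (sub_nonneg.2 hle)] at hlt)

theorem exists_lengthOn_split {A B : ℝ≥0∞} (hA : 0 < A) (hB : 0 < B)
    (h : lengthOn Q γ 0 1 < A + B) :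
    ∃ t, 0 < t ∧ t < 1 ∧ lengthOn Q γ 0 t < A ∧ lengthOn Q γ t 1 < B := by
  have hL : lengthOn Q γ 0 1 ≠ ⊤ := (h.trans_le le_top).ne
  rcases eq_or_ne (lengthOn Q γ 0 1) 0 with h0 | h0
  · refine ⟨2⁻¹, by norm_num, by norm_num, ?_, ?_⟩
    · exact (lengthOn_mono le_rfl (by norm_num)).trans_lt (h0 ▸ hA)
    · exact (lengthOn_mono (by norm_num) le_rfl).trans_lt (h0 ▸ hB)
  -- The length `v` of the initial piece must be below `A` and leave less than `B`. It is also
  -- positive and below the total length, so the cut occurs at an interior time.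
  obtain ⟨v, hv1, hv2⟩ : ∃ v, lengthOn Q γ 0 1 - B < v ∧ v < min A (lengthOn Q γ 0 1) := by
    refine exists_between (lt_min ?_ (ENNReal.sub_lt_self hL h0 hB.ne'))
    rcases lt_or_ge (lengthOn Q γ 0 1) B with hlt | hge
    · rwa [tsub_eq_zero_of_le hlt.le]
    · exact ENNReal.sub_lt_of_lt_add hge h
  have hvL : v < lengthOn Q γ 0 1 := hv2.trans_le (min_le_right _ _)
  have hvt : v ≠ ⊤ := (hvL.trans_le le_top).ne
  have hivt := intermediate_value_Icc (zero_le_one : (0 : ℝ) ≤ 1) (continuousOn_lengthOn hL)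
  obtain ⟨t, ht, htv⟩ := hivt (show v.toReal ∈ Icc _ _ from
    ⟨by rw [lengthOn_self]; exact ENNReal.toReal_nonneg, ENNReal.toReal_mono hL hvL.le⟩)
  have htv' : lengthOn Q γ 0 t = v :=
    (ENNReal.toReal_eq_toReal_iff' (ne_top_of_le_ne_top hL (lengthOn_mono le_rfl ht.2)) hvt).1 htv
  have ht0 : 0 < t := by
    refine lt_of_le_of_ne ht.1 fun h => ?_
    rw [← h, lengthOn_self] at htv'
    exact absurd hv1 (by rw [← htv']; exact not_lt_zero)
  have ht1 : t < 1 := by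
    refine lt_of_le_of_ne ht.2 fun h => ?_
    rw [h] at htv'
    exact hvL.ne htv'.symm
  refine ⟨t, ht0, ht1, htv' ▸ hv2.trans_le (min_le_left _ _), ?_⟩
  have hadd := lengthOn_add (Q := Q) (γ := γ) ht.1 ht.2
  rw [htv'] at hadd
  have hlt : lengthOn Q γ 0 1 < v + B := by
    have := ENNReal.lt_add_of_sub_lt_right (Or.inl hL) hv1
    exact this
  rw [← hadd] at hlt
  exact (ENNReal.add_lt_add_iff_left hvt).1 hlt

theorem exists_ccDist_split {A B : ℝ≥0∞} (hA : 0 < A) (hB : 0 < B)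
    (h : ccDist 𝓗 Q x y < A + B) : ∃ z, ccDist 𝓗 Q x z < A ∧ ccDist 𝓗 Q z y < B := by
  obtain ⟨γ, hγ, h0, h1, hl⟩ := exists_horizontal_of_ccDist_lt h
  obtain ⟨t, ht0, ht1, htA, htB⟩ := exists_lengthOn_split hA hB hl
  refine ⟨γ t, ?_, ?_⟩
  · rw [← h0]
    exact (ccDist_le_lengthOn ht0 (hγ.mono le_rfl ht1.le)).trans_lt htA
  · rw [← h1]
    exact (ccDist_le_lengthOn ht1 (hγ.mono ht0.le le_rfl)).trans_lt htB

end Horizontal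

end SubRiemannian

namespace SubRiemannian

/-! ### Invariance under left translations. -/

section Translation

open Filter Topology

variable {n : ℕ} {G : Type*} [TopologicalSpace G] [ChartedSpace (EuclideanSpace ℝ (Fin n)) G]
  [Group G] [LieGroup (𝓡 n) ∞ G]
  {𝓗 : Submodule ℝ (GroupLieAlgebra (𝓡 n) G)}
  {Q : LinearMap.BilinForm ℝ (GroupLieAlgebra (𝓡 n) G)} {γ : ℝ → G} {a b t : ℝ} {x y : G}

theorem mdifferentiableAt_mul_left (g : G) :
    MDifferentiableAt (𝓡 n) (𝓡 n) (fun y : G => g * y) x :=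
  (contMDiff_mul_left (I := 𝓡 n) (n := ∞)).mdifferentiableAt (by simp)

theorem mfderiv_mul_left_mul_left (g h : G) (v : TangentSpace (𝓡 n) x) :
    mfderiv (𝓡 n) (𝓡 n) (fun y : G => g * y) (h * x)
      (mfderiv (𝓡 n) (𝓡 n) (fun y : G => h * y) x v) =
    (mfderiv (𝓡 n) (𝓡 n) (fun y : G => g * (h * y)) x v : EuclideanSpace ℝ (Fin n)) := by
  have := mfderiv_comp (I := 𝓡 n) (I' := 𝓡 n) (I'' := 𝓡 n) x
    (g := fun y : G => g * y) (f := fun y : G => h * y)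
    (mdifferentiableAt_mul_left g) (mdifferentiableAt_mul_left h)
  exact (congrArg
    (fun L : EuclideanSpace ℝ (Fin n) →L[ℝ] EuclideanSpace ℝ (Fin n) => L v) this).symm

theorem mulInvariantVectorField_mul (g : G) (X : GroupLieAlgebra (𝓡 n) G) :
    mfderiv (𝓡 n) (𝓡 n) (fun y : G => g * y) x (mulInvariantVectorField X x) =
      mulInvariantVectorField X (g * x) := by
  have h := mfderiv_mul_left_mul_left (n := n) (x := (1 : G)) g x X
  have e : ∀ p q : G, p = q → ∀ v : EuclideanSpace ℝ (Fin n),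
      (mfderiv (𝓡 n) (𝓡 n) (fun y : G => g * y) p v : EuclideanSpace ℝ (Fin n)) =
      mfderiv (𝓡 n) (𝓡 n) (fun y : G => g * y) q v := by rintro p _ rfl v; rfl
  have e2 : (fun y : G => g * (x * y)) = fun y => g * x * y := by ext y; rw [mul_assoc]
  rw [e2] at h
  exact (e _ _ (mul_one x).symm _).trans h

theorem tangentNorm_mul_left (g : G) (v : TangentSpace (𝓡 n) x) :
    tangentNorm Q (g * x) (mfderiv (𝓡 n) (𝓡 n) (fun y : G => g * y) x v) = tangentNorm Q x v := by
  have h := mfderiv_mul_left_mul_left (n := n) (g * x)⁻¹ g v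
  have e2 : (fun y : G => (g * x)⁻¹ * (g * y)) = fun y => x⁻¹ * y := by ext y; group
  rw [e2] at h
  exact congrArg (fun Z : GroupLieAlgebra (𝓡 n) G => √(Q Z Z)) h

theorem tangentNorm_mulInvariantVectorField (X : GroupLieAlgebra (𝓡 n) G) :
    tangentNorm Q x (mulInvariantVectorField X x) = √(Q X X) := by
  have h := mfderiv_mul_left_mul_left (n := n) (x := (1 : G)) x⁻¹ x X
  have e : ∀ p q : G, p = q → ∀ v : EuclideanSpace ℝ (Fin n),
      (mfderiv (𝓡 n) (𝓡 n) (fun y : G => x⁻¹ * y) p v : EuclideanSpace ℝ (Fin n)) =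
      mfderiv (𝓡 n) (𝓡 n) (fun y : G => x⁻¹ * y) q v := by rintro p _ rfl v; rfl
  have e2 : (fun y : G => x⁻¹ * (x * y)) = id := by ext y; simp
  rw [e2, mfderiv_id] at h
  exact congrArg (fun Z : GroupLieAlgebra (𝓡 n) G => √(Q Z Z))
    ((e _ _ (mul_one x).symm (mulInvariantVectorField X x)).trans h)

theorem velocity_mul_left (g : G) (hγ : MDifferentiableAt 𝓘(ℝ, ℝ) (𝓡 n) γ t) :
    MDifferentiableAt 𝓘(ℝ, ℝ) (𝓡 n) (fun s => g * γ s) t ∧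
    velocity n (fun s => g * γ s) t =
      mfderiv (𝓡 n) (𝓡 n) (fun y : G => g * y) (γ t) (velocity n γ t) := by
  have h := (mdifferentiableAt_mul_left (n := n) (x := γ t) g).hasMFDerivAt.comp t hγ.hasMFDerivAt
  refine ⟨h.mdifferentiableAt, ?_⟩
  exact congrArg (fun L : ℝ →L[ℝ] EuclideanSpace ℝ (Fin n) => L 1) h.mfderiv

theorem IsHorizontalAt.mul_left (g : G) (h : IsHorizontalAt 𝓗 γ t) :
    IsHorizontalAt 𝓗 (fun s => g * γ s) t := by
  obtain ⟨h1, h2⟩ := velocity_mul_left g h.1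
  refine ⟨h1, ?_⟩
  obtain ⟨X, hX, hv⟩ := h.2
  refine ⟨X, hX, ?_⟩
  rw [h2, hv]
  exact mulInvariantVectorField_mul g X

theorem speed_mul_left (g : G) (h : MDifferentiableAt 𝓘(ℝ, ℝ) (𝓡 n) γ t) :
    speed Q (fun s => g * γ s) t = speed Q γ t := by
  obtain ⟨-, h2⟩ := velocity_mul_left g h
  rw [speed, speed, h2]
  congr 1
  exact tangentNorm_mul_left g _

theorem IsHorizontalOn.mul_left (g : G) (h : IsHorizontalOn 𝓗 γ a b) :
    IsHorizontalOn 𝓗 (fun s => g * γ s) a b := by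
  refine ⟨h.1.comp (f := fun y => g * y) ((contMDiff_mul_left (n := ∞)).of_le (by simp)), ?_⟩
  filter_upwards [h.2] with t ht using ht.mul_left g

theorem lengthOn_mul_left (g : G) (h : IsHorizontalOn 𝓗 γ a b) :
    lengthOn Q (fun s => g * γ s) a b = lengthOn Q γ a b := by
  refine lintegral_congr_ae ?_
  filter_upwards [h.2] with t ht using speed_mul_left g ht.1

theorem ccDist_mul_left_le (g : G) : ccDist 𝓗 Q (g * x) (g * y) ≤ ccDist 𝓗 Q x y := by
  refine le_of_forall_gt fun r hr => ?_
  obtain ⟨γ, h, h0, h1, hl⟩ := exists_horizontal_of_ccDist_lt hr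
  have := ccDist_le_lengthOn (Q := Q) one_pos (h.mul_left g)
  rw [h0, h1, lengthOn_mul_left g h] at this
  exact this.trans_lt hl

theorem ccDist_mul_left (g : G) : ccDist 𝓗 Q (g * x) (g * y) = ccDist 𝓗 Q x y := by
  refine le_antisymm (ccDist_mul_left_le g) ?_
  simpa using ccDist_mul_left_le (𝓗 := 𝓗) (Q := Q) (x := g * x) (y := g * y) g⁻¹

theorem ccDist_self : ccDist 𝓗 Q x x = 0 := by
  have hv : ∀ t : ℝ, velocity n (fun _ : ℝ => x) t = 0 := fun t => by
    rw [velocity, mfderiv_const]; rfl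
  have hz : (0 : TangentSpace (𝓡 n) x) = mulInvariantVectorField (0 : GroupLieAlgebra (𝓡 n) G) x :=
    (map_zero (mfderiv (𝓡 n) (𝓡 n) (fun y : G => x * y) (1 : G))).symm
  have hh : IsHorizontalOn 𝓗 (fun _ : ℝ => x) 0 1 := by
    refine ⟨⟨continuousOn_const, fun p c d _ _ _ _ => ?_⟩,
      ae_of_all _ fun t => ⟨mdifferentiableAt_const, ?_⟩⟩
    · exact (LipschitzWith.const _).lipschitzOnWith.absolutelyContinuousOnInterval
    · rw [hv t]
      exact ⟨0, 𝓗.zero_mem, hz⟩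
  have hl : lengthOn Q (fun _ : ℝ => x) 0 1 = 0 := by
    have : ∀ t, speed Q (fun _ : ℝ => x) t = 0 := fun t => by
      rw [speed, hv t]
      have : tangentNorm Q x (0 : TangentSpace (𝓡 n) x) = 0 := by
        rw [hz, tangentNorm_mulInvariantVectorField]; simp
      rw [this, ENNReal.ofReal_zero]
    simp [lengthOn, this]
  exact le_zero_iff.1 ((ccDist_le_lengthOn (Q := Q) one_pos hh).trans hl.le)

end Translation

/-! ### The multiplication in a chart at the identity. -/

section ChartMul

open Filter Topology

variable {n : ℕ} {G : Type*} [TopologicalSpace G] [ChartedSpace (EuclideanSpace ℝ (Fin n)) G]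
  [Group G]

variable (n G) in
/-- The preferred chart at the identity. -/
noncomputable abbrev chartOne : OpenPartialHomeomorph G (EuclideanSpace ℝ (Fin n)) :=
  chartAt (EuclideanSpace ℝ (Fin n)) (1 : G)

variable (n G) in
/-- The coordinates of the identity. -/
noncomputable abbrev coordOne : EuclideanSpace ℝ (Fin n) := chartOne n G 1

variable (n G) in
/-- The multiplication in the preferred chart at the identity. -/
noncomputable def chartMul (p : EuclideanSpace ℝ (Fin n) × EuclideanSpace ℝ (Fin n)) :
    EuclideanSpace ℝ (Fin n) :=
  chartOne n G ((chartOne n G).symm p.1 * (chartOne n G).symm p.2)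

variable (n G) in
/-- The differential at the identity of the left translation by the point of coordinates `u`. -/
noncomputable def leftDeriv (u : EuclideanSpace ℝ (Fin n)) :
    EuclideanSpace ℝ (Fin n) →L[ℝ] EuclideanSpace ℝ (Fin n) :=
  fderiv ℝ (fun v => chartMul n G (u, v)) (coordOne n G)

theorem one_mem_source : (1 : G) ∈ (chartOne n G).source := mem_chart_source _ _

theorem coordOne_mem_target : coordOne n G ∈ (chartOne n G).target := mem_chart_target _ _

theorem symm_coordOne : (chartOne n G).symm (coordOne n G) = 1 :=
  (chartOne n G).left_inv one_mem_source

theorem chartMul_coordOne_left {v : EuclideanSpace ℝ (Fin n)} (hv : v ∈ (chartOne n G).target) :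
    chartMul n G (coordOne n G, v) = v := by
  rw [chartMul, symm_coordOne, one_mul, (chartOne n G).right_inv hv]

theorem leftDeriv_coordOne : leftDeriv n G (coordOne n G) = ContinuousLinearMap.id ℝ _ := by
  have : (fun v => chartMul n G (coordOne n G, v)) =ᶠ[𝓝 (coordOne n G)] id := by
    filter_upwards [(chartOne n G).open_target.mem_nhds coordOne_mem_target] with v hv
      using chartMul_coordOne_left hv
  rw [leftDeriv, this.fderiv_eq, fderiv_id]

variable [LieGroup (𝓡 n) ∞ G]

theorem contMDiffAt_chartOne_symm {u : EuclideanSpace ℝ (Fin n)} (hu : u ∈ (chartOne n G).target) :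
    ContMDiffAt 𝓘(ℝ, EuclideanSpace ℝ (Fin n)) (𝓡 n) ∞ (chartOne n G).symm u := by
  have h1 : ContMDiffOn 𝓘(ℝ, EuclideanSpace ℝ (Fin n)) (𝓡 n) ∞ (extChartAt (𝓡 n) (1 : G)).symm
    (extChartAt (𝓡 n) (1 : G)).target := contMDiffOn_extChartAt_symm _
  have hu' : u ∈ (extChartAt (𝓡 n) (1 : G)).target := by simpa [mfld_simps] using hu
  exact h1.contMDiffAt ((isOpen_extChartAt_target _).mem_nhds hu')

theorem contMDiffAt_chartOne {x : G} (hx : x ∈ (chartOne n G).source) :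
    ContMDiffAt (𝓡 n) 𝓘(ℝ, EuclideanSpace ℝ (Fin n)) ∞ (chartOne n G) x :=
  contMDiffAt_extChartAt' (I := 𝓡 n) hx

theorem contDiffAt_chartMul {p : EuclideanSpace ℝ (Fin n) × EuclideanSpace ℝ (Fin n)}
    (h1 : p.1 ∈ (chartOne n G).target) (h2 : p.2 ∈ (chartOne n G).target)
    (h : (chartOne n G).symm p.1 * (chartOne n G).symm p.2 ∈ (chartOne n G).source) :
    ContDiffAt ℝ ∞ (chartMul n G) p := by
  have e1 : ContMDiffAt 𝓘(ℝ, EuclideanSpace ℝ (Fin n) × EuclideanSpace ℝ (Fin n)) (𝓡 n) ∞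
      (fun p : EuclideanSpace ℝ (Fin n) × EuclideanSpace ℝ (Fin n) => (chartOne n G).symm p.1) p :=
    (contMDiffAt_chartOne_symm h1).comp p contDiff_fst.contMDiff.contMDiffAt
  have e2 : ContMDiffAt 𝓘(ℝ, EuclideanSpace ℝ (Fin n) × EuclideanSpace ℝ (Fin n)) (𝓡 n) ∞
      (fun p : EuclideanSpace ℝ (Fin n) × EuclideanSpace ℝ (Fin n) => (chartOne n G).symm p.2) p :=
    (contMDiffAt_chartOne_symm h2).comp p contDiff_snd.contMDiff.contMDiffAt
  exact ((contMDiffAt_chartOne h).comp p (e1.mul e2)).contDiffAt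

theorem contDiffAt_chartMul_coordOne_right {u : EuclideanSpace ℝ (Fin n)}
    (hu : u ∈ (chartOne n G).target) : ContDiffAt ℝ ∞ (chartMul n G) (u, coordOne n G) :=
  contDiffAt_chartMul hu coordOne_mem_target (by
    simp only
    rw [symm_coordOne, mul_one]
    exact (chartOne n G).map_target hu)

theorem contDiffAt_chartMul_coordOne_left {u : EuclideanSpace ℝ (Fin n)}
    (hu : u ∈ (chartOne n G).target) : ContDiffAt ℝ ∞ (chartMul n G) (coordOne n G, u) :=
  contDiffAt_chartMul coordOne_mem_target hu (by
    simp only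
    rw [symm_coordOne, one_mul]
    exact (chartOne n G).map_target hu)

theorem leftDeriv_eq {u : EuclideanSpace ℝ (Fin n)} (hu : u ∈ (chartOne n G).target) :
    leftDeriv n G u = (fderiv ℝ (chartMul n G) (u, coordOne n G)).comp
      (ContinuousLinearMap.inr ℝ (EuclideanSpace ℝ (Fin n)) (EuclideanSpace ℝ (Fin n))) :=
  (((contDiffAt_chartMul_coordOne_right hu).differentiableAt (by simp)).hasFDerivAt.comp
    (coordOne n G) (hasFDerivAt_prodMk_right u (coordOne n G))).fderiv

theorem contDiffAt_leftDeriv {u : EuclideanSpace ℝ (Fin n)} (hu : u ∈ (chartOne n G).target) :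
    ContDiffAt ℝ ∞ (leftDeriv n G) u := by
  have h1 : ContDiffAt ℝ ∞ (fun u => (fderiv ℝ (chartMul n G) (u, coordOne n G)).comp
      (ContinuousLinearMap.inr ℝ (EuclideanSpace ℝ (Fin n)) (EuclideanSpace ℝ (Fin n)))) u := by
    have h2 : ContDiffAt ℝ ∞ (fderiv ℝ (chartMul n G)) (u, coordOne n G) :=
      (contDiffAt_chartMul_coordOne_right hu).fderiv_right (by simp)
    exact (h2.comp u (contDiffAt_id.prodMk contDiffAt_const)).clm_comp contDiffAt_const
  refine h1.congr_of_eventuallyEq ?_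
  filter_upwards [(chartOne n G).open_target.mem_nhds hu] with v hv using leftDeriv_eq hv

/-- The left-invariant vector fields in the preferred chart at the identity. -/
theorem mfderiv_chartOne_mulInvariantVectorField {x : G} (hx : x ∈ (chartOne n G).source)
    (X : GroupLieAlgebra (𝓡 n) G) :
    mfderiv (𝓡 n) 𝓘(ℝ, EuclideanSpace ℝ (Fin n)) (chartOne n G) x (mulInvariantVectorField X x) =
      leftDeriv n G (chartOne n G x) X := by
  have hd1 : MDifferentiableAt (𝓡 n) 𝓘(ℝ, EuclideanSpace ℝ (Fin n)) (chartOne n G) (x * 1) := by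
    rw [mul_one]; exact (contMDiffAt_chartOne hx).mdifferentiableAt (by simp)
  have hcomp := mfderiv_comp (I := 𝓡 n) (I' := 𝓡 n) (I'' := 𝓘(ℝ, EuclideanSpace ℝ (Fin n))) (1 : G)
    (g := chartOne n G) (f := fun y : G => x * y) hd1 (mdifferentiableAt_mul_left x)
  have hd : MDifferentiableAt (𝓡 n) 𝓘(ℝ, EuclideanSpace ℝ (Fin n))
      (chartOne n G ∘ fun y : G => x * y) 1 := hd1.comp (1 : G) (mdifferentiableAt_mul_left x)
  have h1 : (mfderiv (𝓡 n) 𝓘(ℝ, EuclideanSpace ℝ (Fin n)) (chartOne n G ∘ fun y : G => x * y) 1 :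
      EuclideanSpace ℝ (Fin n) →L[ℝ] EuclideanSpace ℝ (Fin n)) =
      leftDeriv n G (chartOne n G x) := by
    rw [hd.mfderiv]
    have e : writtenInExtChartAt (𝓡 n) 𝓘(ℝ, EuclideanSpace ℝ (Fin n)) (1 : G)
        (chartOne n G ∘ fun y : G => x * y) = fun v => chartMul n G (chartOne n G x, v) := by
      ext1 v
      simp only [writtenInExtChartAt, chartMul, mfld_simps, (chartOne n G).left_inv hx]
      rfl
    rw [e, leftDeriv]
    simp only [mfld_simps, fderivWithin_univ]
    rfl
  have e : ∀ p q : G, p = q → ∀ v : EuclideanSpace ℝ (Fin n),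
      (mfderiv (𝓡 n) 𝓘(ℝ, EuclideanSpace ℝ (Fin n)) (chartOne n G) p v : EuclideanSpace ℝ (Fin n)) =
      mfderiv (𝓡 n) 𝓘(ℝ, EuclideanSpace ℝ (Fin n)) (chartOne n G) q v := by rintro p _ rfl v; rfl
  rw [← h1]
  refine (e _ _ (mul_one x).symm _).trans ?_
  exact (congrArg
    (fun L : EuclideanSpace ℝ (Fin n) →L[ℝ] EuclideanSpace ℝ (Fin n) => L X) hcomp).symm

theorem hasDerivAt_chartOne_comp {γ : ℝ → G} {t : ℝ} (hγ : MDifferentiableAt 𝓘(ℝ, ℝ) (𝓡 n) γ t)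
    (ht : γ t ∈ (chartOne n G).source) :
    HasDerivAt (fun s => chartOne n G (γ s))
      (mfderiv (𝓡 n) 𝓘(ℝ, EuclideanSpace ℝ (Fin n)) (chartOne n G) (γ t) (velocity n γ t)) t := by
  have h := ((contMDiffAt_chartOne ht).mdifferentiableAt (by simp)).hasMFDerivAt.comp t
    hγ.hasMFDerivAt
  obtain ⟨L, hL⟩ : ∃ L : ℝ →L[ℝ] EuclideanSpace ℝ (Fin n),
      L = (mfderiv (𝓡 n) 𝓘(ℝ, EuclideanSpace ℝ (Fin n)) (chartOne n G) (γ t)).comp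
        (mfderiv 𝓘(ℝ, ℝ) (𝓡 n) γ t) := ⟨_, rfl⟩
  have h' : HasFDerivAt (fun s => chartOne n G (γ s)) L t := by
    rw [hL]; exact h.hasFDerivAt
  have e : L 1 = mfderiv (𝓡 n) 𝓘(ℝ, EuclideanSpace ℝ (Fin n)) (chartOne n G) (γ t)
      (velocity n γ t) := by rw [hL]; rfl
  rw [← e]
  exact h'.hasDerivAt

end ChartMul

end SubRiemannian

namespace SubRiemannian

/-! ### Small Carnot–Carathéodory balls are small for the topology. -/

section Confinement

open Filter Topology

/-- The form attains a positive minimum on the compact unit sphere, and homogeneity does the rest.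
The sphere is empty when the space is trivial. -/
theorem exists_norm_le_mul_sqrt {E : Type*} [NormedAddCommGroup E] [NormedSpace ℝ E]
    [FiniteDimensional ℝ E] (B : E →ₗ[ℝ] E →ₗ[ℝ] ℝ) (hB : ∀ X, X ≠ 0 → 0 < B X X) :
    ∃ C : ℝ, 0 < C ∧ ∀ X, ‖X‖ ≤ C * √(B X X) := by
  set T : E →ₗ[ℝ] (E →L[ℝ] ℝ) := (LinearMap.toContinuousLinearMap (𝕜 := ℝ)).toLinearMap ∘ₗ B
  have hT : Continuous T := T.continuous_of_finiteDimensional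
  have hq : Continuous fun X => B X X := by
    change Continuous fun X => T X X
    exact hT.clm_apply continuous_id
  rcases (Metric.sphere (0 : E) 1).eq_empty_or_nonempty with he | hne
  · refine ⟨1, one_pos, fun X => ?_⟩
    rcases eq_or_ne X 0 with rfl | hX
    · simp
    · have : ‖X‖⁻¹ • X ∈ Metric.sphere (0 : E) 1 := by
        rw [mem_sphere_zero_iff_norm, norm_smul, norm_inv, norm_norm,
          inv_mul_cancel₀ (norm_ne_zero_iff.2 hX)]
      rw [he] at this
      exact absurd this (notMem_empty _)
  · obtain ⟨Y, hY, hmin⟩ := (isCompact_sphere (0 : E) 1).exists_isMinOn hne hq.continuousOn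
    have hY0 : Y ≠ 0 := by
      rintro rfl
      simp at hY
    have hpos : 0 < B Y Y := hB Y hY0
    refine ⟨(√(B Y Y))⁻¹, by positivity, fun X => ?_⟩
    rcases eq_or_ne X 0 with rfl | hX
    · simp
    have hXn : 0 < ‖X‖ := norm_pos_iff.2 hX
    have hmem : ‖X‖⁻¹ • X ∈ Metric.sphere (0 : E) 1 := by
      rw [mem_sphere_zero_iff_norm, norm_smul, norm_inv, norm_norm,
        inv_mul_cancel₀ hXn.ne']
    have h1 : B Y Y ≤ B (‖X‖⁻¹ • X) (‖X‖⁻¹ • X) := hmin hmem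
    rw [map_smul, map_smul, LinearMap.smul_apply, smul_eq_mul, smul_eq_mul, ← mul_assoc] at h1
    have h2 : B Y Y * ‖X‖ ^ 2 ≤ B X X := by
      have := mul_le_mul_of_nonneg_right h1 (sq_nonneg ‖X‖)
      calc B Y Y * ‖X‖ ^ 2 ≤ _ := this
        _ = B X X := by field_simp
    rw [inv_mul_eq_div, le_div_iff₀ (by positivity)]
    calc ‖X‖ * √(B Y Y) = √(B Y Y * ‖X‖ ^ 2) := by
          rw [Real.sqrt_mul hpos.le, Real.sqrt_sq hXn.le, mul_comm]
      _ ≤ _ := Real.sqrt_le_sqrt h2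

variable {n : ℕ} {G : Type*} [TopologicalSpace G] [ChartedSpace (EuclideanSpace ℝ (Fin n)) G]
  [Group G]
  {𝓗 : Submodule ℝ (GroupLieAlgebra (𝓡 n) G)}
  {Q : LinearMap.BilinForm ℝ (GroupLieAlgebra (𝓡 n) G)}

theorem exists_norm_le_of_posDef (hQpos : ∀ X, X ≠ 0 → 0 < Q X X) :
    ∃ C : ℝ, 0 < C ∧ ∀ X : EuclideanSpace ℝ (Fin n),
      ‖X‖ ≤ C * √(Q (X : GroupLieAlgebra (𝓡 n) G) (X : GroupLieAlgebra (𝓡 n) G)) :=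
  exists_norm_le_mul_sqrt (E := EuclideanSpace ℝ (Fin n)) Q hQpos

variable [LieGroup (𝓡 n) ∞ G]

/-- The displacement in the chart at the identity is controlled by the length. -/
theorem norm_chartOne_sub_le {C K : ℝ} (hC : 0 < C)
    (hQ : ∀ X : EuclideanSpace ℝ (Fin n),
      ‖X‖ ≤ C * √(Q (X : GroupLieAlgebra (𝓡 n) G) (X : GroupLieAlgebra (𝓡 n) G)))
    (hK : 0 ≤ K) {γ : ℝ → G} {τ : ℝ} (hτ : 0 ≤ τ) (hγ : IsHorizontalOn 𝓗 γ 0 τ)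
    (hsource : ∀ t ∈ Icc 0 τ, γ t ∈ (chartOne n G).source)
    (hderiv : ∀ t ∈ Icc 0 τ, ‖leftDeriv n G (chartOne n G (γ t))‖ ≤ K)
    {r : ℝ} (hr : 0 ≤ r) (hlen : lengthOn Q γ 0 τ ≤ ENNReal.ofReal r) :
    ‖chartOne n G (γ τ) - chartOne n G (γ 0)‖ ≤ K * C * r := by
  set u : ℝ → EuclideanSpace ℝ (Fin n) := fun t => chartOne n G (γ t) with hu
  set v := u τ - u 0 with hv
  change ‖v‖ ≤ _
  rcases eq_or_ne v 0 with h0 | h0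
  · rw [h0, norm_zero]; positivity
  have hv0 : 0 < ‖v‖ := norm_pos_iff.2 h0
  -- Testing against the unit vector in the direction of the displacement reduces the estimate to
  -- the fundamental theorem of calculus for a real absolutely continuous function.
  set ℓ : EuclideanSpace ℝ (Fin n) →L[ℝ] ℝ := innerSL ℝ (‖v‖⁻¹ • v) with hℓ
  have hℓ1 : ‖ℓ‖ = 1 := by
    rw [hℓ, innerSL_apply_norm, norm_smul, norm_inv, norm_norm, inv_mul_cancel₀ hv0.ne']
  have hℓv : ℓ v = ‖v‖ := by
    rw [hℓ, innerSL_apply_apply, real_inner_smul_left, real_inner_self_eq_norm_sq]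
    field_simp
  have hAC : AbsolutelyContinuousOnInterval u 0 τ := hγ.1.2 1 0 τ le_rfl hτ le_rfl hsource
  have hACℓ : AbsolutelyContinuousOnInterval (fun t => ℓ (u t)) 0 τ :=
    AbsolutelyContinuousOnInterval.lipschitzOnWith_comp
      ℓ.lipschitz.lipschitzOnWith hAC (mapsTo_univ _ _)
  have hFTC := hACℓ.integral_deriv_eq_sub
  have hFTC' : ∫ t in (0)..τ, deriv (fun t => ℓ (u t)) t = ‖v‖ := by
    rw [hFTC, ← map_sub, ← hv, hℓv]
  have hbound : ‖∫ t in (0)..τ, deriv (fun t => ℓ (u t)) t‖ₑ ≤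
      ENNReal.ofReal (K * C) * lengthOn Q γ 0 τ := by
    rw [intervalIntegral.integral_of_le hτ, ← integral_Icc_eq_integral_Ioc]
    refine (enorm_integral_le_lintegral_enorm _).trans ?_
    rw [lengthOn, ← lintegral_const_mul' _ _ ENNReal.ofReal_ne_top]
    refine lintegral_mono_ae ?_
    filter_upwards [hγ.2, ae_restrict_mem measurableSet_Icc] with t ht htI
    obtain ⟨X, hX, hvel⟩ := ht.2
    have hd := hasDerivAt_chartOne_comp ht.1 (hsource t htI)
    rw [hvel, mfderiv_chartOne_mulInvariantVectorField (hsource t htI)] at hd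
    have hd2 : HasDerivAt (fun t => ℓ (u t)) (ℓ (leftDeriv n G (chartOne n G (γ t)) X)) t :=
      ℓ.hasFDerivAt.comp_hasDerivAt t hd
    rw [hd2.deriv, speed, hvel, tangentNorm_mulInvariantVectorField,
      ← ENNReal.ofReal_mul (by positivity), ← ofReal_norm]
    refine ENNReal.ofReal_le_ofReal ?_
    calc ‖ℓ (leftDeriv n G (chartOne n G (γ t)) X)‖
        ≤ ‖ℓ‖ * ‖leftDeriv n G (chartOne n G (γ t)) X‖ := ℓ.le_opNorm _
      _ ≤ 1 * (K * (C * √(Q X X))) := by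
          rw [hℓ1]
          gcongr
          exact ((leftDeriv n G (chartOne n G (γ t))).le_opNorm _).trans
            (mul_le_mul (hderiv t htI) (hQ X) (norm_nonneg _) hK)
      _ = _ := by ring
  rw [hFTC', ← ofReal_norm, norm_norm] at hbound
  have := hbound.trans (mul_le_mul_right hlen _)
  rw [← ENNReal.ofReal_mul (by positivity), ENNReal.ofReal_le_ofReal_iff (by positivity)] at this
  exact this

/-- The balls of small radius centred at the identity are small for the topology of the group. -/
theorem exists_ccDist_lt_imp_mem [T2Space G] (hQpos : ∀ X, X ≠ 0 → 0 < Q X X)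
    {U : Set G} (hU : U ∈ 𝓝 (1 : G)) :
    ∃ r : ℝ, 0 < r ∧ ∀ y, ccDist 𝓗 Q 1 y < ENNReal.ofReal r → y ∈ U := by
  obtain ⟨C, hC, hQ⟩ := exists_norm_le_of_posDef hQpos
  have hcont : ContinuousAt (leftDeriv n G) (coordOne n G) :=
    (contDiffAt_leftDeriv coordOne_mem_target).continuousAt
  set K : ℝ := ‖leftDeriv n G (coordOne n G)‖ + 1 with hK
  have hK0 : 0 < K := by positivity
  have hnear : ∀ᶠ u in 𝓝 (coordOne n G), u ∈ (chartOne n G).target ∧ ‖leftDeriv n G u‖ ≤ K ∧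
      (chartOne n G).symm u ∈ U := by
    have hA : ∀ᶠ u in 𝓝 (coordOne n G), u ∈ (chartOne n G).target :=
      (chartOne n G).open_target.mem_nhds coordOne_mem_target
    refine hA.and (Eventually.and ?_ ?_)
    · exact (hcont.norm.eventually (gt_mem_nhds (lt_add_one _))).mono fun u hu => hu.le
    · have := (chartOne n G).continuousAt_symm (coordOne_mem_target (n := n) (G := G))
      exact this (by rw [symm_coordOne]; exact hU)
  obtain ⟨ρ, hρ, hball⟩ := Metric.nhds_basis_closedBall.eventually_iff.1 hnear
  set V : Set G := (chartOne n G).source ∩ chartOne n G ⁻¹' Metric.ball (coordOne n G) ρ with hV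
  have hVo : IsOpen V := (chartOne n G).isOpen_inter_preimage Metric.isOpen_ball
  have hV1 : (1 : G) ∈ V := ⟨one_mem_source, Metric.mem_ball_self hρ⟩
  have hVU : V ⊆ U := by
    rintro y ⟨hy, hyb⟩
    have := (hball (Metric.ball_subset_closedBall hyb)).2.2
    rwa [(chartOne n G).left_inv hy] at this
  -- At this length the displacement in the chart is at most `ρ / 2`, as long as the curve has
  -- stayed in `V`.
  refine ⟨ρ / (2 * (K * C)), by positivity, fun y hy => hVU ?_⟩
  obtain ⟨γ, hγ, h0, h1, hl⟩ := exists_horizontal_of_ccDist_lt hy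
  have key : ∀ τ ∈ Icc (0 : ℝ) 1, (∀ t ∈ Icc 0 τ, γ t ∈ V) →
      γ τ ∈ (chartOne n G).symm '' Metric.closedBall (coordOne n G) (ρ / 2) := by
    intro τ hτ hτV
    have hest := norm_chartOne_sub_le (Q := Q) hC hQ hK0.le hτ.1 (hγ.mono le_rfl hτ.2)
      (fun t ht => (hτV t ht).1)
      (fun t ht => (hball (Metric.ball_subset_closedBall (hτV t ht).2)).2.1)
      (r := ρ / (2 * (K * C))) (by positivity) ((lengthOn_mono le_rfl hτ.2).trans hl.le)
    refine ⟨chartOne n G (γ τ), ?_, (chartOne n G).left_inv (hτV τ (right_mem_Icc.2 hτ.1)).1⟩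
    rw [mem_closedBall_iff_norm]
    rw [h0] at hest
    refine hest.trans (le_of_eq ?_)
    field_simp
  have hcompact : IsCompact ((chartOne n G).symm '' Metric.closedBall (coordOne n G) (ρ / 2)) := by
    refine (isCompact_closedBall _ _).image_of_continuousOn
      ((chartOne n G).continuousOn_symm.mono fun u hu => (hball ?_).1)
    exact Metric.closedBall_subset_closedBall (by linarith) hu
  have hsubV : (chartOne n G).symm '' Metric.closedBall (coordOne n G) (ρ / 2) ⊆ V := by
    rintro _ ⟨u, hu, rfl⟩
    have hut := (hball (Metric.closedBall_subset_closedBall (by linarith) hu)).1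
    refine ⟨(chartOne n G).map_target hut, ?_⟩
    rw [mem_preimage, (chartOne n G).right_inv hut]
    exact Metric.closedBall_subset_ball (by linarith) hu
  by_contra hyV
  set B : Set ℝ := {t ∈ Icc (0 : ℝ) 1 | γ t ∉ V} with hB
  have hBclosed : IsClosed B := by
    have := hγ.1.1.preimage_isClosed_of_isClosed isClosed_Icc hVo.isClosed_compl
    exact this
  have hBne : B.Nonempty := ⟨1, ⟨zero_le_one, le_rfl⟩, by rwa [h1]⟩
  have hBbdd : BddBelow B := ⟨0, fun t ht => ht.1.1⟩
  -- The infimum is the first time outside the open set `V`. Before it the curve lies in the compact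
  -- image of the ball of radius `ρ / 2`, so its value there is in that image too, hence in `V`: a
  -- contradiction.
  have hTB : sInf B ∈ B := hBclosed.csInf_mem hBne hBbdd
  set T := sInf B with hT
  have hT0 : 0 < T := by
    refine lt_of_le_of_ne hTB.1.1 fun h => hTB.2 ?_
    rw [← h, h0]; exact hV1
  have hbefore : ∀ t, 0 ≤ t → t < T → γ t ∈ V := by
    intro t ht0 htT
    by_contra hcon
    exact absurd (csInf_le hBbdd (show t ∈ B from ⟨⟨ht0, htT.le.trans hTB.1.2⟩, hcon⟩))
      (not_le.2 htT)
  have hlim : Tendsto γ (𝓝[Ico 0 T] T) (𝓝 (γ T)) :=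
    (hγ.1.1 T hTB.1).mono_left (nhdsWithin_mono _ fun t ht => ⟨ht.1, ht.2.le.trans hTB.1.2⟩)
  have hne : (𝓝[Ico 0 T] T).NeBot := by
    rw [nhdsWithin_Ico_eq_nhdsLT hT0]; infer_instance
  have hmemT : γ T ∈ (chartOne n G).symm '' Metric.closedBall (coordOne n G) (ρ / 2) := by
    refine hcompact.isClosed.mem_of_tendsto hlim ?_
    filter_upwards [self_mem_nhdsWithin] with t ht
    exact key t ⟨ht.1, ht.2.le.trans hTB.1.2⟩ fun s hs => hbefore s hs.1 (hs.2.trans_lt ht.2)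
  exact hTB.2 (hsubV hmemT)

end Confinement

/-! ### Integral curves of horizontal left-invariant fields. -/

section IntegralCurves

open Filter Topology

variable {n : ℕ} {G : Type*} [TopologicalSpace G] [ChartedSpace (EuclideanSpace ℝ (Fin n)) G]
  [Group G] [LieGroup (𝓡 n) ∞ G]
  {𝓗 : Submodule ℝ (GroupLieAlgebra (𝓡 n) G)}
  {Q : LinearMap.BilinForm ℝ (GroupLieAlgebra (𝓡 n) G)}

/-- Through the identity there is a curve with any prescribed horizontal velocity, along which the
Carnot–Carathéodory distance to the identity grows at most linearly. -/
theorem exists_curve_of_mem {X : GroupLieAlgebra (𝓡 n) G} (hX : X ∈ 𝓗) :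
    ∃ γ : ℝ → G, γ 0 = 1 ∧ ContinuousAt γ 0 ∧
      HasStrictDerivAt (fun t => chartOne n G (γ t)) (X : EuclideanSpace ℝ (Fin n)) 0 ∧
      ∀ᶠ s in 𝓝 (0 : ℝ), ccDist 𝓗 Q 1 (γ s) ≤ ENNReal.ofReal (√(Q X X) * |s|) := by
  have hv : ContMDiffAt (𝓡 n) (𝓡 n).tangent 1
      (fun g : G => (⟨g, mulInvariantVectorField X g⟩ : TangentBundle (𝓡 n) G)) 1 :=
    (contMDiffAt_mulInvariantVectorField X).of_le (by
      rw [minSmoothness_of_isRCLikeNormedField]; norm_num)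
  obtain ⟨γ, h0, hγ⟩ := exists_isMIntegralCurveAt_of_contMDiffAt_boundaryless (t₀ := 0) hv
  have hcont : ContinuousAt γ 0 := hγ.continuousAt
  set u : ℝ → EuclideanSpace ℝ (Fin n) := fun t => chartOne n G (γ t) with hu
  have hsrc : ∀ᶠ t in 𝓝 (0 : ℝ), γ t ∈ (chartOne n G).source :=
    hcont ((chartOne n G).open_source.mem_nhds (by rw [h0]; exact one_mem_source))
  have hvel : ∀ᶠ t in 𝓝 (0 : ℝ), MDifferentiableAt 𝓘(ℝ, ℝ) (𝓡 n) γ t ∧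
      velocity n γ t = mulInvariantVectorField X (γ t) := by
    filter_upwards [hγ] with t ht
    refine ⟨ht.mdifferentiableAt, ?_⟩
    have := congrArg (fun L : ℝ →L[ℝ] EuclideanSpace ℝ (Fin n) => L 1) ht.mfderiv
    refine this.trans ?_
    exact one_smul ℝ (mulInvariantVectorField X (γ t) : EuclideanSpace ℝ (Fin n))
  have hder : ∀ᶠ t in 𝓝 (0 : ℝ), HasDerivAt u (leftDeriv n G (u t) X) t := by
    filter_upwards [hvel, hsrc] with t ht hts
    have := hasDerivAt_chartOne_comp ht.1 hts
    rwa [ht.2, mfderiv_chartOne_mulInvariantVectorField hts] at this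
  have hu0 : u 0 = coordOne n G := by rw [hu]; simp only [h0]
  have hucont : ContinuousAt u 0 := hder.self_of_nhds.continuousAt
  have hdcont : ContinuousAt (fun t => leftDeriv n G (u t) X) 0 := by
    have h1 : ContinuousAt (leftDeriv n G) (u 0) := by
      rw [hu0]; exact (contDiffAt_leftDeriv coordOne_mem_target).continuousAt
    exact (h1.comp hucont).clm_apply continuousAt_const
  -- Strict differentiability is what the open mapping argument in Chow's theorem requires.
  have hstrict : HasStrictDerivAt u (X : EuclideanSpace ℝ (Fin n)) 0 := by
    have := hasStrictDerivAt_of_hasDerivAt_of_continuousAt hder hdcont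
    rwa [hu0, leftDeriv_coordOne] at this
  refine ⟨γ, h0, hcont, hstrict, ?_⟩
  set M : ℝ := ‖leftDeriv n G (u 0) X‖ + 1 with hM
  have hbd : ∀ᶠ t in 𝓝 (0 : ℝ), ‖leftDeriv n G (u t) X‖ ≤ M :=
    (hdcont.norm.eventually (gt_mem_nhds (lt_add_one _))).mono fun t ht => ht.le
  obtain ⟨ε, hε, hall⟩ := Metric.eventually_nhds_iff_ball.1
    ((hsrc.and hvel).and (hder.and hbd))
  rw [Real.ball_zero_eq_Ioo] at hall
  have hsub : ∀ p q, -ε < p → q < ε → Icc p q ⊆ Ioo (-ε) ε := fun p q hp hq t ht =>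
    ⟨hp.trans_le ht.1, ht.2.trans_lt hq⟩
  have hLip : ∀ p q, -ε < p → p ≤ q → q < ε → AbsolutelyContinuousOnInterval u p q := by
    intro p q hp hpq hq
    have hL : LipschitzOnWith M.toNNReal u (uIcc p q) := by
      rw [uIcc_of_le hpq]
      refine (convex_Icc p q).lipschitzOnWith_of_nnnorm_hasDerivWithin_le
        (f' := fun t => leftDeriv n G (u t) X)
        (fun t ht => (hall t (hsub p q hp hq ht)).2.1.hasDerivWithinAt) fun t ht => ?_
      rw [← NNReal.coe_le_coe, coe_nnnorm, Real.coe_toNNReal _ (by positivity)]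
      exact (hall t (hsub p q hp hq ht)).2.2
    exact hL.absolutelyContinuousOnInterval
  have hhor : ∀ p q, -ε < p → p ≤ q → q < ε → IsHorizontalOn 𝓗 γ p q := by
    intro p q hp hpq hq
    refine ⟨IsAbsContOn.of_local fun t ht =>
      ⟨univ, univ_mem, (chartOne n G).symm, u, ?_, ?_, ?_, ?_⟩, ?_⟩
    · have := (hall t (hsub p q hp hq ht)).1.1
      exact (contMDiffAt_chartOne_symm ((chartOne n G).map_source this)).of_le (by simp)
    · exact (hall t (hsub p q hp hq ht)).2.1.continuousAt.continuousWithinAt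
    · exact fun s hs => ((chartOne n G).left_inv (hall s (hsub p q hp hq hs.2)).1.1).symm
    · exact fun p' q' hp' hpq' hq' _ => hLip p' q' (hp.trans_le hp') hpq' (hq'.trans_lt hq)
    · filter_upwards [ae_restrict_mem measurableSet_Icc] with t ht
      have := (hall t (hsub p q hp hq ht)).1.2
      exact ⟨this.1, X, hX, this.2⟩
  have hlen : ∀ p q, -ε < p → p ≤ q → q < ε →
      lengthOn Q γ p q = ENNReal.ofReal (√(Q X X) * (q - p)) := by
    intro p q hp hpq hq
    have : lengthOn Q γ p q = ∫⁻ _ in Icc p q, ENNReal.ofReal (√(Q X X)) := by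
      refine setLIntegral_congr_fun measurableSet_Icc fun t ht => ?_
      simp only [speed]
      rw [(hall t (hsub p q hp hq ht)).1.2.2, tangentNorm_mulInvariantVectorField]
    rw [this, setLIntegral_const, Real.volume_Icc, ENNReal.ofReal_mul (Real.sqrt_nonneg _)]
  filter_upwards [Ioo_mem_nhds (neg_lt_zero.2 hε) hε] with s hs
  rcases lt_trichotomy s 0 with hs0 | hs0 | hs0
  · have := ccDist_le_lengthOn (Q := Q) hs0 (hhor s 0 hs.1 hs0.le hε)
    rwa [hlen s 0 hs.1 hs0.le hε, h0, ccDist_comm, zero_sub, ← abs_of_neg hs0] at this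
  · rw [hs0, h0, ccDist_self]; exact zero_le
  · have := ccDist_le_lengthOn (Q := Q) hs0 (hhor 0 s (neg_lt_zero.2 hε) hs0.le hs.2)
    rw [hlen 0 s (neg_lt_zero.2 hε) hs0.le hs.2, h0, sub_zero] at this
    rwa [abs_of_pos hs0]

end IntegralCurves

end SubRiemannian

namespace SubRiemannian

/-! ### The Lie bracket in coordinates. -/

section Bracket

open Filter Topology VectorField

variable {n : ℕ} {G : Type*} [TopologicalSpace G] [ChartedSpace (EuclideanSpace ℝ (Fin n)) G]
  [Group G] [LieGroup (𝓡 n) ∞ G]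

theorem mfderiv_extChartAt_one :
    (mfderiv (𝓡 n) 𝓘(ℝ, EuclideanSpace ℝ (Fin n)) (extChartAt (𝓡 n) (1 : G)) (1 : G) :
      EuclideanSpace ℝ (Fin n) →L[ℝ] EuclideanSpace ℝ (Fin n)) = ContinuousLinearMap.id ℝ _ := by
  have hd : MDifferentiableAt (𝓡 n) 𝓘(ℝ, EuclideanSpace ℝ (Fin n)) (extChartAt (𝓡 n) (1 : G)) 1 :=
    (contMDiffAt_chartOne one_mem_source).mdifferentiableAt (by simp)
  have e : writtenInExtChartAt (𝓡 n) 𝓘(ℝ, EuclideanSpace ℝ (Fin n)) (1 : G)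
      (extChartAt (𝓡 n) (1 : G)) =ᶠ[𝓝 (extChartAt (𝓡 n) (1 : G) 1)] id := by
    filter_upwards [(chartOne n G).open_target.mem_nhds coordOne_mem_target] with v hv
    simp only [writtenInExtChartAt, mfld_simps]
    exact (chartOne n G).right_inv hv
  have := e.fderiv_eq (𝕜 := ℝ)
  rw [fderiv_id] at this
  refine hd.mfderiv.trans ?_
  have hr : range (𝓡 n) = univ := by simp [mfld_simps]
  exact (by rw [hr, fderivWithin_univ, this] :
    fderivWithin ℝ (writtenInExtChartAt (𝓡 n) 𝓘(ℝ, EuclideanSpace ℝ (Fin n)) (1 : G)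
      (extChartAt (𝓡 n) (1 : G))) (range (𝓡 n)) (extChartAt (𝓡 n) (1 : G) 1) =
        ContinuousLinearMap.id ℝ (EuclideanSpace ℝ (Fin n)))

/-- The bracket of vector fields on a manifold is computed from their pullbacks to a chart;
`leftDeriv` is this pullback for left-invariant fields. -/
theorem inverse_mfderivWithin_extChartAt_symm {u : EuclideanSpace ℝ (Fin n)}
    (hu : u ∈ (chartOne n G).target) (X : GroupLieAlgebra (𝓡 n) G) :
    mpullbackWithin 𝓘(ℝ, EuclideanSpace ℝ (Fin n)) (𝓡 n) (extChartAt (𝓡 n) (1 : G)).symm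
      (mulInvariantVectorField X) (range (𝓡 n)) u = leftDeriv n G u X := by
  have hu' : u ∈ (extChartAt (𝓡 n) (1 : G)).target := by simpa [mfld_simps] using hu
  have : IsManifold (𝓡 n) 1 G := IsManifold.of_le (n := ∞) (by simp)
  have h1 := mfderiv_extChartAt_comp_mfderivWithin_extChartAt_symm (I := 𝓡 n) hu'
  have h2 := mfderivWithin_extChartAt_symm_comp_mfderiv_extChartAt (I := 𝓡 n) hu'
  rw [mpullbackWithin_apply, ContinuousLinearMap.inverse_eq h2 h1]
  have h3 := mfderiv_chartOne_mulInvariantVectorField ((chartOne n G).map_target hu) X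
  rw [(chartOne n G).right_inv hu] at h3
  exact h3

/-- The Lie bracket in the preferred chart at the identity. -/
theorem bracket_eq_fderiv_leftDeriv (Y Z : GroupLieAlgebra (𝓡 n) G) :
    ⁅Y, Z⁆ = (fderiv ℝ (fun u => leftDeriv n G u Z) (coordOne n G) Y -
      fderiv ℝ (fun u => leftDeriv n G u Y) (coordOne n G) Z : EuclideanSpace ℝ (Fin n)) := by
  have hpull : ∀ X : GroupLieAlgebra (𝓡 n) G,
      (fun u => mpullbackWithin 𝓘(ℝ, EuclideanSpace ℝ (Fin n)) (𝓡 n)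
        (extChartAt (𝓡 n) (1 : G)).symm (mulInvariantVectorField X) (range (𝓡 n)) u :
        EuclideanSpace ℝ (Fin n) → EuclideanSpace ℝ (Fin n)) =ᶠ[𝓝 (coordOne n G)]
      fun u => leftDeriv n G u X := fun X => by
    filter_upwards [(chartOne n G).open_target.mem_nhds coordOne_mem_target] with u hu
    exact inverse_mfderivWithin_extChartAt_symm hu X
  have h1 := (hpull Y).lieBracket_vectorField_eq (𝕜 := ℝ) (hpull Z)
  have h2 : ∀ V W : EuclideanSpace ℝ (Fin n) → EuclideanSpace ℝ (Fin n),
      lieBracketWithin ℝ V W ((extChartAt (𝓡 n) (1 : G)).symm ⁻¹' univ ∩ range (𝓡 n))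
        (coordOne n G) = lieBracket ℝ V W (coordOne n G) := by
    intro V W
    have : ((extChartAt (𝓡 n) (1 : G)).symm ⁻¹' univ ∩ range (𝓡 n)) = univ := by
      simp [mfld_simps]
    rw [this, lieBracketWithin_univ]
  have h3 : lieBracket ℝ (fun u => leftDeriv n G u Y) (fun u => leftDeriv n G u Z)
      (coordOne n G) = fderiv ℝ (fun u => leftDeriv n G u Z) (coordOne n G) Y -
        fderiv ℝ (fun u => leftDeriv n G u Y) (coordOne n G) Z := by
    rw [lieBracket_eq]
    simp only [leftDeriv_coordOne]
    rfl
  have h4 : ∀ (L : EuclideanSpace ℝ (Fin n) →L[ℝ] EuclideanSpace ℝ (Fin n))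
      (v : EuclideanSpace ℝ (Fin n)), L = ContinuousLinearMap.id ℝ _ → L.inverse v = v := by
    rintro L v rfl
    rw [ContinuousLinearMap.inverse_id]; rfl
  have h5 := mlieBracketWithin_apply (I := 𝓡 n) (V := mulInvariantVectorField Y)
    (W := mulInvariantVectorField Z) (s := univ) (x₀ := (1 : G))
  exact h5.trans ((h4 _ _ mfderiv_extChartAt_one).trans ((h2 _ _).trans (h1.trans h3)))

end Bracket

end SubRiemannian

namespace SubRiemannian

/-! ### The adjoint representation and its differential. -/

section Adjoint

open Filter Topology

variable {n : ℕ} {G : Type*} [TopologicalSpace G] [ChartedSpace (EuclideanSpace ℝ (Fin n)) G]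
  [Group G]

variable (n) in
/-- The conjugation by `g` in the preferred chart at the identity. -/
noncomputable def chartConj (g : G) (v : EuclideanSpace ℝ (Fin n)) : EuclideanSpace ℝ (Fin n) :=
  chartOne n G (g * (chartOne n G).symm v * g⁻¹)

variable (n) in
/-- The adjoint representation, on the model space of the preferred chart at the identity. -/
noncomputable def adjointMap (g : G) : EuclideanSpace ℝ (Fin n) →L[ℝ] EuclideanSpace ℝ (Fin n) :=
  fderiv ℝ (chartConj n g) (coordOne n G)

theorem chartConj_coordOne (g : G) : chartConj n g (coordOne n G) = coordOne n G := by
  rw [chartConj, symm_coordOne, mul_one, mul_inv_cancel]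

theorem adjointMap_one : adjointMap n (1 : G) = ContinuousLinearMap.id ℝ _ := by
  have : chartConj n (1 : G) =ᶠ[𝓝 (coordOne n G)] id := by
    filter_upwards [(chartOne n G).open_target.mem_nhds coordOne_mem_target] with v hv
    rw [chartConj, one_mul, inv_one, mul_one, (chartOne n G).right_inv hv, id]
  rw [adjointMap, this.fderiv_eq, fderiv_id]

variable [LieGroup (𝓡 n) ∞ G]

theorem contDiffAt_chartConj (g : G) : ContDiffAt ℝ ∞ (chartConj n g) (coordOne n G) := by
  have e1 : ContMDiffAt 𝓘(ℝ, EuclideanSpace ℝ (Fin n)) (𝓡 n) ∞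
      (fun v : EuclideanSpace ℝ (Fin n) => g * (chartOne n G).symm v * g⁻¹) (coordOne n G) :=
    (contMDiffAt_const.mul (contMDiffAt_chartOne_symm coordOne_mem_target)).mul contMDiffAt_const
  have hmem : g * (chartOne n G).symm (coordOne n G) * g⁻¹ ∈ (chartOne n G).source := by
    rw [symm_coordOne, mul_one, mul_inv_cancel]; exact one_mem_source
  exact ((contMDiffAt_chartOne hmem).comp (coordOne n G) e1).contDiffAt

theorem hasFDerivAt_chartConj (g : G) :
    HasFDerivAt (chartConj n g) (adjointMap n g) (coordOne n G) :=
  ((contDiffAt_chartConj g).differentiableAt (by simp)).hasFDerivAt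

theorem eventually_conj_mem_source (g : G) :
    ∀ᶠ v in 𝓝 (coordOne n G), g * (chartOne n G).symm v * g⁻¹ ∈ (chartOne n G).source := by
  have : IsTopologicalGroup G := topologicalGroup_of_lieGroup (𝓡 n) ∞
  have hc : ContinuousAt (fun v => g * (chartOne n G).symm v * g⁻¹) (coordOne n G) :=
    (continuousAt_const.mul ((chartOne n G).continuousAt_symm coordOne_mem_target)).mul
      continuousAt_const
  refine hc ((chartOne n G).open_source.mem_nhds ?_)
  simp only
  rw [symm_coordOne, mul_one, mul_inv_cancel]
  exact one_mem_source

theorem adjointMap_mul (g h : G) :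
    adjointMap n (g * h) = (adjointMap n g).comp (adjointMap n h) := by
  have h1 : HasFDerivAt (chartConj n g ∘ chartConj n h) ((adjointMap n g).comp (adjointMap n h))
      (coordOne n G) := by
    refine HasFDerivAt.comp _ ?_ (hasFDerivAt_chartConj h)
    rw [chartConj_coordOne]
    exact hasFDerivAt_chartConj g
  refine (h1.congr_of_eventuallyEq ?_).fderiv
  filter_upwards [eventually_conj_mem_source h] with v hv
  simp only [Function.comp, chartConj]
  rw [(chartOne n G).left_inv hv]
  congr 1
  group

/-- The adjoint map is a partial differential of the map `(u, v) ↦ u v u⁻¹`, which is smooth in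
coordinates near the identity. -/
theorem differentiableAt_adjointMap_symm :
    DifferentiableAt ℝ (fun u => adjointMap n ((chartOne n G).symm u)) (coordOne n G) := by
  set q : EuclideanSpace ℝ (Fin n) × EuclideanSpace ℝ (Fin n) → EuclideanSpace ℝ (Fin n) :=
    fun p => chartConj n ((chartOne n G).symm p.1) p.2 with hq
  have hqs : ∀ u ∈ (chartOne n G).target, ContDiffAt ℝ ∞ q (u, coordOne n G) := by
    intro u hu
    have e1 : ContMDiffAt 𝓘(ℝ, EuclideanSpace ℝ (Fin n) × EuclideanSpace ℝ (Fin n)) (𝓡 n) ∞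
        (fun p : EuclideanSpace ℝ (Fin n) × EuclideanSpace ℝ (Fin n) => (chartOne n G).symm p.1)
        (u, coordOne n G) :=
      (contMDiffAt_chartOne_symm hu).comp (u, coordOne n G) contDiff_fst.contMDiff.contMDiffAt
    have e2 : ContMDiffAt 𝓘(ℝ, EuclideanSpace ℝ (Fin n) × EuclideanSpace ℝ (Fin n)) (𝓡 n) ∞
        (fun p : EuclideanSpace ℝ (Fin n) × EuclideanSpace ℝ (Fin n) => (chartOne n G).symm p.2)
        (u, coordOne n G) :=
      (contMDiffAt_chartOne_symm coordOne_mem_target).comp (u, coordOne n G)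
        contDiff_snd.contMDiff.contMDiffAt
    have hmem : (chartOne n G).symm u * (chartOne n G).symm (coordOne n G) *
        ((chartOne n G).symm u)⁻¹ ∈ (chartOne n G).source := by
      rw [symm_coordOne, mul_one, mul_inv_cancel]; exact one_mem_source
    exact ((contMDiffAt_chartOne hmem).comp (u, coordOne n G) ((e1.mul e2).mul e1.inv)).contDiffAt
  have heq : ∀ u ∈ (chartOne n G).target, adjointMap n ((chartOne n G).symm u) =
      (fderiv ℝ q (u, coordOne n G)).comp
        (ContinuousLinearMap.inr ℝ (EuclideanSpace ℝ (Fin n)) (EuclideanSpace ℝ (Fin n))) :=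
    fun u hu => (((hqs u hu).differentiableAt (by simp)).hasFDerivAt.comp
      (coordOne n G) (hasFDerivAt_prodMk_right u (coordOne n G))).fderiv
  have h2 : ContDiffAt ℝ ∞ (fderiv ℝ q) (coordOne n G, coordOne n G) :=
    (hqs _ coordOne_mem_target).fderiv_right (by simp)
  have h3 := (ContDiffAt.comp (f := fun u => (id u, coordOne n G)) (coordOne n G) h2
    (contDiffAt_id.prodMk (contDiffAt_const (c := coordOne n G)))).clm_comp
    (contDiffAt_const (c := ContinuousLinearMap.inr ℝ (EuclideanSpace ℝ (Fin n))
      (EuclideanSpace ℝ (Fin n))))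
  refine (h3.differentiableAt (by simp)).congr_of_eventuallyEq ?_
  filter_upwards [(chartOne n G).open_target.mem_nhds coordOne_mem_target] with v hv using heq v hv

/-- This is the derivative at `z = 1` of the identity `g z = (g z g⁻¹) g`. -/
theorem fderiv_chartMul_adjointMap {u : EuclideanSpace ℝ (Fin n)} (hu : u ∈ (chartOne n G).target)
    (Z : EuclideanSpace ℝ (Fin n)) :
    fderiv ℝ (chartMul n G) (coordOne n G, u) (adjointMap n ((chartOne n G).symm u) Z, 0) =
      leftDeriv n G u Z := by
  set g := (chartOne n G).symm u with hg
  have h1 : HasFDerivAt (fun v => chartMul n G (chartConj n g v, u))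
      ((fderiv ℝ (chartMul n G) (coordOne n G, u)).comp ((adjointMap n g).prod 0))
      (coordOne n G) := by
    refine HasFDerivAt.comp (g := chartMul n G) (coordOne n G) ?_
      ((hasFDerivAt_chartConj g).prodMk (hasFDerivAt_const u (coordOne n G)))
    rw [chartConj_coordOne]
    exact ((contDiffAt_chartMul_coordOne_left hu).differentiableAt (by simp)).hasFDerivAt
  have h2 : (fun v => chartMul n G (u, v)) =ᶠ[𝓝 (coordOne n G)]
      fun v => chartMul n G (chartConj n g v, u) := by
    filter_upwards [eventually_conj_mem_source g] with v hv
    simp only [chartMul, chartConj]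
    rw [(chartOne n G).left_inv hv, ← hg]
    congr 1
    group
  rw [leftDeriv, h2.fderiv_eq, h1.fderiv]
  rfl

/-- The identity of `fderiv_chartMul_adjointMap` is differentiated in `u` at the identity in the
direction `Y`. Besides the derivative of the adjoint map, its left-hand side yields a mixed second
derivative of the multiplication; by symmetry of second derivatives, this is the derivative of
`leftDeriv · Y` in the direction `Z`. -/
theorem fderiv_adjointMap_symm_apply (Y Z : EuclideanSpace ℝ (Fin n)) :
    fderiv ℝ (fun u => adjointMap n ((chartOne n G).symm u)) (coordOne n G) Y Z =
      fderiv ℝ (fun u => leftDeriv n G u Z) (coordOne n G) Y -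
        fderiv ℝ (fun u => leftDeriv n G u Y) (coordOne n G) Z := by
  set m := chartMul n G with hm
  set c := coordOne n G with hc
  have hsm : ContDiffAt ℝ ∞ m (c, c) := contDiffAt_chartMul_coordOne_left coordOne_mem_target
  have hD2 : DifferentiableAt ℝ (fderiv ℝ m) (c, c) :=
    (hsm.fderiv_right (m := ∞) (by simp)).differentiableAt (by simp)
  have hsymm : IsSymmSndFDerivAt ℝ m (c, c) := hsm.isSymmSndFDerivAt (by
    rw [minSmoothness_of_isRCLikeNormedField]; exact ENat.LEInfty.out)
  have hA := (differentiableAt_adjointMap_symm (n := n) (G := G)).hasFDerivAt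
  set A' := fderiv ℝ (fun u => adjointMap n ((chartOne n G).symm u)) c with hA'
  have hright : ∀ Y' : EuclideanSpace ℝ (Fin n), HasFDerivAt (fun u => leftDeriv n G u Y')
      (((fderiv ℝ (fderiv ℝ m) (c, c)).flip (0, Y')).comp
        (ContinuousLinearMap.inl ℝ (EuclideanSpace ℝ (Fin n)) (EuclideanSpace ℝ (Fin n)))) c := by
    intro Y'
    have h1 : HasFDerivAt (fun u => fderiv ℝ m (u, c))
        ((fderiv ℝ (fderiv ℝ m) (c, c)).comp (ContinuousLinearMap.inl ℝ _ _)) c :=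
      HasFDerivAt.comp (f := fun u => (u, c)) c hD2.hasFDerivAt (hasFDerivAt_prodMk_left c c)
    have h2 := h1.clm_apply (hasFDerivAt_const ((0 : EuclideanSpace ℝ (Fin n)), Y') c)
    have h3 : HasFDerivAt (fun u => fderiv ℝ m (u, c) (0, Y'))
      (((fderiv ℝ (fderiv ℝ m) (c, c)).flip (0, Y')).comp
        (ContinuousLinearMap.inl ℝ (EuclideanSpace ℝ (Fin n)) (EuclideanSpace ℝ (Fin n)))) c := by
      refine h2.congr_fderiv ?_
      ext1 v
      simp
    refine h3.congr_of_eventuallyEq ?_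
    filter_upwards [(chartOne n G).open_target.mem_nhds coordOne_mem_target] with u hu
    rw [leftDeriv_eq hu]
    rfl
  have hleft : HasFDerivAt (fun u => fderiv ℝ m (c, u) (adjointMap n ((chartOne n G).symm u) Z, 0))
      (((fderiv ℝ (fderiv ℝ m) (c, c)).flip (Z, 0)).comp (ContinuousLinearMap.inr ℝ _ _) +
        A'.flip Z) c := by
    have h1 : HasFDerivAt (fun u => fderiv ℝ m (c, u))
        ((fderiv ℝ (fderiv ℝ m) (c, c)).comp (ContinuousLinearMap.inr ℝ _ _)) c :=
      hD2.hasFDerivAt.comp c (hasFDerivAt_prodMk_right c c)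
    have h2 : HasFDerivAt (fun u => adjointMap n ((chartOne n G).symm u) Z) (A'.flip Z) c := by
      refine (hA.clm_apply (hasFDerivAt_const Z c)).congr_fderiv ?_
      ext1 v
      simp
    have h3 := h1.clm_apply (h2.prodMk (hasFDerivAt_const (0 : EuclideanSpace ℝ (Fin n)) c))
    refine h3.congr_fderiv ?_
    have h4 : ∀ v : EuclideanSpace ℝ (Fin n), fderiv ℝ m (c, c) (v, 0) = v := by
      intro v
      have := fderiv_chartMul_adjointMap (coordOne_mem_target (n := n) (G := G)) v
      rwa [symm_coordOne, adjointMap_one, leftDeriv_coordOne] at this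
    have h5 : adjointMap n ((chartOne n G).symm c) Z = Z := by
      rw [hc, symm_coordOne, adjointMap_one]; rfl
    ext1 v
    simp [h4, h5, add_comm]
  have huniq := (hleft.congr_of_eventuallyEq (f₁ := fun u => leftDeriv n G u Z) (by
    filter_upwards [(chartOne n G).open_target.mem_nhds coordOne_mem_target] with u hu
    exact (fderiv_chartMul_adjointMap hu Z).symm)).fderiv
  rw [huniq, (hright Y).fderiv]
  have := hsymm.eq (Z, 0) (0, Y)
  simp [this]

/-- The differential of the adjoint representation at the identity is the Lie bracket. -/
theorem fderiv_adjointMap_symm (Y Z : GroupLieAlgebra (𝓡 n) G) :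
    ⁅Y, Z⁆ = (fderiv ℝ (fun u => adjointMap n ((chartOne n G).symm u)) (coordOne n G) Y Z :
      EuclideanSpace ℝ (Fin n)) :=
  (bracket_eq_fderiv_leftDeriv Y Z).trans (fderiv_adjointMap_symm_apply Y Z).symm

theorem hasDerivAt_adjointMap_comp {γ : ℝ → G} {Y : GroupLieAlgebra (𝓡 n) G} (h0 : γ 0 = 1)
    (hcont : ContinuousAt γ 0)
    (hderiv : HasDerivAt (fun t => chartOne n G (γ t)) (Y : EuclideanSpace ℝ (Fin n)) 0)
    (Z : GroupLieAlgebra (𝓡 n) G) :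
    HasDerivAt (fun s => adjointMap n (γ s) Z)
      ((⁅Y, Z⁆ : GroupLieAlgebra (𝓡 n) G) : EuclideanSpace ℝ (Fin n)) 0 := by
  have hA : HasFDerivAt (fun u => adjointMap n ((chartOne n G).symm u))
      (fderiv ℝ (fun u => adjointMap n ((chartOne n G).symm u)) (coordOne n G))
      (chartOne n G (γ 0)) := by
    rw [h0]
    exact differentiableAt_adjointMap_symm.hasFDerivAt
  have h1 := hA.comp_hasDerivAt (0 : ℝ) hderiv
  have h2 : ∀ Z' : EuclideanSpace ℝ (Fin n),
      HasDerivAt (fun s => adjointMap n ((chartOne n G).symm (chartOne n G (γ s))) Z')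
        (fderiv ℝ (fun u => adjointMap n ((chartOne n G).symm u)) (coordOne n G) Y Z') 0 :=
    fun Z' => (ContinuousLinearMap.apply ℝ (EuclideanSpace ℝ (Fin n))
      Z').hasFDerivAt.comp_hasDerivAt (0 : ℝ) h1
  rw [fderiv_adjointMap_symm Y Z]
  refine (h2 Z).congr_of_eventuallyEq ?_
  have hsrc : ∀ᶠ t in 𝓝 (0 : ℝ), γ t ∈ (chartOne n G).source :=
    hcont ((chartOne n G).open_source.mem_nhds (by rw [h0]; exact one_mem_source))
  filter_upwards [hsrc] with t ht
  rw [(chartOne n G).left_inv ht]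

end Adjoint

end SubRiemannian

namespace SubRiemannian

/-! ### Chow's theorem. -/

section Chow

open Filter Topology

/-- A subspace which contains a generating set of a Lie algebra and is stable under the brackets
with the elements of this set is the whole Lie algebra. -/
theorem eq_top_of_lieSpan_eq_top {L : Type*} [LieRing L] [LieAlgebra ℝ L] {H W : Submodule ℝ L}
    (hHW : H ≤ W) (h : ∀ Y ∈ H, ∀ Z ∈ W, ⁅Y, Z⁆ ∈ W)
    (hspan : LieSubalgebra.lieSpan ℝ L (H : Set L) = ⊤) : W = ⊤ := by
  have key : ∀ Y : L, ∀ Z ∈ W, ⁅Y, Z⁆ ∈ W := by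
    intro Y
    have hY : Y ∈ LieSubalgebra.lieSpan ℝ L (H : Set L) := by rw [hspan]; trivial
    induction hY using LieSubalgebra.lieSpan_induction with
    | mem Y hY => exact h Y hY
    | zero => intro Z _; rw [zero_lie]; exact W.zero_mem
    | add x y _ _ hx hy => intro Z hZ; rw [add_lie]; exact W.add_mem (hx Z hZ) (hy Z hZ)
    | smul a x _ hx => intro Z hZ; rw [smul_lie]; exact W.smul_mem a (hx Z hZ)
    | lie x y _ _ hx hy =>
      intro Z hZ
      rw [lie_lie]
      exact W.sub_mem (hx _ (hy Z hZ)) (hy _ (hx Z hZ))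
  let K : LieSubalgebra ℝ L := { W with lie_mem' := fun {x y} _ hy => key x y hy }
  have hK : LieSubalgebra.lieSpan ℝ L (H : Set L) ≤ K := LieSubalgebra.lieSpan_le.2 hHW
  rw [eq_top_iff]
  intro x _
  have hx : x ∈ LieSubalgebra.lieSpan ℝ L (H : Set L) := by rw [hspan]; trivial
  exact hK hx

theorem HasDerivAt.mem_of_eventually_mem {E : Type*} [NormedAddCommGroup E] [NormedSpace ℝ E]
    [FiniteDimensional ℝ E] {W : Submodule ℝ E} {f : ℝ → E} {f' : E} {t : ℝ}
    (hf : HasDerivAt f f' t) (hmem : ∀ᶠ s in 𝓝 t, f s ∈ W) : f' ∈ W := by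
  have hclosed : IsClosed (W : Set E) := W.closed_of_finiteDimensional
  refine hclosed.mem_of_tendsto (hasDerivAt_iff_tendsto_slope.1 hf) ?_
  filter_upwards [nhdsWithin_le_nhds hmem] with s hs
  exact W.smul_mem _ (W.sub_mem hs hmem.self_of_nhds)

variable {n : ℕ} {G : Type*} [TopologicalSpace G] [ChartedSpace (EuclideanSpace ℝ (Fin n)) G]
  [Group G]

/-- The conjugates of the horizontal vectors by the points at distance less than `ρ` from the
identity. -/
def conjugates (𝓗 : Submodule ℝ (GroupLieAlgebra (𝓡 n) G))
    (Q : LinearMap.BilinForm ℝ (GroupLieAlgebra (𝓡 n) G)) (ρ : ℝ) :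
    Set (EuclideanSpace ℝ (Fin n)) :=
  {v | ∃ h : G, ccDist 𝓗 Q 1 h < ENNReal.ofReal ρ ∧ ∃ X ∈ 𝓗, v = adjointMap n h X}

variable [LieGroup (𝓡 n) ∞ G]
  {𝓗 : Submodule ℝ (GroupLieAlgebra (𝓡 n) G)}
  {Q : LinearMap.BilinForm ℝ (GroupLieAlgebra (𝓡 n) G)}

/-- As the radius decreases to zero the spans decrease, so by finite dimension they are eventually
constant. The limit contains `𝓗`. It is stable under the bracket with `Y ∈ 𝓗`: a curve tangent to
`Y` keeps conjugating vectors of the limit into it, and the derivative of these conjugates is the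
bracket. -/
theorem span_conjugates_eq_top
    (h𝓗 : LieSubalgebra.lieSpan ℝ (GroupLieAlgebra (𝓡 n) G)
      (𝓗 : Set (GroupLieAlgebra (𝓡 n) G)) = ⊤) {r : ℝ} (hr : 0 < r) :
    Submodule.span ℝ (conjugates 𝓗 Q r) = ⊤ := by
  set W : ℝ → Submodule ℝ (EuclideanSpace ℝ (Fin n)) :=
    fun ρ => Submodule.span ℝ (conjugates 𝓗 Q ρ) with hW
  have hmono : Monotone W := fun ρ σ hρσ => Submodule.span_mono fun v hv => by
    obtain ⟨h, hh, hX⟩ := hv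
    exact ⟨h, hh.trans_le (ENNReal.ofReal_le_ofReal hρσ), hX⟩
  obtain ⟨ρ, hρ, hmin⟩ : ∃ ρ : ℝ, 0 < ρ ∧ ∀ σ : ℝ, 0 < σ →
      Module.finrank ℝ (W ρ) ≤ Module.finrank ℝ (W σ) := by
    obtain ⟨ρ, hρ, hmin⟩ := WellFounded.has_min (measure fun ρ => Module.finrank ℝ (W ρ)).wf
      (Ioi (0 : ℝ)) ⟨1, mem_Ioi.2 one_pos⟩
    exact ⟨ρ, hρ, fun σ hσ => not_lt.1 (hmin σ hσ)⟩
  have hstab : ∀ σ, 0 < σ → σ ≤ ρ → W σ = W ρ := fun σ hσ hσρ =>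
    Submodule.eq_of_le_of_finrank_le (hmono hσρ) (hmin σ hσ)
  have h1 : ∀ X ∈ 𝓗, (X : EuclideanSpace ℝ (Fin n)) ∈ W ρ := by
    intro X hX
    refine Submodule.subset_span ⟨1, ?_, X, hX, ?_⟩
    · rw [ccDist_self]; exact ENNReal.ofReal_pos.2 hρ
    · rw [adjointMap_one]; rfl
  have h2 : ∀ Y ∈ 𝓗, ∀ Z : GroupLieAlgebra (𝓡 n) G, (Z : EuclideanSpace ℝ (Fin n)) ∈ W ρ →
      ((⁅Y, Z⁆ : GroupLieAlgebra (𝓡 n) G) : EuclideanSpace ℝ (Fin n)) ∈ W ρ := by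
    intro Y hY Z hZ
    obtain ⟨γ, h0, hcont, hderiv, hdist⟩ := exists_curve_of_mem (Q := Q) hY
    refine HasDerivAt.mem_of_eventually_mem
      (hasDerivAt_adjointMap_comp h0 hcont hderiv.hasDerivAt Z) ?_
    -- Writing `Z` by conjugates of radius `ρ / 2` leaves room for one more factor `γ s` at distance
    -- less than `ρ / 2`.
    rw [← hstab (ρ / 2) (by positivity) (by linarith)] at hZ
    have hsmall : ∀ᶠ s in 𝓝 (0 : ℝ), √(Q Y Y) * |s| < ρ / 2 := by
      have : ContinuousAt (fun s : ℝ => √(Q Y Y) * |s|) 0 := by fun_prop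
      exact this (gt_mem_nhds (by simpa using hρ))
    filter_upwards [hdist, hsmall] with s hs hs'
    have hs2 : ccDist 𝓗 Q 1 (γ s) < ENNReal.ofReal (ρ / 2) :=
      hs.trans_lt ((ENNReal.ofReal_lt_ofReal_iff (by positivity)).2 hs')
    have hle : W (ρ / 2) ≤ (W ρ).comap (adjointMap n (γ s)).toLinearMap := by
      refine Submodule.span_le.2 ?_
      rintro _ ⟨h, hh, X, hX, rfl⟩
      refine Submodule.subset_span ⟨γ s * h, ?_, X, hX, ?_⟩
      · have ht : ccDist 𝓗 Q 1 (γ s * h) ≤ ccDist 𝓗 Q 1 (γ s) + ccDist 𝓗 Q 1 h := by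
          refine (ccDist_triangle (y := γ s)).trans (add_le_add le_rfl ?_)
          have := ccDist_mul_left (𝓗 := 𝓗) (Q := Q) (x := 1) (y := h) (γ s)
          rw [mul_one] at this
          exact this.le
        refine ht.trans_lt ((ENNReal.add_lt_add hs2 hh).trans_le ?_)
        rw [← ENNReal.ofReal_add (by positivity) (by positivity), add_halves]
      · rw [adjointMap_mul]; rfl
    exact hle hZ
  have htop : W ρ = ⊤ :=
    eq_top_of_lieSpan_eq_top (L := GroupLieAlgebra (𝓡 n) G) (H := 𝓗) (W := W ρ) h1 h2 h𝓗
  have h3 : W (min r ρ) = ⊤ := (hstab _ (lt_min hr hρ) (min_le_right _ _)).trans htop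
  exact top_le_iff.1 (h3 ▸ hmono (min_le_left r ρ))

theorem fderiv_chartMul_coordOne (v : EuclideanSpace ℝ (Fin n) × EuclideanSpace ℝ (Fin n)) :
    fderiv ℝ (chartMul n G) (coordOne n G, coordOne n G) v = v.1 + v.2 := by
  have h1 := fderiv_chartMul_adjointMap (coordOne_mem_target (n := n) (G := G)) v.1
  rw [symm_coordOne, adjointMap_one, leftDeriv_coordOne] at h1
  have h2 := congrArg (fun L => L v.2) (leftDeriv_eq (coordOne_mem_target (n := n) (G := G)))
  simp only [leftDeriv_coordOne] at h2
  have h3 : v = (v.1, 0) + (0, v.2) := by simp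
  conv_lhs => rw [h3, map_add]
  exact congrArg₂ (· + ·) h1 h2.symm

theorem hasStrictFDerivAt_chartMul_coordOne :
    HasStrictFDerivAt (chartMul n G) (ContinuousLinearMap.fst ℝ _ _ + ContinuousLinearMap.snd ℝ _ _)
      (coordOne n G, coordOne n G) := by
  have h := (contDiffAt_chartMul_coordOne_left
    (coordOne_mem_target (n := n) (G := G))).hasStrictFDerivAt (by simp)
  have e : fderiv ℝ (chartMul n G) (coordOne n G, coordOne n G) =
      ContinuousLinearMap.fst ℝ _ _ + ContinuousLinearMap.snd ℝ _ _ := by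
    exact ContinuousLinearMap.ext fderiv_chartMul_coordOne
  rwa [e] at h

/-- Products of curves through the identity, in the preferred chart at the identity. -/
theorem hasStrictFDerivAt_chartOne_mul {D : Type*} [NormedAddCommGroup D] [NormedSpace ℝ D]
    {f g : D → G} {f' g' : D →L[ℝ] EuclideanSpace ℝ (Fin n)} {a : D} (hf1 : f a = 1) (hg1 : g a = 1)
    (hfc : ContinuousAt f a) (hgc : ContinuousAt g a)
    (hf : HasStrictFDerivAt (fun s => chartOne n G (f s)) f' a)
    (hg : HasStrictFDerivAt (fun s => chartOne n G (g s)) g' a) :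
    HasStrictFDerivAt (fun s => chartOne n G (f s * g s)) (f' + g') a := by
  have h1 : HasStrictFDerivAt (fun s => chartMul n G (chartOne n G (f s), chartOne n G (g s)))
      (ContinuousLinearMap.comp (ContinuousLinearMap.fst ℝ _ _ + ContinuousLinearMap.snd ℝ _ _)
        (f'.prod g')) a := by
    refine HasStrictFDerivAt.comp (g := chartMul n G) a ?_ (hf.prodMk hg)
    rw [hf1, hg1]
    exact hasStrictFDerivAt_chartMul_coordOne
  have hfs : ∀ᶠ s in 𝓝 a, f s ∈ (chartOne n G).source :=
    hfc ((chartOne n G).open_source.mem_nhds (by rw [hf1]; exact one_mem_source))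
  have hgs : ∀ᶠ s in 𝓝 a, g s ∈ (chartOne n G).source :=
    hgc ((chartOne n G).open_source.mem_nhds (by rw [hg1]; exact one_mem_source))
  refine (h1.congr_of_eventuallyEq ?_).congr_fderiv ?_
  · filter_upwards [hfs, hgs] with s h2 h3
    rw [chartMul, (chartOne n G).left_inv h2, (chartOne n G).left_inv h3]
  · ext1 v; simp

/-- The curve is `h γ(t) h⁻¹`. Its points are reached by going to `h`, following the translate of
`γ`, then undoing `h`; each leg costs at most `ρ`. -/
theorem exists_curve_of_mem_conjugates {ρ : ℝ} (hρ : 0 < ρ) {v : EuclideanSpace ℝ (Fin n)}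
    (hv : v ∈ conjugates 𝓗 Q ρ) :
    ∃ γ : ℝ → G, γ 0 = 1 ∧ ContinuousAt γ 0 ∧
      HasStrictDerivAt (fun t => chartOne n G (γ t)) v 0 ∧
      ∀ᶠ s in 𝓝 (0 : ℝ), ccDist 𝓗 Q 1 (γ s) ≤ ENNReal.ofReal (3 * ρ) := by
  have : IsTopologicalGroup G := topologicalGroup_of_lieGroup (𝓡 n) ∞
  obtain ⟨h, hh, X, hX, rfl⟩ := hv
  obtain ⟨γ, h0, hcont, hderiv, hdist⟩ := exists_curve_of_mem (Q := Q) hX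
  refine ⟨fun t => h * γ t * h⁻¹, by simp [h0],
    (continuousAt_const.mul hcont).mul continuousAt_const, ?_, ?_⟩
  · have h1 : HasStrictFDerivAt (chartConj n h) (adjointMap n h) (chartOne n G (γ 0)) := by
      rw [h0]; exact (contDiffAt_chartConj h).hasStrictFDerivAt (by simp)
    refine (h1.comp_hasStrictDerivAt (0 : ℝ) hderiv).congr_of_eventuallyEq ?_
    have hsrc : ∀ᶠ t in 𝓝 (0 : ℝ), γ t ∈ (chartOne n G).source :=
      hcont ((chartOne n G).open_source.mem_nhds (by rw [h0]; exact one_mem_source))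
    filter_upwards [hsrc] with t ht
    simp only [Function.comp, chartConj]
    rw [(chartOne n G).left_inv ht]
  · have hsmall : ∀ᶠ s in 𝓝 (0 : ℝ), √(Q X X) * |s| < ρ := by
      have : ContinuousAt (fun s : ℝ => √(Q X X) * |s|) 0 := by fun_prop
      exact this (gt_mem_nhds (by simpa using hρ))
    filter_upwards [hdist, hsmall] with s hs hs'
    have hs2 : ccDist 𝓗 Q 1 (γ s) ≤ ENNReal.ofReal ρ :=
      hs.trans (ENNReal.ofReal_le_ofReal hs'.le)
    have e1 : ccDist 𝓗 Q h (h * γ s) = ccDist 𝓗 Q 1 (γ s) := by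
      have := ccDist_mul_left (𝓗 := 𝓗) (Q := Q) (x := 1) (y := γ s) h
      rwa [mul_one] at this
    have e2 : ccDist 𝓗 Q (h * γ s) (h * γ s * h⁻¹) = ccDist 𝓗 Q 1 h := by
      have := ccDist_mul_left (𝓗 := 𝓗) (Q := Q) (x := h) (y := 1) (h * γ s * h⁻¹)
      rw [inv_mul_cancel_right, mul_one] at this
      rw [this, ccDist_comm]
    calc ccDist 𝓗 Q 1 (h * γ s * h⁻¹)
        ≤ ccDist 𝓗 Q 1 h + (ccDist 𝓗 Q h (h * γ s) + ccDist 𝓗 Q (h * γ s) (h * γ s * h⁻¹)) :=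
          (ccDist_triangle (y := h)).trans (add_le_add le_rfl (ccDist_triangle (y := h * γ s)))
      _ ≤ ENNReal.ofReal ρ + (ENNReal.ofReal ρ + ENNReal.ofReal ρ) := by
          rw [e1, e2]
          exact add_le_add hh.le (add_le_add hs2 hh.le)
      _ = ENNReal.ofReal (3 * ρ) := by
          rw [← ENNReal.ofReal_add hρ.le hρ.le, ← ENNReal.ofReal_add hρ.le (by positivity)]
          congr 1
          ring

theorem exists_map_of_mem_conjugates {ρ : ℝ} (hρ : 0 < ρ) {ι : Type*} [Fintype ι]
    {v : ι → EuclideanSpace ℝ (Fin n)} (hv : ∀ i, v i ∈ conjugates 𝓗 Q ρ) (T : Finset ι) :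
    ∃ F : (ι → ℝ) → G, F 0 = 1 ∧ ContinuousAt F 0 ∧
      HasStrictFDerivAt (fun s => chartOne n G (F s))
        (∑ i ∈ T, (ContinuousLinearMap.proj (R := ℝ) (φ := fun _ : ι => ℝ) i).smulRight (v i)) 0 ∧
      ∀ᶠ s in 𝓝 (0 : ι → ℝ), ccDist 𝓗 Q 1 (F s) ≤ T.card * ENNReal.ofReal (3 * ρ) := by
  classical
  have : IsTopologicalGroup G := topologicalGroup_of_lieGroup (𝓡 n) ∞
  induction T using Finset.induction_on with
  | empty =>
    refine ⟨fun _ => 1, rfl, continuousAt_const, ?_, Eventually.of_forall fun s => ?_⟩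
    · simpa using hasStrictFDerivAt_const _ _
    · rw [ccDist_self]; exact zero_le
  | insert i T hi ih =>
    obtain ⟨F, hF0, hFc, hFd, hFdist⟩ := ih
    obtain ⟨γ, h0, hcont, hderiv, hdist⟩ := exists_curve_of_mem_conjugates hρ (hv i)
    have hp : ContinuousAt (fun s : ι → ℝ => s i) 0 := (continuous_apply i).continuousAt
    have hgc : ContinuousAt (fun s : ι → ℝ => γ (s i)) 0 :=
      ContinuousAt.comp (g := γ) (f := fun s : ι → ℝ => s i) hcont hp
    have hgd : HasStrictFDerivAt (fun s : ι → ℝ => chartOne n G (γ (s i)))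
        ((ContinuousLinearMap.proj (R := ℝ) (φ := fun _ : ι => ℝ) i).smulRight (v i)) 0 := by
      have h1 := HasStrictFDerivAt.comp (g := fun t => chartOne n G (γ t))
        (f := fun s : ι → ℝ => s i) 0 hderiv.hasStrictFDerivAt
        (ContinuousLinearMap.proj (R := ℝ) (φ := fun _ : ι => ℝ) i).hasStrictFDerivAt
      refine h1.congr_fderiv ?_
      ext1 s
      simp
    refine ⟨fun s => γ (s i) * F s, ?_, hgc.mul hFc, ?_, ?_⟩
    · simp [h0, hF0]
    · rw [Finset.sum_insert hi]
      exact hasStrictFDerivAt_chartOne_mul h0 hF0 hgc hFc hgd hFd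
    · filter_upwards [hFdist, hp.eventually hdist] with s hs1 hs2
      have e1 : ccDist 𝓗 Q (γ (s i)) (γ (s i) * F s) = ccDist 𝓗 Q 1 (F s) := by
        have := ccDist_mul_left (𝓗 := 𝓗) (Q := Q) (x := 1) (y := F s) (γ (s i))
        rwa [mul_one] at this
      refine (ccDist_triangle (y := γ (s i))).trans ?_
      rw [e1, Finset.card_insert_of_notMem hi, Nat.cast_add, Nat.cast_one, add_mul, one_mul,
        add_comm]
      exact add_le_add hs1 hs2

/-- The Carnot–Carathéodory balls centred at the identity are neighbourhoods of the identity. -/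
theorem setOf_ccDist_lt_mem_nhds
    (h𝓗 : LieSubalgebra.lieSpan ℝ (GroupLieAlgebra (𝓡 n) G)
      (𝓗 : Set (GroupLieAlgebra (𝓡 n) G)) = ⊤) {r : ℝ} (hr : 0 < r) :
    {y | ccDist 𝓗 Q 1 y < ENNReal.ofReal r} ∈ 𝓝 (1 : G) := by
  -- A product of `n` curves, each at distance at most `3 * ρ`, stays within `r * n / (n + 1) < r`;
  -- the `+ 1` also covers `n = 0`.
  set ρ : ℝ := r / (3 * (n + 1)) with hρ
  have hρ0 : 0 < ρ := by positivity
  obtain ⟨v, hv, hspan, -⟩ := Submodule.exists_fun_fin_finrank_span_eq ℝ (conjugates 𝓗 Q ρ)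
  replace hspan := hspan.trans (span_conjugates_eq_top h𝓗 hρ0)
  have hcard : Module.finrank ℝ (Submodule.span ℝ (conjugates 𝓗 Q ρ)) = n := by
    rw [span_conjugates_eq_top h𝓗 hρ0, finrank_top, finrank_euclideanSpace_fin]
  obtain ⟨F, hF0, hFc, hFd, hFdist⟩ := exists_map_of_mem_conjugates hρ0 hv Finset.univ
  -- The differential of the product of curves maps the coordinate vectors to a basis, so the
  -- product is open at the origin in coordinates.
  have hsurj := hFd.map_nhds_eq_of_surj (by
    rw [eq_top_iff, ← hspan]
    refine Submodule.span_le.2 ?_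
    rintro _ ⟨i, rfl⟩
    refine ⟨Pi.single i 1, ?_⟩
    simp [Pi.single_apply])
  rw [hF0] at hsurj
  have hsrc : ∀ᶠ s in 𝓝 0, F s ∈ (chartOne n G).source :=
    hFc ((chartOne n G).open_source.mem_nhds (by rw [hF0]; exact one_mem_source))
  have himage := image_mem_map (m := fun s => chartOne n G (F s)) (hFdist.and hsrc)
  rw [hsurj] at himage
  have hpre := (chartOne n G).continuousAt (one_mem_source (n := n) (G := G)) himage
  filter_upwards [hpre, (chartOne n G).open_source.mem_nhds one_mem_source] with y hy hys
  obtain ⟨s, ⟨hs1, hs2⟩, hs3⟩ := hy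
  rw [← (chartOne n G).injOn hs2 hys hs3]
  refine hs1.trans_lt ?_
  rw [Finset.card_univ, Fintype.card_fin, hcard, ← ENNReal.ofReal_natCast,
    ← ENNReal.ofReal_mul (by positivity), ENNReal.ofReal_lt_ofReal_iff hr, hρ]
  have : (n : ℝ) * (3 * (r / (3 * (n + 1)))) = r * (n / (n + 1)) := by field_simp
  rw [this]
  refine mul_lt_of_lt_one_right hr ((div_lt_one (by positivity)).2 (lt_add_one _))

end Chow

end SubRiemannian

namespace SubRiemannian

/-! ### Topology and compactness of the balls. -/

section Balls

open Filter Topology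
open scoped Pointwise

variable {n : ℕ} {G : Type*} [TopologicalSpace G] [ChartedSpace (EuclideanSpace ℝ (Fin n)) G]
  [Group G] [LieGroup (𝓡 n) ∞ G]
  {𝓗 : Submodule ℝ (GroupLieAlgebra (𝓡 n) G)}
  {Q : LinearMap.BilinForm ℝ (GroupLieAlgebra (𝓡 n) G)}

theorem ccDist_eq_ccDist_one (x y : G) : ccDist 𝓗 Q x y = ccDist 𝓗 Q 1 (x⁻¹ * y) := by
  have := ccDist_mul_left (𝓗 := 𝓗) (Q := Q) (x := x) (y := y) x⁻¹
  rw [inv_mul_cancel] at this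
  exact this.symm

theorem ccBall_eq_preimage (x : G) (r : ℝ) :
    ccBall 𝓗 Q x r = (fun y => x⁻¹ * y) ⁻¹' ccBall 𝓗 Q 1 r := by
  ext y
  simp only [ccBall, mem_preimage, mem_ofPred_eq]
  rw [ccDist_eq_ccDist_one]

theorem ccBall_mem_nhds
    (h𝓗 : LieSubalgebra.lieSpan ℝ (GroupLieAlgebra (𝓡 n) G)
      (𝓗 : Set (GroupLieAlgebra (𝓡 n) G)) = ⊤) (x : G) {r : ℝ} (hr : 0 < r) :
    ccBall 𝓗 Q x r ∈ 𝓝 x := by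
  have : IsTopologicalGroup G := topologicalGroup_of_lieGroup (𝓡 n) ∞
  rw [ccBall_eq_preimage]
  have hc : ContinuousAt (fun y => x⁻¹ * y) x := (continuous_const_mul x⁻¹).continuousAt
  refine hc ?_
  simp only [inv_mul_cancel]
  exact setOf_ccDist_lt_mem_nhds h𝓗 hr

theorem isOpen_ccBall
    (h𝓗 : LieSubalgebra.lieSpan ℝ (GroupLieAlgebra (𝓡 n) G)
      (𝓗 : Set (GroupLieAlgebra (𝓡 n) G)) = ⊤) (x : G) (r : ℝ) : IsOpen (ccBall 𝓗 Q x r) := by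
  refine isOpen_iff_mem_nhds.2 fun y hy => ?_
  obtain ⟨ε, hε, hlt⟩ := ENNReal.lt_iff_exists_add_pos_lt.1 hy
  refine mem_of_superset (ccBall_mem_nhds (Q := Q) h𝓗 y (NNReal.coe_pos.2 hε)) fun z hz => ?_
  refine ccDist_triangle.trans_lt ((add_le_add le_rfl (le_of_lt hz)).trans_lt ?_)
  rwa [ENNReal.ofReal_coe_nnreal]

theorem exists_ccBall_subset [T2Space G] (hQpos : ∀ X, X ≠ 0 → 0 < Q X X) {x : G} {U : Set G}
    (hU : U ∈ 𝓝 x) : ∃ r : ℝ, 0 < r ∧ ccBall 𝓗 Q x r ⊆ U := by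
  have : IsTopologicalGroup G := topologicalGroup_of_lieGroup (𝓡 n) ∞
  have hU' : (fun y => x * y) ⁻¹' U ∈ 𝓝 (1 : G) := by
    have hc : ContinuousAt (fun y => x * y) (1 : G) := (continuous_const_mul x).continuousAt
    exact hc (by simpa using hU)
  obtain ⟨r, hr, h⟩ := exists_ccDist_lt_imp_mem (𝓗 := 𝓗) hQpos hU'
  refine ⟨r, hr, fun y hy => ?_⟩
  rw [ccBall_eq_preimage] at hy
  simpa using h _ hy

/-- The points at finite distance from the identity form a subgroup which is a neighbourhood of the
identity, hence open and closed. -/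
theorem ccDist_ne_top [ConnectedSpace G]
    (h𝓗 : LieSubalgebra.lieSpan ℝ (GroupLieAlgebra (𝓡 n) G)
      (𝓗 : Set (GroupLieAlgebra (𝓡 n) G)) = ⊤) (x y : G) : ccDist 𝓗 Q x y ≠ ⊤ := by
  have : IsTopologicalGroup G := topologicalGroup_of_lieGroup (𝓡 n) ∞
  let S : Subgroup G :=
    { carrier := {y | ccDist 𝓗 Q 1 y < ⊤}
      one_mem' := by
        rw [mem_ofPred_eq, ccDist_self]; exact ENNReal.zero_lt_top
      mul_mem' := fun {a b} ha hb => by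
        refine (ccDist_triangle (y := a)).trans_lt (ENNReal.add_lt_top.2 ⟨ha, ?_⟩)
        rw [ccDist_eq_ccDist_one, inv_mul_cancel_left]
        exact hb
      inv_mem' := fun {a} ha => by
        have h : ccDist 𝓗 Q 1 a⁻¹ = ccDist 𝓗 Q 1 a := by
          rw [ccDist_comm, ccDist_eq_ccDist_one, inv_inv, mul_one]
        rw [mem_ofPred_eq, h]
        exact ha }
  have hnhds : (S : Set G) ∈ 𝓝 (1 : G) :=
    mem_of_superset (ccBall_mem_nhds (Q := Q) h𝓗 1 one_pos) fun y hy =>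
      lt_of_lt_of_le (show ccDist 𝓗 Q 1 y < ENNReal.ofReal 1 from hy) le_top
  have hopen := S.isOpen_of_mem_nhds hnhds
  have huniv : (S : Set G) = univ :=
    IsClopen.eq_univ ⟨S.isClosed_of_isOpen hopen, hopen⟩ ⟨1, S.one_mem⟩
  have hmem : x⁻¹ * y ∈ (S : Set G) := by rw [huniv]; trivial
  rw [ccDist_eq_ccDist_one]
  exact ne_of_lt hmem

/-- By the length property and left invariance, the ball of radius `(k + 1) * ρ` about the identity
is contained in a product of `k + 1` copies of a compact neighbourhood of the identity. -/
theorem exists_isCompact_ccBall_subset [T2Space G] (hQpos : ∀ X, X ≠ 0 → 0 < Q X X) (x : G)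
    (r : ℝ) : ∃ K, IsCompact K ∧ ccBall 𝓗 Q x r ⊆ K := by
  have : IsTopologicalGroup G := topologicalGroup_of_lieGroup (𝓡 n) ∞
  have : LocallyCompactSpace G := Manifold.locallyCompact_of_finiteDimensional (𝓡 n)
  obtain ⟨K₀, hK₀, hK₀n⟩ := exists_compact_mem_nhds (1 : G)
  obtain ⟨ρ, hρ, hsub⟩ := exists_ccBall_subset (𝓗 := 𝓗) hQpos hK₀n
  have key : ∀ k : ℕ, ∃ K, IsCompact K ∧ ccBall 𝓗 Q 1 ((k + 1) * ρ) ⊆ K := by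
    intro k
    induction k with
    | zero => exact ⟨K₀, hK₀, by simpa using hsub⟩
    | succ k ih =>
      obtain ⟨K, hK, hKs⟩ := ih
      refine ⟨K * K₀, hK.mul hK₀, fun y hy => ?_⟩
      have hy' : ccDist 𝓗 Q 1 y < ENNReal.ofReal ((k + 1) * ρ) + ENNReal.ofReal ρ := by
        rw [← ENNReal.ofReal_add (by positivity) hρ.le]
        refine lt_of_lt_of_le hy (ENNReal.ofReal_le_ofReal (le_of_eq ?_))
        push_cast
        ring
      obtain ⟨z, hz1, hz2⟩ := exists_ccDist_split
        (ENNReal.ofReal_pos.2 (by positivity)) (ENNReal.ofReal_pos.2 hρ) hy'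
      rw [ccDist_eq_ccDist_one] at hz2
      exact ⟨z, hKs hz1, z⁻¹ * y, hsub hz2, mul_inv_cancel_left z y⟩
  obtain ⟨k, hk⟩ := exists_nat_gt (r / ρ)
  obtain ⟨K, hK, hKs⟩ := key k
  refine ⟨(fun y => x * y) '' K, hK.image (continuous_const_mul x), fun y hy => ?_⟩
  rw [ccBall_eq_preimage] at hy
  refine ⟨x⁻¹ * y, hKs (lt_of_lt_of_le hy (ENNReal.ofReal_le_ofReal ?_)), mul_inv_cancel_left x y⟩
  have := (div_lt_iff₀ hρ).1 hk
  nlinarith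

/-- The Carnot–Carathéodory distance as a metric structure compatible with the topology. -/
noncomputable abbrev ccPseudoMetricSpace [T2Space G] [ConnectedSpace G]
    (hQpos : ∀ X, X ≠ 0 → 0 < Q X X)
    (h𝓗 : LieSubalgebra.lieSpan ℝ (GroupLieAlgebra (𝓡 n) G)
      (𝓗 : Set (GroupLieAlgebra (𝓡 n) G)) = ⊤) : PseudoMetricSpace G :=
  PseudoMetricSpace.ofDistTopology (fun x y => (ccDist 𝓗 Q x y).toReal)
    (fun x => by rw [ccDist_self, ENNReal.toReal_zero])
    (fun x y => by rw [ccDist_comm])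
    (fun x y z => by
      rw [← ENNReal.toReal_add (ccDist_ne_top h𝓗 x y) (ccDist_ne_top h𝓗 y z)]
      exact ENNReal.toReal_mono
        (ENNReal.add_ne_top.2 ⟨ccDist_ne_top h𝓗 x y, ccDist_ne_top h𝓗 y z⟩) ccDist_triangle)
    (fun s => by
      have hball : ∀ x y r, (ccDist 𝓗 Q x y).toReal < r ↔ y ∈ ccBall 𝓗 Q x r := fun x y r =>
        (ENNReal.lt_ofReal_iff_toReal_lt (ccDist_ne_top h𝓗 x y)).symm
      simp only [hball]
      refine ⟨fun hs x hx => ?_, fun hs => isOpen_iff_mem_nhds.2 fun x hx => ?_⟩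
      · exact exists_ccBall_subset hQpos (hs.mem_nhds hx)
      · obtain ⟨r, hr, h⟩ := hs x hx
        exact mem_of_superset (ccBall_mem_nhds h𝓗 x hr) h)

theorem cond3_of_cond1_ccBall [T2Space G] [SecondCountableTopology G] [ConnectedSpace G]
    [MeasurableSpace G] [BorelSpace G] {μ : Measure G}
    (hQpos : ∀ X, X ≠ 0 → 0 < Q X X)
    (h𝓗 : LieSubalgebra.lieSpan ℝ (GroupLieAlgebra (𝓡 n) G)
      (𝓗 : Set (GroupLieAlgebra (𝓡 n) G)) = ⊤) {R : ℝ} {w : G → ℝ}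
    (hinv : ∀ x y r, μ (ccBall 𝓗 Q x r) = μ (ccBall 𝓗 Q y r))
    (hpos : ∀ x r, 0 < r → μ (ccBall 𝓗 Q x r) ≠ 0) (hfin : ∀ x r, μ (ccBall 𝓗 Q x r) ≠ ⊤)
    (hwfin : ∀ x r, weightMeasure μ w (ccBall 𝓗 Q x r) ≠ ⊤)
    (hw : LocallyIntegrable w μ) (hw0 : ∀ᵐ x ∂μ, 0 ≤ w x)
    (hdouble : FiveDoubling (ccBall 𝓗 Q) μ w R) (h1 : Cond1 (ccBall 𝓗 Q) μ w R) :
    Cond3 (ccBall 𝓗 Q) μ w R := by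
  -- This metric induces the given topology, so the Borel structure and second countability remain
  -- valid for it.
  let _ : PseudoMetricSpace G := ccPseudoMetricSpace hQpos h𝓗
  have hdist : ∀ x y : G, dist x y = (ccDist 𝓗 Q x y).toReal := fun _ _ => rfl
  have hball : (ccBall 𝓗 Q : G → ℝ → Set G) = Metric.ball := by
    ext x r y
    rw [Metric.mem_ball, dist_comm, hdist,
      ← ENNReal.lt_ofReal_iff_toReal_lt (ccDist_ne_top h𝓗 x y)]
    rfl
  have hlen : LengthProperty G := by
    intro x y a b ha hb h
    rw [hdist, ← ENNReal.lt_ofReal_iff_toReal_lt (ccDist_ne_top h𝓗 x y),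
      ENNReal.ofReal_add ha.le hb.le] at h
    obtain ⟨z, hz1, hz2⟩ := exists_ccDist_split (ENNReal.ofReal_pos.2 ha)
      (ENNReal.ofReal_pos.2 hb) h
    exact ⟨z, (ENNReal.lt_ofReal_iff_toReal_lt (ccDist_ne_top h𝓗 x z)).1 hz1,
      (ENNReal.lt_ofReal_iff_toReal_lt (ccDist_ne_top h𝓗 z y)).1 hz2⟩
  rw [hball] at hinv hpos hfin hwfin hdouble h1 ⊢
  exact cond3_of_cond1 hlen hinv hpos hfin hwfin hw hw0 hdouble h1

theorem weightMeasure_lt_top_of_isCompact {X : Type*} [TopologicalSpace X] [T2Space X]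
    [MeasurableSpace X] [BorelSpace X] {μ : Measure X} {w : X → ℝ} (hw : LocallyIntegrable w μ)
    {K : Set X} (hK : IsCompact K) : weightMeasure μ w K < ⊤ := by
  rw [weightMeasure, withDensity_apply _ hK.isClosed.measurableSet]
  refine lt_of_le_of_lt (lintegral_mono fun x => ?_) (hw.integrableOn_isCompact hK).2
  rw [← ofReal_norm]
  exact ENNReal.ofReal_le_ofReal (Real.le_norm_self _)

end Balls

end SubRiemannian

/-! ### The equivalence for Carnot–Carathéodory balls. -/

theorem proposition6p1
    {n : ℕ} {G : Type*} [TopologicalSpace G] [T2Space G] [SecondCountableTopology G]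
    [ChartedSpace (EuclideanSpace ℝ (Fin n)) G] [Group G] [LieGroup (𝓡 n) ∞ G]
    [ConnectedSpace G] [NoncompactSpace G]
    [MeasurableSpace G] [BorelSpace G] (μ : Measure G) [μ.IsHaarMeasure]
    (Q : LinearMap.BilinForm ℝ (GroupLieAlgebra (𝓡 n) G))
    (hQsymm : ∀ X Y, Q X Y = Q Y X) (hQpos : ∀ X, X ≠ 0 → 0 < Q X X)
    (𝓗 : Submodule ℝ (GroupLieAlgebra (𝓡 n) G))
    (h𝓗 : LieSubalgebra.lieSpan ℝ (GroupLieAlgebra (𝓡 n) G) (𝓗 : Set (GroupLieAlgebra (𝓡 n) G)) = ⊤)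
    (R : ℝ) (hR : 0 < R)
    (w : G → ℝ) (hw : LocallyIntegrable w μ) (hw_nonneg : ∀ᵐ x ∂μ, 0 ≤ w x)
    (hw_ne : ¬ w =ᵐ[μ] 0) :
    (Cond4 (ccBall 𝓗 Q) μ w R → Cond1 (ccBall 𝓗 Q) μ w R) ∧
    (Cond3 (ccBall 𝓗 Q) μ w R → Cond2 (ccBall 𝓗 Q) μ w R) ∧
    (Cond2 (ccBall 𝓗 Q) μ w R → Cond1 (ccBall 𝓗 Q) μ w R) ∧
    (Cond3 (ccBall 𝓗 Q) μ w R → Cond4 (ccBall 𝓗 Q) μ w R) ∧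
    (FiveDoubling (ccBall 𝓗 Q) μ w R →
      [Cond1 (ccBall 𝓗 Q) μ w R, Cond2 (ccBall 𝓗 Q) μ w R,
        Cond3 (ccBall 𝓗 Q) μ w R, Cond4 (ccBall 𝓗 Q) μ w R].TFAE) := by

  have : IsTopologicalGroup G := topologicalGroup_of_lieGroup (𝓡 n) ∞
  have hmeas : ∀ x r, MeasurableSet (ccBall 𝓗 Q x r) := fun x r =>
    (isOpen_ccBall h𝓗 x r).measurableSet
  have hpos : ∀ x r, 0 < r → μ (ccBall 𝓗 Q x r) ≠ 0 := fun x r hr =>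
    (Measure.measure_pos_of_mem_nhds μ (ccBall_mem_nhds h𝓗 x hr)).ne'
  have hfin : ∀ x r, μ (ccBall 𝓗 Q x r) ≠ ⊤ := fun x r => by
    obtain ⟨K, hK, hsub⟩ := exists_isCompact_ccBall_subset (𝓗 := 𝓗) hQpos x r
    exact ((measure_mono hsub).trans_lt hK.measure_lt_top).ne
  have hwfin : ∀ x r, weightMeasure μ w (ccBall 𝓗 Q x r) ≠ ⊤ := fun x r => by
    obtain ⟨K, hK, hsub⟩ := exists_isCompact_ccBall_subset (𝓗 := 𝓗) hQpos x r
    exact ((measure_mono hsub).trans_lt (weightMeasure_lt_top_of_isCompact hw hK)).ne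
  have hinv : ∀ x y r, μ (ccBall 𝓗 Q x r) = μ (ccBall 𝓗 Q y r) := fun x y r => by
    rw [ccBall_eq_preimage x, ccBall_eq_preimage y, measure_preimage_mul, measure_preimage_mul]
  have hwm : AEMeasurable w μ := hw.aestronglyMeasurable.aemeasurable
  have h41 : Cond4 (ccBall 𝓗 Q) μ w R → Cond1 (ccBall 𝓗 Q) μ w R :=
    cond1_of_cond4 hmeas hpos hfin hwfin hwm
  have h32 : Cond3 (ccBall 𝓗 Q) μ w R → Cond2 (ccBall 𝓗 Q) μ w R :=
    cond2_of_cond3 hpos hmeas hfin hwfin hwm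
  have h21 : Cond2 (ccBall 𝓗 Q) μ w R → Cond1 (ccBall 𝓗 Q) μ w R :=
    cond1_of_cond2 hmeas hpos hfin hwfin
  have h34 : Cond3 (ccBall 𝓗 Q) μ w R → Cond4 (ccBall 𝓗 Q) μ w R :=
    cond4_of_cond3 hpos hmeas hfin hwfin hwm
  refine ⟨h41, h32, h21, h34, fun hdouble => ?_⟩
  have h13 : Cond1 (ccBall 𝓗 Q) μ w R → Cond3 (ccBall 𝓗 Q) μ w R :=
    cond3_of_cond1_ccBall hQpos h𝓗 hinv hpos hfin hwfin hw hw_nonneg hdouble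
  tfae_have 1 → 3 := h13
  tfae_have 3 → 2 := h32
  tfae_have 2 → 1 := h21
  tfae_have 3 → 4 := h34
  tfae_have 4 → 1 := h41
  tfae_finish
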